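/- Let $H$ be a separable real Hilbert space, let $A$ generate a strongly continuous semigroup $(S(t))_{t\ge 0}$ on $H$, and let $Q$ be a bounded selfadjoint nonnegative operator on $H$. For $t\le\infty$ put $Q_t x=\int_0^t S(s)QS^*(s)x\,ds$. Assume that \[\int_0^\infty \mathrm{tr}\big(S(s)QS^*(s)\big)\,ds<\infty\] and that $Q_\infty$ is injective. Let $\mu=N(0,Q_\infty)$ be the centered Gaussian measure on $H$ with covariance operator $Q_\infty$, and let $(R_t)_{t\ge 0}$ be the Ornstein–Uhlenbeck transition semigroup of the equation $dZ=AZ\,dt+Q^{1/2}dW$, that is, $R_t\phi(x)=\int_H\phi\,dN(S(t)x,Q_t)$ for bounded Borel functions $\phi:H\to\mathbb R$. Assume that $(R_t)$ is symmetric, that is, $\int_H\psi\,R_t\phi\,d\mu=\int_H\phi\,R_t\psi\,d\mu$ for all $t\ge 0$ and all bounded Borel functions $\phi,\psi$. Then $R_t$ extends uniquely from bounded Borel functions to a bounded operator on $L^2(H,\mu)$, still denoted by $R_t$; the operator $Q^{1/2}$ is injective; and for every $t\ge 0$ there is a unique bounded operator $S_Q(t)=Q^{-1/2}S(t)Q^{1/2}$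 on $H$ with $Q^{1/2}S_Q(t)=S(t)Q^{1/2}$. Moreover: (a) The following conditions are equivalent: (i) $R_t$ is a Hilbert–Schmidt operator on $L^2(H,\mu)$ for every $t>0$; (ii) $S_Q(t)$ is a Hilbert–Schmidt operator on $H$ for every $t>0$, and $(S_Q(t))$ is exponentially stable: there are constants $M$ and $\beta>0$ with $\|S_Q(t)\|\le Me^{-\beta t}$ for all $t\ge 0$. (b) $\mu\big(Q^{1/2}(H)\big)=1$ if and only if $S_Q(t)$ is a Hilbert–Schmidt operator for every $t>0$ and \[\int_0^\infty\|S_Q(t)\|_{HS}^2\,dt<\infty .\] -/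

import Mathlib

open MeasureTheory Set Filter Topology
open scoped ENNReal RealInnerProductSpace

namespace OrnsteinUhlenbeck

section Operators

variable {E : Type*} [NormedAddCommGroup E] [InnerProductSpace ℝ E] [CompleteSpace E]

/-! ### Positive square root -/

/-- A positive operator of norm at most one satisfies `‖A x‖ ^ 2 ≤ ⟪A x, x⟫`. -/
theorem sq_norm_le_inner {A : E →L[ℝ] E} (hA : A.IsPositive) (h1 : ‖A‖ ≤ 1) (x : E) :
    ‖A x‖ ^ 2 ≤ ⟪A x, x⟫ := by
  have h := hA.inner_nonneg_left (x - A x)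
  have hs : ⟪A (A x), x⟫ = ‖A x‖ ^ 2 := by
    rw [hA.inner_left_eq_inner_right, real_inner_self_eq_norm_sq]
  have hb : ⟪A (A x), A x⟫ ≤ ‖A x‖ ^ 2 := by
    refine (real_inner_le_norm _ _).trans ?_
    have := (A.le_opNorm (A x)).trans (mul_le_of_le_one_left (norm_nonneg _) h1)
    nlinarith [norm_nonneg (A x)]
  have he : ⟪A x, A x⟫ = ‖A x‖ ^ 2 := real_inner_self_eq_norm_sq _
  simp only [map_sub, inner_sub_left, inner_sub_right, hs, he] at h
  linarith

/-- The iteration `y₀ = 0`, `yₙ₊₁ = (X + yₙ ^ 2) / 2`, which approximates `1 - √(1 - X)`. -/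
noncomputable def sqrtPoly : ℕ → Polynomial ℝ
  | 0 => 0
  | n + 1 => Polynomial.C (1 / 2) * (Polynomial.X + sqrtPoly n ^ 2)

theorem coeff_mul_nonneg {p q : Polynomial ℝ} (hp : ∀ k, 0 ≤ p.coeff k)
    (hq : ∀ k, 0 ≤ q.coeff k) (k : ℕ) : 0 ≤ (p * q).coeff k := by
  rw [Polynomial.coeff_mul]
  exact Finset.sum_nonneg fun i _ => mul_nonneg (hp _) (hq _)

theorem coeff_sqrtPoly_nonneg (n k : ℕ) : 0 ≤ (sqrtPoly n).coeff k := by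
  induction n generalizing k with
  | zero => simp [sqrtPoly]
  | succ n ih =>
    rw [sqrtPoly, Polynomial.coeff_C_mul, Polynomial.coeff_add, pow_two, Polynomial.coeff_X]
    have := coeff_mul_nonneg ih ih k
    split_ifs <;> linarith

theorem coeff_sqrtPoly_sub_nonneg (n k : ℕ) :
    0 ≤ (sqrtPoly (n + 1) - sqrtPoly n).coeff k := by
  induction n generalizing k with
  | zero =>
    have := coeff_sqrtPoly_nonneg 1 k
    simpa [sqrtPoly] using this
  | succ n ih =>
    have h : sqrtPoly (n + 1 + 1) - sqrtPoly (n + 1) = Polynomial.C (1 / 2) *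
        ((sqrtPoly (n + 1) + sqrtPoly n) * (sqrtPoly (n + 1) - sqrtPoly n)) := by
      conv_lhs => rw [sqrtPoly]
      conv_lhs => rw [show sqrtPoly (n + 1) = Polynomial.C (1 / 2) * (Polynomial.X + sqrtPoly n ^ 2)
        from rfl]
      rw [show sqrtPoly (n + 1) = Polynomial.C (1 / 2) * (Polynomial.X + sqrtPoly n ^ 2) from rfl]
      ring
    rw [h, Polynomial.coeff_C_mul]
    refine mul_nonneg (by norm_num) (coeff_mul_nonneg (fun j => ?_) ih k)
    rw [Polynomial.coeff_add]
    exact add_nonneg (coeff_sqrtPoly_nonneg _ _) (coeff_sqrtPoly_nonneg _ _)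

theorem norm_aeval_le {p : Polynomial ℝ} (hp : ∀ k, 0 ≤ p.coeff k) {B : E →L[ℝ] E}
    (hB : ‖B‖ ≤ 1) : ‖Polynomial.aeval B p‖ ≤ p.eval 1 := by
  rw [Polynomial.aeval_eq_sum_range, Polynomial.eval_eq_sum_range]
  refine (norm_sum_le _ _).trans (Finset.sum_le_sum fun k _ => ?_)
  rw [norm_smul, Real.norm_of_nonneg (hp k)]
  refine mul_le_mul_of_nonneg_left ?_ (hp k)
  rw [one_pow]
  rcases Nat.eq_zero_or_pos k with rfl | hk
  · exact ContinuousLinearMap.norm_id_le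
  · exact (norm_pow_le' B hk).trans (pow_le_one₀ (norm_nonneg _) hB)

theorem eval_sqrtPoly_le (n : ℕ) : (sqrtPoly n).eval 1 ≤ 1 := by
  induction n with
  | zero => simp [sqrtPoly]
  | succ n ih =>
    have h0 : 0 ≤ (sqrtPoly n).eval 1 := by
      rw [Polynomial.eval_eq_sum_range]
      exact Finset.sum_nonneg fun k _ => by simpa using coeff_sqrtPoly_nonneg n k
    simp only [sqrtPoly, Polynomial.eval_mul, Polynomial.eval_C, Polynomial.eval_add,
      Polynomial.eval_X, Polynomial.eval_pow]
    nlinarith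

theorem exists_sqrt_of_norm_le_one {A : E →L[ℝ] E} (hA : A.IsPositive) (h1 : ‖A‖ ≤ 1) :
    ∃ R : E →L[ℝ] E, R.IsPositive ∧ R ∘L R = A := by
  set B : E →L[ℝ] E := 1 - A with hBdef
  have hB : ‖B‖ ≤ 1 := by
    refine ContinuousLinearMap.opNorm_le_bound _ zero_le_one fun x => ?_
    have h := sq_norm_le_inner hA h1 x
    have h2 := hA.inner_nonneg_left x
    have : ‖B x‖ ^ 2 ≤ ‖x‖ ^ 2 := by
      have e : B x = x - A x := by simp [hBdef]
      rw [e, norm_sub_sq_real, real_inner_comm]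
      linarith
    rw [one_mul]
    exact le_of_sq_le_sq this (norm_nonneg _)
  have hBsa : IsSelfAdjoint B := (IsSelfAdjoint.one _).sub hA.isSelfAdjoint
  set y : ℕ → (E →L[ℝ] E) := fun n => Polynomial.aeval B (sqrtPoly n) with hy
  set r : ℕ → ℝ := fun n => (sqrtPoly n).eval 1 with hr
  have hstep : ∀ n, ‖y (n + 1) - y n‖ ≤ r (n + 1) - r n := fun n => by
    have := norm_aeval_le (coeff_sqrtPoly_sub_nonneg n) hB
    simpa [hy, hr] using this
  have hsum : Summable fun n => r (n + 1) - r n := by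
    refine summable_of_sum_range_le (c := 1) (fun n => (norm_nonneg _).trans (hstep n)) fun n => ?_
    rw [Finset.sum_range_sub]
    have h0 : r 0 = 0 := by simp [hr, sqrtPoly]
    rw [h0, sub_zero]
    exact eval_sqrtPoly_le n
  have hcau : CauchySeq y := by
    refine cauchySeq_of_dist_le_of_summable _ (fun n => ?_) hsum
    rw [dist_comm, dist_eq_norm]
    exact hstep n
  obtain ⟨Y, hY⟩ := cauchySeq_tendsto_of_complete hcau
  have hYn : ‖Y‖ ≤ 1 := le_of_tendsto hY.norm (Eventually.of_forall fun n =>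
    (norm_aeval_le (coeff_sqrtPoly_nonneg n) hB).trans (eval_sqrtPoly_le n))
  have hysa : ∀ n, IsSelfAdjoint (y n) := fun n => by
    induction n with
    | zero => simp [hy, sqrtPoly]
    | succ n ih =>
      have : y (n + 1) = (1 / 2 : ℝ) • (B + y n ^ 2) := by
        simp [hy, sqrtPoly, Algebra.smul_def]
      rw [this]
      exact (IsSelfAdjoint.all (1 / 2 : ℝ)).smul (hBsa.add (ih.pow 2))
  have hYsa : IsSelfAdjoint Y := by
    have h := (continuous_star.tendsto Y).comp hY
    exact tendsto_nhds_unique (h.congr fun n => (hysa n).star_eq) hY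
  have hfix : Y = (1 / 2 : ℝ) • (B + Y ^ 2) := by
    refine tendsto_nhds_unique ((tendsto_add_atTop_iff_nat 1).2 hY) ?_
    refine Tendsto.congr (fun n => ?_) ((tendsto_const_nhds.add (hY.pow 2)).const_smul (1 / 2 : ℝ))
    simp [hy, sqrtPoly, Algebra.smul_def]
  refine ⟨1 - Y, ?_, ?_⟩
  · rw [ContinuousLinearMap.isPositive_iff']
    refine ⟨(IsSelfAdjoint.one _).sub hYsa, fun x => ?_⟩
    have h : ⟪Y x, x⟫ ≤ ‖x‖ ^ 2 := by
      refine (real_inner_le_norm _ _).trans ?_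
      have := (Y.le_opNorm x).trans (mul_le_of_le_one_left (norm_nonneg _) hYn)
      nlinarith [norm_nonneg x]
    have e : ⟪x, x⟫ = ‖x‖ ^ 2 := real_inner_self_eq_norm_sq _
    simp only [ContinuousLinearMap.sub_apply, ContinuousLinearMap.one_apply, inner_sub_left, e]
    linarith
  · change (1 - Y) * (1 - Y) = A
    have h2 : (2 : ℝ) • Y = B + Y ^ 2 := by
      conv_lhs => rw [hfix]
      rw [smul_smul]; norm_num
    have h3 : Y + Y = 1 - A + Y * Y := by rw [← two_smul ℝ, h2, hBdef, pow_two]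
    have h4 : (1 - Y) * (1 - Y) = 1 - (Y + Y) + Y * Y := by noncomm_ring
    rw [h4, h3]; abel

theorem exists_sqrt {A : E →L[ℝ] E} (hA : A.IsPositive) :
    ∃ R : E →L[ℝ] E, R.IsPositive ∧ R ∘L R = A := by
  set c : ℝ := ‖A‖ + 1
  have hc : 0 < c := by positivity
  obtain ⟨R, hR, hRR⟩ := exists_sqrt_of_norm_le_one (A := c⁻¹ • A)
    (hA.smul_of_nonneg (inv_nonneg.2 hc.le)) (by
      rw [norm_smul, norm_inv, Real.norm_of_nonneg hc.le, inv_mul_le_iff₀ hc]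
      simp [c])
  refine ⟨√c • R, hR.smul_of_nonneg (Real.sqrt_nonneg c), ?_⟩
  rw [ContinuousLinearMap.smul_comp, ContinuousLinearMap.comp_smul, hRR, smul_smul, smul_smul,
    Real.mul_self_sqrt hc.le, mul_inv_cancel₀ hc.ne', one_smul]

open Classical in
/-- The positive square root `A^{1/2}` of a positive operator `A`: the (unique) positive operator
whose square is `A` (and `0` when `A` is not positive). -/
noncomputable def posSqrt (A : E →L[ℝ] E) : E →L[ℝ] E :=
  if h : A.IsPositive then (exists_sqrt h).choose else 0

theorem posSqrt_spec {A : E →L[ℝ] E} (hA : A.IsPositive) :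
    (posSqrt A).IsPositive ∧ posSqrt A ∘L posSqrt A = A := by
  rw [posSqrt, dif_pos hA]
  exact (exists_sqrt hA).choose_spec

/-! ### Trace and Hilbert–Schmidt norm -/

variable (E) in
/-- The index set of a fixed orthonormal (Hilbert) basis. -/
def basisSet : Set E := (exists_hilbertBasis ℝ E).choose

variable (E) in
/-- A fixed orthonormal (Hilbert) basis. -/
noncomputable def basis : HilbertBasis (basisSet E) ℝ E :=
  (exists_hilbertBasis ℝ E).choose_spec.choose

/-- The trace of a positive operator, with values in `[0, ∞]`. -/
noncomputable def trace (T : E →L[ℝ] E) : ℝ≥0∞ :=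
  ∑' i, ENNReal.ofReal ⟪T (basis E i), basis E i⟫

/-- The squared Hilbert–Schmidt norm `‖T‖²_HS = ∑ ‖T eᵢ‖²`, with values in `[0, ∞]`. -/
noncomputable def hsNormSq (T : E →L[ℝ] E) : ℝ≥0∞ :=
  ∑' i, ‖T (basis E i)‖ₑ ^ 2

/-- A semigroup `(T(t))` is a Hilbert–Schmidt semigroup if `T(t)` is a Hilbert–Schmidt operator for
every `t > 0`. -/
def IsHilbertSchmidtSemigroup (T : ℝ → E →L[ℝ] E) : Prop :=
  ∀ t, 0 < t → hsNormSq (T t) < ∞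

/-- Exponential stability: `‖T(t)‖ ≤ M e^{-β t}` for all `t ≥ 0`, for some `M` and `β > 0`. -/
def IsExponentiallyStable (T : ℝ → E →L[ℝ] E) : Prop :=
  ∃ M β : ℝ, 0 < β ∧ ∀ t, 0 ≤ t → ‖T t‖ ≤ M * Real.exp (-β * t)

/-- Strongly continuous one-parameter semigroup `(S(t))_{t ≥ 0}`. Values at `t < 0` play no role. -/
structure IsC0Semigroup (S : ℝ → E →L[ℝ] E) : Prop where
  map_zero : S 0 = ContinuousLinearMap.id ℝ E
  map_add : ∀ s t, 0 ≤ s → 0 ≤ t → S (s + t) = S s ∘L S t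
  tendsto_zero : ∀ x, Tendsto (fun t => S t x) (𝓝[>] 0) (𝓝 x)

end Operators

section OU

variable {H : Type*} [NormedAddCommGroup H] [InnerProductSpace ℝ H] [CompleteSpace H]

/-- The operator `S(s) Q S*(s)`. -/
noncomputable def covKernel (S : ℝ → H →L[ℝ] H) (Q : H →L[ℝ] H) (s : ℝ) : H →L[ℝ] H :=
  S s ∘L Q ∘L ContinuousLinearMap.adjoint (S s)

/-- `Q_t x = ∫_0^t S(s) Q S*(s) x ds`. -/
noncomputable def covOp (S : ℝ → H →L[ℝ] H) (Q : H →L[ℝ] H) (t : ℝ) (x : H) : H :=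
  ∫ s in Ioc 0 t, covKernel S Q s x

/-- `Q_∞ x = ∫_0^∞ S(s) Q S*(s) x ds`. -/
noncomputable def covOpInf (S : ℝ → H →L[ℝ] H) (Q : H →L[ℝ] H) (x : H) : H :=
  ∫ s in Ioi 0, covKernel S Q s x

/-- The operator `S_Q(t) = Q^{-1/2} S(t) Q^{1/2}`: the bounded operator `T` with
`Q^{1/2} T = S(t) Q^{1/2}`. It is unique when `Q^{1/2}` is injective; it is set to `0` if there is
no such bounded operator. -/
noncomputable def SQ (S : ℝ → H →L[ℝ] H) (Q : H →L[ℝ] H) (t : ℝ) : H →L[ℝ] H :=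
  open Classical in
  if h : ∃ T : H →L[ℝ] H, posSqrt Q ∘L T = S t ∘L posSqrt Q then h.choose else 0

variable [MeasurableSpace H]

/-- `ν` is the Gaussian measure `N(m, C)`, i.e. the Borel probability measure with characteristic
function `z ↦ exp(i⟨m, z⟩ - ⟨C z, z⟩ / 2)`. -/
def IsGaussianMeasure (m : H) (C : H → H) (ν : Measure H) : Prop :=
  IsProbabilityMeasure ν ∧
    ∀ z, charFun ν z = Complex.exp ((⟪m, z⟫ : ℝ) * Complex.I - (⟪C z, z⟫ : ℝ) / 2)

/-- The Gaussian measure `N(m, C)`. It is determined by its characteristic function and exists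
whenever `C` is a nonnegative trace class operator. -/
noncomputable def gaussianMeasure (m : H) (C : H → H) : Measure H :=
  open Classical in
  if h : ∃ ν, IsGaussianMeasure m C ν then h.choose else 0

/-- The invariant measure `μ = N(0, Q_∞)`. -/
noncomputable def invMeasure (S : ℝ → H →L[ℝ] H) (Q : H →L[ℝ] H) : Measure H :=
  gaussianMeasure 0 (covOpInf S Q)

/-- The Ornstein–Uhlenbeck transition semigroup on functions,
`R_t φ(x) = E φ(Z(t, x)) = ∫ φ dN(S(t) x, Q_t)`, as the mild solution
`Z(t, x) = S(t) x + ∫_0^t S(t - s) Q^{1/2} dW(s)` has law `N(S(t) x, Q_t)`. -/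
noncomputable def transition (S : ℝ → H →L[ℝ] H) (Q : H →L[ℝ] H) (t : ℝ) (φ : H → ℝ) (x : H) : ℝ :=
  ∫ y, φ y ∂(gaussianMeasure (S t x) (covOp S Q t))

/-- Bounded Borel functions. -/
def IsBoundedBorel (φ : H → ℝ) : Prop :=
  Measurable φ ∧ ∃ M : ℝ, ∀ x, |φ x| ≤ M

/-- `(R_t)` is symmetric with respect to `μ`. -/
def IsSymmetricOU (S : ℝ → H →L[ℝ] H) (Q : H →L[ℝ] H) : Prop :=
  ∀ t, 0 ≤ t → ∀ φ ψ : H → ℝ, IsBoundedBorel φ → IsBoundedBorel ψ →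
    ∫ x, ψ x * transition S Q t φ x ∂(invMeasure S Q) =
      ∫ x, φ x * transition S Q t ψ x ∂(invMeasure S Q)

/-- The real Hilbert space `L²(H, μ)`. -/
abbrev L2 (S : ℝ → H →L[ℝ] H) (Q : H →L[ℝ] H) : Type _ := Lp ℝ 2 (invMeasure S Q)

/-- `T` is the bounded operator on `L²(H, μ)` that extends `R_t` from bounded Borel functions. -/
def IsL2Extension (S : ℝ → H →L[ℝ] H) (Q : H →L[ℝ] H) (t : ℝ) (T : L2 S Q →L[ℝ] L2 S Q) : Prop :=
  ∀ φ : H → ℝ, IsBoundedBorel φ → ∀ h : MemLp φ 2 (invMeasure S Q),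
    (T (h.toLp φ) : H → ℝ) =ᵐ[invMeasure S Q] transition S Q t φ

/-- The operator `R_t` on `L²(H, μ)`: the bounded extension of `R_t` from bounded Borel functions,
which is unique by density (`0` if there is no such extension). -/
noncomputable def transitionL2 (S : ℝ → H →L[ℝ] H) (Q : H →L[ℝ] H) (t : ℝ) :
    L2 S Q →L[ℝ] L2 S Q :=
  open Classical in
  if h : ∃ T, IsL2Extension S Q t T then h.choose else 0

end OU

end OrnsteinUhlenbeck

/-! Write V for Q_∞. Symmetry of (R_t) says that the joint law of (Z(0), Z(t)), started from μ, is
exchangeable. Comparing characteristic functions gives S(t)V = VS*(t) (`comp_eq_comp_adjoint`).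
Since Q_r = V - S(r)VS*(r), the same commutation holds for every Q_r and, by letting r tend to 0,
for Q (`symmetrizes_Q`). Hence S(s)QS*(s) = S(2s)Q, and Q inherits injectivity from V. If TP = PT*
with P positive, then T* is symmetric for the form ⟨P·,·⟩, and Cauchy–Schwarz iterated along powers
bounds it there by ‖T‖. So T₁ = S_Q and T₀ = V^{-1/2}SV^{1/2} are strongly continuous selfadjoint
semigroups (`exists_symmetrization`).

They are unitarily equivalent (`exists_unitary`): the operator G with GV^{1/2} = T₁(1)Q^{1/2}
intertwines them and is injective with dense range, and its polar decomposition supplies the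
unitary. Conditions on S_Q thus become conditions on T₀, a contraction semigroup that tends strongly
to 0.

For (a), T₀(t) is the compression of R_t to the first Wiener chaos (`exists_firstChaos`), so it is
Hilbert–Schmidt if R_t is; strong convergence to 0 then brings the norm below 1 at some time, which
is stability. Conversely, stability and selfadjointness give ‖T₀(t)‖ < 1 for t > 0. On cylinders
chosen to diagonalise a compression of T₀(t), the joint law is a product of planar Gaussian laws
with correlations r_i. Its density relative to μ ⊗ μ has squared norm ∏ (1 - r_i²)^{-1} ≤
exp(‖T₀(t)‖²_HS / (1 - ‖T₀(t)‖²)). The bound is kept in the dual form `SqDominates`, which passes to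
the limit over cylinders, and `hsNormSq_transitionL2_le` converts it into a bound for the
Hilbert–Schmidt norm of R_t.

For (b), finiteness of the integral makes L = ∫ T₁T₁* trace class; as Q^{1/2}LQ^{1/2} = V, μ is the
image of N(0, L) under Q^{1/2}. Conversely, if μ charges only the range of Q^{1/2}, it pulls back to
a measure ν with ν ⊗ ν invariant under rotation by -π/4. Fernique's theorem gives ν a finite second
moment, and by Parseval that moment dominates the integral. -/

set_option linter.unusedSectionVars false

namespace OrnsteinUhlenbeck

/-! ### Hilbert–Schmidt norms -/

section HilbertSchmidt

variable {E : Type*} [NormedAddCommGroup E] [InnerProductSpace ℝ E] [CompleteSpace E]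

theorem enorm_sq_eq_ofReal_norm_sq {F : Type*} [NormedAddCommGroup F] (x : F) :
    ‖x‖ₑ ^ 2 = ENNReal.ofReal (‖x‖ ^ 2) := by
  rw [ENNReal.ofReal_pow (norm_nonneg _), ofReal_norm]

theorem tsum_enorm_inner_sq {ι : Type*} (b : HilbertBasis ι ℝ E) (x : E) :
    ∑' i, ‖⟪b i, x⟫‖ₑ ^ 2 = ‖x‖ₑ ^ 2 := by
  have h := b.hasSum_inner_mul_inner x x
  rw [real_inner_self_eq_norm_sq] at h
  have h' : HasSum (fun i => ⟪b i, x⟫ ^ 2) (‖x‖ ^ 2) := by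
    refine h.congr_fun ?_ |> fun h => h
    intro i; rw [real_inner_comm]; ring
  rw [enorm_sq_eq_ofReal_norm_sq, ← h'.tsum_eq,
    ENNReal.ofReal_tsum_of_nonneg (fun i => sq_nonneg _) h'.summable]
  congr with i
  rw [enorm_sq_eq_ofReal_norm_sq, Real.norm_eq_abs, sq_abs]

theorem tsum_enorm_inner_sq_le {ι : Type*} {v : ι → E} (hv : Orthonormal ℝ v) (x : E) :
    ∑' i, ‖⟪v i, x⟫‖ₑ ^ 2 ≤ ‖x‖ₑ ^ 2 := by
  have h := hv.tsum_inner_products_le x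
  have hs := hv.inner_products_summable x
  simp only [enorm_sq_eq_ofReal_norm_sq]
  rw [← ENNReal.ofReal_tsum_of_nonneg (fun i => sq_nonneg _) hs]
  exact ENNReal.ofReal_le_ofReal h

/-- Both sides are the double sum of squared matrix entries, by Parseval in each basis. Two
different bases are allowed so that independence of the basis follows by passing to the adjoint
twice. -/
theorem tsum_enorm_apply_sq_comm {ι κ : Type*} (b : HilbertBasis ι ℝ E) (c : HilbertBasis κ ℝ E)
    (T : E →L[ℝ] E) :
    ∑' i, ‖T (b i)‖ₑ ^ 2 = ∑' j, ‖ContinuousLinearMap.adjoint T (c j)‖ₑ ^ 2 := by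
  simp_rw [← tsum_enorm_inner_sq c (T _), ← tsum_enorm_inner_sq b (ContinuousLinearMap.adjoint T _)]
  rw [ENNReal.tsum_comm]
  refine tsum_congr fun j => tsum_congr fun i => ?_
  rw [ContinuousLinearMap.adjoint_inner_right, real_inner_comm]

theorem hsNormSq_eq_tsum {ι : Type*} (b : HilbertBasis ι ℝ E) (T : E →L[ℝ] E) :
    hsNormSq T = ∑' i, ‖T (b i)‖ₑ ^ 2 := by
  rw [hsNormSq, tsum_enorm_apply_sq_comm (basis E) b, tsum_enorm_apply_sq_comm b b,
    ContinuousLinearMap.adjoint_adjoint]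

theorem hsNormSq_adjoint (T : E →L[ℝ] E) :
    hsNormSq (ContinuousLinearMap.adjoint T) = hsNormSq T := by
  rw [hsNormSq, hsNormSq, tsum_enorm_apply_sq_comm (basis E) (basis E) T]

/-- Bessel's inequality replaces Parseval. Incomplete systems occur twice: the first chaos inside
L²(H, μ), and the finite eigenvector families in the kernel estimate. -/
theorem tsum_enorm_apply_sq_le {ι : Type*} {v : ι → E} (hv : Orthonormal ℝ v) (T : E →L[ℝ] E) :
    ∑' i, ‖T (v i)‖ₑ ^ 2 ≤ hsNormSq T := by
  rw [← hsNormSq_adjoint, hsNormSq]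
  simp_rw [← tsum_enorm_inner_sq (basis E) (T _)]
  rw [ENNReal.tsum_comm]
  refine ENNReal.tsum_le_tsum fun j => ?_
  refine le_trans (le_of_eq ?_) (tsum_enorm_inner_sq_le hv _)
  refine tsum_congr fun i => ?_
  rw [ContinuousLinearMap.adjoint_inner_right, real_inner_comm]

theorem hsNormSq_comp_le (A T : E →L[ℝ] E) : hsNormSq (A ∘L T) ≤ ‖A‖ₑ ^ 2 * hsNormSq T := by
  rw [hsNormSq, hsNormSq, ← ENNReal.tsum_mul_left]
  refine ENNReal.tsum_le_tsum fun i => ?_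
  rw [← mul_pow]
  gcongr
  exact A.le_opENorm _

/-- Each coordinate of `T x` is an inner product of `x` with an adjoint image of a basis vector;
Cauchy–Schwarz bounds it. -/
theorem enorm_apply_sq_le (T : E →L[ℝ] E) (x : E) : ‖T x‖ₑ ^ 2 ≤ hsNormSq T * ‖x‖ₑ ^ 2 := by
  rw [← hsNormSq_adjoint, hsNormSq, ← ENNReal.tsum_mul_right, ← tsum_enorm_inner_sq (basis E)]
  refine ENNReal.tsum_le_tsum fun i => ?_
  rw [← ContinuousLinearMap.adjoint_inner_left, ← mul_pow]
  gcongr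
  rw [← ofReal_norm, ← ofReal_norm, ← ofReal_norm, ← ENNReal.ofReal_mul (norm_nonneg _)]
  exact ENNReal.ofReal_le_ofReal (norm_inner_le_norm _ _)

theorem enorm_sq_le_hsNormSq (T : E →L[ℝ] E) : ‖T‖ₑ ^ 2 ≤ hsNormSq T := by
  by_cases h : hsNormSq T = ∞
  · rw [h]; exact le_top
  have hT : ‖T‖ ≤ √(hsNormSq T).toReal := by
    refine T.opNorm_le_bound (Real.sqrt_nonneg _) fun x => ?_
    refine le_of_sq_le_sq ?_ (by positivity)
    rw [mul_pow, Real.sq_sqrt ENNReal.toReal_nonneg]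
    have := ENNReal.toReal_mono (ENNReal.mul_ne_top h (by simp)) (enorm_apply_sq_le T x)
    simpa using this
  rw [enorm_sq_eq_ofReal_norm_sq, ENNReal.ofReal_le_iff_le_toReal h]
  calc ‖T‖ ^ 2 ≤ √(hsNormSq T).toReal ^ 2 := by gcongr
    _ = _ := Real.sq_sqrt ENNReal.toReal_nonneg

theorem hsNormSq_eq_of_intertwine {F : Type*} [NormedAddCommGroup F] [InnerProductSpace ℝ F]
    [CompleteSpace F] (U : E ≃ₗᵢ[ℝ] F) (A : F →L[ℝ] F) (B : E →L[ℝ] E)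
    (h : ∀ x, A (U x) = U (B x)) : hsNormSq A = hsNormSq B := by
  set b : HilbertBasis (basisSet E) ℝ F := HilbertBasis.ofRepr (U.symm.trans (basis E).repr) with hb
  have hbi : ∀ i, b i = U (basis E i) := fun i => by
    classical
    rw [hb, ← HilbertBasis.repr_symm_single, ← HilbertBasis.repr_symm_single]
    rfl
  rw [hsNormSq_eq_tsum b, hsNormSq]
  refine tsum_congr fun i => ?_
  rw [hbi, h, ← ofReal_norm, U.norm_map, ofReal_norm]

end HilbertSchmidt

/-! ### Square roots, polar decomposition and operators symmetric for a positive form -/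

section SquareRoot

variable {E : Type*} [NormedAddCommGroup E] [InnerProductSpace ℝ E] [CompleteSpace E]

theorem posSqrt_apply_apply {A : E →L[ℝ] E} (hA : A.IsPositive) (x : E) :
    posSqrt A (posSqrt A x) = A x :=
  congrArg (fun T : E →L[ℝ] E => T x) (posSqrt_spec hA).2

theorem inner_posSqrt_left {A : E →L[ℝ] E} (hA : A.IsPositive) (x y : E) :
    ⟪posSqrt A x, y⟫ = ⟪x, posSqrt A y⟫ :=
  (posSqrt_spec hA).1.inner_left_eq_inner_right x y

theorem inner_posSqrt_posSqrt {A : E →L[ℝ] E} (hA : A.IsPositive) (x y : E) :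
    ⟪posSqrt A x, posSqrt A y⟫ = ⟪A x, y⟫ := by
  rw [← inner_posSqrt_left hA, posSqrt_apply_apply hA]

theorem norm_posSqrt_sq {A : E →L[ℝ] E} (hA : A.IsPositive) (x : E) :
    ‖posSqrt A x‖ ^ 2 = ⟪A x, x⟫ := by
  rw [← inner_posSqrt_posSqrt hA, real_inner_self_eq_norm_sq]

theorem injective_posSqrt {A : E →L[ℝ] E} (hA : A.IsPositive) (hi : Function.Injective A) :
    Function.Injective (posSqrt A) := fun x y h => hi (by
  rw [← posSqrt_apply_apply hA, h, posSqrt_apply_apply hA])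

theorem hsNormSq_posSqrt {A : E →L[ℝ] E} (hA : A.IsPositive) : hsNormSq (posSqrt A) = trace A := by
  rw [hsNormSq, trace]
  refine tsum_congr fun i => ?_
  rw [enorm_sq_eq_ofReal_norm_sq, norm_posSqrt_sq hA]

theorem isPositive_comp_adjoint_self (G : E →L[ℝ] E) :
    (ContinuousLinearMap.adjoint G ∘L G).IsPositive := by
  simpa using ContinuousLinearMap.isPositive_adjoint_comp_self G

/-- An operator whose adjoint is injective has dense range. -/
theorem denseRange_of_injective_adjoint {F : Type*} [NormedAddCommGroup F] [InnerProductSpace ℝ F]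
    [CompleteSpace F] {A : E →L[ℝ] F}
    (h : Function.Injective (ContinuousLinearMap.adjoint A)) : DenseRange A := by
  have h1 : (A.range)ᗮ = ⊥ := by
    rw [A.orthogonal_range]
    exact LinearMap.ker_eq_bot.2 h
  have h2 := (Submodule.topologicalClosure_eq_top_iff (K := A.range)).2 h1
  have h3 := Submodule.dense_iff_topologicalClosure_eq_top.2 h2
  exact h3

theorem denseRange_of_injective_of_isSelfAdjoint {A : E →L[ℝ] E} (hA : IsSelfAdjoint A)
    (h : Function.Injective A) : DenseRange A :=
  denseRange_of_injective_adjoint (by rwa [hA.adjoint_eq])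

theorem denseRange_posSqrt {A : E →L[ℝ] E} (hA : A.IsPositive) (hi : Function.Injective A) :
    DenseRange (posSqrt A) :=
  denseRange_of_injective_of_isSelfAdjoint (posSqrt_spec hA).1.isSelfAdjoint
    (injective_posSqrt hA hi)

/-- The root is a norm limit of polynomials in `A`, so it commutes with whatever commutes with `A`.
The specification of `posSqrt` does not record this; the polar decomposition needs it, and does not
need positivity of the root. -/
theorem exists_sqrt_commute_of_norm_le_one {A : E →L[ℝ] E} (hA : A.IsPositive) (h1 : ‖A‖ ≤ 1) :
    ∃ R : E →L[ℝ] E, IsSelfAdjoint R ∧ R * R = A ∧ ∀ C, Commute C A → Commute C R := by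
  set B : E →L[ℝ] E := 1 - A with hBdef
  have hB : ‖B‖ ≤ 1 := by
    refine ContinuousLinearMap.opNorm_le_bound _ zero_le_one fun x => ?_
    have h := sq_norm_le_inner hA h1 x
    have h2 := hA.inner_nonneg_left x
    have : ‖B x‖ ^ 2 ≤ ‖x‖ ^ 2 := by
      have e : B x = x - A x := by simp [hBdef]
      rw [e, norm_sub_sq_real, real_inner_comm]
      linarith
    rw [one_mul]
    exact le_of_sq_le_sq this (norm_nonneg _)
  have hBsa : IsSelfAdjoint B := (IsSelfAdjoint.one _).sub hA.isSelfAdjoint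
  set y : ℕ → (E →L[ℝ] E) := fun n => Polynomial.aeval B (sqrtPoly n) with hy
  set r : ℕ → ℝ := fun n => (sqrtPoly n).eval 1 with hr
  have hys : ∀ n, y (n + 1) = (1 / 2 : ℝ) • (B + y n ^ 2) := fun n => by
    simp [hy, sqrtPoly, Algebra.smul_def]
  have hstep : ∀ n, ‖y (n + 1) - y n‖ ≤ r (n + 1) - r n := fun n => by
    have := norm_aeval_le (coeff_sqrtPoly_sub_nonneg n) hB
    simpa [hy, hr] using this
  have hsum : Summable fun n => r (n + 1) - r n := by
    refine summable_of_sum_range_le (c := 1) (fun n => (norm_nonneg _).trans (hstep n)) fun n => ?_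
    rw [Finset.sum_range_sub]
    have h0 : r 0 = 0 := by simp [hr, sqrtPoly]
    rw [h0, sub_zero]
    exact eval_sqrtPoly_le n
  have hcau : CauchySeq y := by
    refine cauchySeq_of_dist_le_of_summable _ (fun n => ?_) hsum
    rw [dist_comm, dist_eq_norm]
    exact hstep n
  obtain ⟨Y, hY⟩ := cauchySeq_tendsto_of_complete hcau
  have hysa : ∀ n, IsSelfAdjoint (y n) := fun n => by
    induction n with
    | zero => simp [hy, sqrtPoly]
    | succ n ih =>
      rw [hys]
      exact (IsSelfAdjoint.all (1 / 2 : ℝ)).smul (hBsa.add (ih.pow 2))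
  have hYsa : IsSelfAdjoint Y := by
    have h := (continuous_star.tendsto Y).comp hY
    exact tendsto_nhds_unique (h.congr fun n => (hysa n).star_eq) hY
  have hfix : Y = (1 / 2 : ℝ) • (B + Y ^ 2) :=
    tendsto_nhds_unique ((tendsto_add_atTop_iff_nat 1).2 hY)
      (Tendsto.congr (fun n => (hys n).symm)
        ((tendsto_const_nhds.add (hY.pow 2)).const_smul (1 / 2 : ℝ)))
  refine ⟨1 - Y, (IsSelfAdjoint.one _).sub hYsa, ?_, fun C hC => ?_⟩
  · have h2 : (2 : ℝ) • Y = B + Y ^ 2 := by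
      conv_lhs => rw [hfix]
      rw [smul_smul]; norm_num
    have h3 : Y + Y = 1 - A + Y * Y := by rw [← two_smul ℝ, h2, hBdef, pow_two]
    have h4 : (1 - Y) * (1 - Y) = 1 - (Y + Y) + Y * Y := by noncomm_ring
    rw [h4, h3]; abel
  · have hCB : Commute C B := (Commute.one_right C).sub_right hC
    have hCy : ∀ n, Commute C (y n) := fun n => by
      induction n with
      | zero => simp [hy, sqrtPoly]
      | succ n ih =>
        rw [hys]
        exact (hCB.add_right (ih.pow_right 2)).smul_right _
    have hCY : Commute C Y := tendsto_nhds_unique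
      ((hY.const_mul C).congr fun n => (hCy n).eq) (hY.mul_const C)
    exact (Commute.one_right C).sub_right hCY

theorem exists_sqrt_commute {A : E →L[ℝ] E} (hA : A.IsPositive) :
    ∃ R : E →L[ℝ] E, IsSelfAdjoint R ∧ R * R = A ∧ ∀ C, Commute C A → Commute C R := by
  set c : ℝ := ‖A‖ + 1
  have hc : 0 < c := by positivity
  obtain ⟨R, hR, hRR, hcom⟩ := exists_sqrt_commute_of_norm_le_one (A := c⁻¹ • A)
    (hA.smul_of_nonneg (inv_nonneg.2 hc.le)) (by
      rw [norm_smul, norm_inv, Real.norm_of_nonneg hc.le, inv_mul_le_iff₀ hc]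
      simp [c])
  refine ⟨√c • R, (IsSelfAdjoint.all _).smul hR, ?_, fun C hC => (hcom C (hC.smul_right _)).smul_right _⟩
  rw [smul_mul_smul_comm, hRR, smul_smul, Real.mul_self_sqrt hc.le, mul_inv_cancel₀ hc.ne', one_smul]

/-- Symmetric operators intertwined by an injective operator with dense range are unitarily
equivalent. -/
theorem exists_unitary_intertwine {ι : Type*} {A B : ι → E →L[ℝ] E} {G : E →L[ℝ] E}
    (hA : ∀ i, IsSelfAdjoint (A i)) (hB : ∀ i, IsSelfAdjoint (B i))
    (hG : Function.Injective G) (hGr : DenseRange G) (h : ∀ i, A i ∘L G = G ∘L B i) :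
    ∃ U : E ≃ₗᵢ[ℝ] E, ∀ i x, A i (U x) = U (B i x) := by
  -- `N` is a selfadjoint root of `G* G`, so `‖N x‖ = ‖G x‖` and `N x ↦ G x` extends to a unitary.
  -- Since `G* G` commutes with each `B i`, so does `N`, and the unitary inherits the intertwining
  -- from `G`.
  obtain ⟨N, hN, hNN, hcom⟩ := exists_sqrt_commute (isPositive_comp_adjoint_self G)
  have hnorm : ∀ x, ‖G x‖ = ‖N x‖ := fun x => by
    have h1 : ‖G x‖ ^ 2 = ‖N x‖ ^ 2 := by
      rw [← real_inner_self_eq_norm_sq, ← real_inner_self_eq_norm_sq,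
        ← ContinuousLinearMap.adjoint_inner_left, ← ContinuousLinearMap.adjoint_inner_left N,
        hN.adjoint_eq]
      exact congrArg (fun T : E →L[ℝ] E => ⟪T x, x⟫) hNN.symm
    exact (sq_eq_sq₀ (norm_nonneg _) (norm_nonneg _)).1 h1
  have hNi : Function.Injective N := by
    rw [injective_iff_map_eq_zero]
    intro x hx
    refine (injective_iff_map_eq_zero G).1 hG x ?_
    rw [← norm_eq_zero, hnorm, hx, norm_zero]
  have hNr : DenseRange N := denseRange_of_injective_of_isSelfAdjoint hN hNi
  have hGA : ∀ i, ContinuousLinearMap.adjoint G ∘L A i = B i ∘L ContinuousLinearMap.adjoint G := by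
    intro i
    have := congrArg ContinuousLinearMap.adjoint (h i)
    rwa [ContinuousLinearMap.adjoint_comp, ContinuousLinearMap.adjoint_comp, (hA i).adjoint_eq,
      (hB i).adjoint_eq] at this
  have hcomB : ∀ i, Commute (B i) N := fun i => by
    refine hcom _ ?_
    change B i ∘L (ContinuousLinearMap.adjoint G ∘L G) = (ContinuousLinearMap.adjoint G ∘L G) ∘L B i
    rw [← ContinuousLinearMap.comp_assoc, ← hGA, ContinuousLinearMap.comp_assoc, h,
      ContinuousLinearMap.comp_assoc]
  let U : E ≃ₗᵢ[ℝ] E := (LinearEquiv.refl ℝ E).extendOfIsometry (N : E →ₗ[ℝ] E) (G : E →ₗ[ℝ] E)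
    hNr hGr hnorm
  have hU : ∀ x, U (N x) = G x :=
    LinearEquiv.extendOfIsometry_eq (LinearEquiv.refl ℝ E) (N : E →ₗ[ℝ] E) (G : E →ₗ[ℝ] E)
      hNr hGr hnorm
  refine ⟨U, fun i => ?_⟩
  have key : ∀ x, A i (U (N x)) = U (B i (N x)) := fun x => by
    have e1 : A i (G x) = G (B i x) := congrArg (fun T : E →L[ℝ] E => T x) (h i)
    have e2 : B i (N x) = N (B i x) := congrArg (fun T : E →L[ℝ] E => T x) (hcomB i).eq
    rw [hU, e1, e2, hU]
  intro x
  exact hNr.induction_on (p := fun x => A i (U x) = U (B i x)) x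
    (isClosed_eq (by fun_prop) (by fun_prop)) key

/-- If `T P = P T*` with `P` positive, then `‖P^{1/2} T* x‖ ≤ ‖T‖ ‖P^{1/2} x‖`. -/
theorem norm_posSqrt_adjoint_le {P T : E →L[ℝ] E} (hP : P.IsPositive)
    (h : T ∘L P = P ∘L ContinuousLinearMap.adjoint T) (x : E) :
    ‖posSqrt P (ContinuousLinearMap.adjoint T x)‖ ≤ ‖T‖ * ‖posSqrt P x‖ := by
  set T' := ContinuousLinearMap.adjoint T with hT'
  have hT'n : ‖T'‖ = ‖T‖ := LinearIsometryEquiv.norm_map _ _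
  have hsym : ∀ u v, ⟪posSqrt P (T' u), posSqrt P v⟫ = ⟪posSqrt P u, posSqrt P (T' v)⟫ := by
    intro u v
    have e : P (T' u) = T (P u) := (congrArg (fun S : E →L[ℝ] E => S u) h).symm
    rw [inner_posSqrt_posSqrt hP, inner_posSqrt_posSqrt hP, e,
      ContinuousLinearMap.adjoint_inner_right]
  -- `T'` is symmetric for the seminorm `‖posSqrt P ·‖`. If it stretched `x` by a factor `a > ‖T‖`,
  -- Cauchy–Schwarz would force its powers of order `2 ^ k` to stretch `x` by at least `a ^ (2 ^
  -- k)`, against the trivial bound of order `‖T‖ ^ (2 ^ k)`.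
  by_contra hlt
  rw [not_le] at hlt
  set n0 := ‖posSqrt P x‖ with hn0
  have hsymn : ∀ n u v, ⟪posSqrt P ((T' ^ n) u), posSqrt P v⟫ =
      ⟪posSqrt P u, posSqrt P ((T' ^ n) v)⟫ := by
    intro n
    induction n with
    | zero => simp
    | succ n ih =>
      intro u v
      have e1 : (T' ^ (n + 1)) u = (T' ^ n) (T' u) := by rw [pow_succ]; rfl
      have e2 : (T' ^ (n + 1)) v = T' ((T' ^ n) v) := by rw [pow_succ']; rfl
      rw [e1, e2, ih, hsym]
  have hstep : ∀ n, ‖posSqrt P ((T' ^ n) x)‖ ^ 2 ≤ n0 * ‖posSqrt P ((T' ^ (2 * n)) x)‖ := fun n => by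
    have e : (T' ^ (2 * n)) x = (T' ^ n) ((T' ^ n) x) := by rw [two_mul, pow_add]; rfl
    rw [← real_inner_self_eq_norm_sq, hsymn, e]
    exact real_inner_le_norm _ _
  -- The kernel of the seminorm is invariant under `T'`, so a null vector cannot violate the
  -- inequality.
  have hn0pos : 0 < n0 := by
    rcases (norm_nonneg (posSqrt P x)).lt_or_eq with h0 | h0
    · exact h0
    · have := hstep 1
      rw [hn0, ← h0, zero_mul, pow_one] at this
      have h1 : ‖posSqrt P (T' x)‖ = 0 := by
        nlinarith [norm_nonneg (posSqrt P (T' x))]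
      rw [h1, hn0, ← h0, mul_zero] at hlt
      exact absurd hlt (lt_irrefl _)
  set a := ‖posSqrt P (T' x)‖ / n0 with ha
  have hlt' : ‖T‖ < a := by rwa [ha, lt_div_iff₀ hn0pos]
  have ha0 : 0 < a := (norm_nonneg _).trans_lt hlt'
  have hgrow : ∀ k : ℕ, n0 * a ^ (2 ^ k) ≤ ‖posSqrt P ((T' ^ (2 ^ k)) x)‖ := by
    intro k
    induction k with
    | zero =>
      rw [ha]; simp only [pow_zero, pow_one]
      rw [mul_div_cancel₀ _ hn0pos.ne']
    | succ k ih =>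
      have h1 := hstep (2 ^ k)
      rw [← pow_succ'] at h1
      have h2 : (n0 * a ^ 2 ^ k) ^ 2 ≤ n0 * ‖posSqrt P ((T' ^ 2 ^ (k + 1)) x)‖ :=
        (by gcongr : _ ≤ _).trans h1
      have h3 : (n0 * a ^ 2 ^ k) ^ 2 = n0 * (n0 * a ^ 2 ^ (k + 1)) := by ring
      rw [h3] at h2
      exact le_of_mul_le_mul_left h2 hn0pos
  have hbound : ∀ k : ℕ, ‖posSqrt P ((T' ^ (2 ^ k)) x)‖ ≤ ‖posSqrt P‖ * (‖T‖ ^ (2 ^ k) * ‖x‖) := by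
    intro k
    refine (ContinuousLinearMap.le_opNorm _ _).trans ?_
    gcongr
    refine (ContinuousLinearMap.le_opNorm _ _).trans ?_
    gcongr
    rw [← hT'n]
    exact norm_pow_le' _ (by positivity)
  have hlim : Tendsto (fun k : ℕ => (‖T‖ / a) ^ (2 ^ k) * (‖posSqrt P‖ * ‖x‖)) atTop (𝓝 0) := by
    have h1 : Tendsto (fun k : ℕ => (‖T‖ / a) ^ (2 ^ k)) atTop (𝓝 0) :=
      (tendsto_pow_atTop_nhds_zero_of_lt_one (by positivity) ((div_lt_one ha0).2 hlt')).comp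
        (tendsto_pow_atTop_atTop_of_one_lt one_lt_two)
    simpa using h1.mul_const (‖posSqrt P‖ * ‖x‖)
  have : n0 ≤ 0 := ge_of_tendsto' hlim fun k => by
    have := (hgrow k).trans (hbound k)
    rw [div_pow, div_mul_eq_mul_div, le_div_iff₀ (by positivity)]
    linarith
  linarith

/-- If `‖B x‖ ≤ c ‖A x‖` and `A` has dense range, then `B` factors through `A`. -/
theorem exists_comp_eq_of_norm_le {F : Type*} [NormedAddCommGroup F] [InnerProductSpace ℝ F]
    [CompleteSpace F] {A : E →L[ℝ] E} {B : E →L[ℝ] F} {c : ℝ} (hc : 0 ≤ c) (hA : DenseRange A)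
    (h : ∀ x, ‖B x‖ ≤ c * ‖A x‖) : ∃ D : E →L[ℝ] F, (∀ x, D (A x) = B x) ∧ ‖D‖ ≤ c :=
  ⟨(B : E →ₗ[ℝ] F).extendOfNorm (A : E →ₗ[ℝ] E),
    fun x => LinearMap.extendOfNorm_eq (f := (B : E →ₗ[ℝ] F)) (e := (A : E →ₗ[ℝ] E)) hA ⟨c, h⟩ x,
    LinearMap.opNorm_extendOfNorm_le (f := (B : E →ₗ[ℝ] F)) (e := (A : E →ₗ[ℝ] E)) hA hc h⟩

end SquareRoot

end OrnsteinUhlenbeck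

namespace OrnsteinUhlenbeck

/-! ### Strongly continuous semigroups, their adjoints and symmetrizations -/

section Semigroup

variable {E : Type*} [NormedAddCommGroup E] [InnerProductSpace ℝ E] [CompleteSpace E]

/-- Strong convergence on a dense set extends to all vectors under a uniform norm bound. -/
theorem tendsto_apply_of_dense {ι : Type*} {l : Filter ι} {T : ι → E →L[ℝ] E} {R : E →L[ℝ] E}
    {M : ℝ} (hM : ∀ᶠ t in l, ‖T t‖ ≤ M) {D : Set E} (hD : Dense D)
    (h : ∀ x ∈ D, Tendsto (fun t => T t x) l (𝓝 (R x))) (x : E) :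
    Tendsto (fun t => T t x) l (𝓝 (R x)) := by
  rw [Metric.tendsto_nhds]
  intro ε hε
  set C := |M| + ‖R‖ + 1 with hC
  have hC0 : 0 < C := by positivity
  obtain ⟨y, hy, hxy⟩ := hD.exists_dist_lt x (show 0 < ε / (2 * C) by positivity)
  rw [dist_eq_norm] at hxy
  filter_upwards [hM, (Metric.tendsto_nhds.1 (h y hy)) (ε / 2) (by positivity)] with t h1 h2
  rw [dist_eq_norm] at h2 ⊢
  have e : T t x - R x = T t (x - y) + (T t y - R y) + R (y - x) := by
    simp only [map_sub]; abel
  have b1 : ‖T t (x - y)‖ ≤ |M| * ‖x - y‖ :=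
    ((T t).le_opNorm _).trans (by gcongr; exact h1.trans (le_abs_self M))
  have b2 : ‖R (y - x)‖ ≤ ‖R‖ * ‖x - y‖ := by
    rw [norm_sub_rev x y]; exact R.le_opNorm _
  have b3 : C * ‖x - y‖ < ε / 2 := by
    calc C * ‖x - y‖ < C * (ε / (2 * C)) := by gcongr
      _ = ε / 2 := by field_simp
  calc ‖T t x - R x‖ ≤ ‖T t (x - y)‖ + ‖T t y - R y‖ + ‖R (y - x)‖ := by
        rw [e]; exact norm_add₃_le
    _ ≤ (|M| + ‖R‖) * ‖x - y‖ + ‖T t y - R y‖ := by linarith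
    _ < ε := by nlinarith [norm_nonneg (x - y)]

/-- The averages of `f` over `[0, r]` converge to `f 0`. This recovers information at time zero from
integrated identities. -/
theorem eq_zero_of_intervalIntegral_eq_zero {F : Type*} [NormedAddCommGroup F] [NormedSpace ℝ F]
    [CompleteSpace F] {f : ℝ → F} (hf : ContinuousOn f (Ici 0))
    (h : ∀ r, 0 < r → r ≤ 1 → ∫ s in (0 : ℝ)..r, f s = 0) : f 0 = 0 := by
  rw [← norm_eq_zero]
  refine le_antisymm (le_of_forall_pos_le_add fun ε hε => ?_) (norm_nonneg _)
  have h0 : Tendsto f (𝓝[>] 0) (𝓝 (f 0)) :=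
    (hf 0 self_mem_Ici).mono_left (nhdsWithin_mono _ Ioi_subset_Ici_self)
  have h1 := (Metric.tendsto_nhds.1 h0) ε hε
  obtain ⟨u, hu, hu1⟩ := mem_nhdsGT_iff_exists_Ioc_subset.1 h1
  have hu0 : (0 : ℝ) < u := hu
  set r := min u 1 with hr
  have hr0 : 0 < r := lt_min hu0 one_pos
  have hint : IntervalIntegrable f volume 0 r :=
    (hf.mono fun s hs => by rw [uIcc_of_le hr0.le] at hs; exact hs.1).intervalIntegrable
  have h2 := intervalIntegral.norm_integral_le_of_norm_le_const (a := 0) (b := r)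
    (f := fun s => f s - f 0) (C := ε) fun s hs => by
      rw [uIoc_of_le hr0.le] at hs
      have := hu1 (⟨hs.1, hs.2.trans (min_le_left _ _)⟩ : s ∈ Ioc 0 u)
      rw [mem_ofPred_eq, dist_eq_norm] at this
      exact this.le
  rw [intervalIntegral.integral_sub hint intervalIntegrable_const, h r hr0 (min_le_right _ _),
    intervalIntegral.integral_const, zero_sub, norm_neg, norm_smul, sub_zero, Real.norm_eq_abs,
    mul_comm ε, abs_of_pos hr0] at h2
  linarith [le_of_mul_le_mul_left h2 hr0]

namespace IsC0Semigroup

variable {S : ℝ → E →L[ℝ] E}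

theorem congr {T : ℝ → E →L[ℝ] E} (hS : IsC0Semigroup S) (h : ∀ t, 0 ≤ t → T t = S t) :
    IsC0Semigroup T where
  map_zero := by rw [h 0 le_rfl, hS.map_zero]
  map_add s t hs ht := by rw [h _ (add_nonneg hs ht), h s hs, h t ht, hS.map_add s t hs ht]
  tendsto_zero x := (hS.tendsto_zero x).congr' (by
    filter_upwards [self_mem_nhdsWithin] with t ht
    rw [h t (le_of_lt ht)])

theorem map_add_apply (hS : IsC0Semigroup S) {s t : ℝ} (hs : 0 ≤ s) (ht : 0 ≤ t) (x : E) :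
    S (s + t) x = S s (S t x) := by rw [hS.map_add s t hs ht]; rfl

theorem map_zero_apply (hS : IsC0Semigroup S) (x : E) : S 0 x = x := by rw [hS.map_zero]; rfl

theorem map_nat_mul (hS : IsC0Semigroup S) {t : ℝ} (ht : 0 ≤ t) (n : ℕ) :
    S (n * t) = S t ^ n := by
  induction n with
  | zero => simp [hS.map_zero]; rfl
  | succ n ih =>
    rw [Nat.cast_succ, add_mul, one_mul, hS.map_add _ _ (by positivity) ht, ih, pow_succ]
    rfl

theorem tendsto_zero_ge (hS : IsC0Semigroup S) (x : E) :
    Tendsto (fun t => S t x) (𝓝[≥] 0) (𝓝 x) := by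
  have h : ContinuousWithinAt (fun t => S t x) (Ioi 0) 0 := by
    rw [ContinuousWithinAt, hS.map_zero_apply]; exact hS.tendsto_zero x
  have h2 := continuousWithinAt_Ioi_iff_Ici.1 h
  rwa [ContinuousWithinAt, hS.map_zero_apply] at h2

/-- Otherwise some times `t n → 0` have `‖S (t n)‖ > n`; every orbit along them converges and is
bounded, which contradicts Banach–Steinhaus. -/
theorem exists_norm_le_near_zero (hS : IsC0Semigroup S) :
    ∃ δ > 0, ∃ M : ℝ, ∀ t, 0 ≤ t → t ≤ δ → ‖S t‖ ≤ M := by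
  by_contra! hcon
  choose t ht0 ht1 htM using fun n : ℕ =>
    hcon (1 / ((n : ℝ) + 1)) (by positivity) (n : ℝ)
  have hlim : Tendsto t atTop (𝓝[≥] 0) := by
    refine tendsto_nhdsWithin_iff.2 ⟨squeeze_zero ht0 ht1 tendsto_one_div_add_atTop_nhds_zero_nat,
      Eventually.of_forall ht0⟩
  obtain ⟨C, hC⟩ := banach_steinhaus (g := fun n => S (t n)) fun x => by
    obtain ⟨C, hC⟩ := ((hS.tendsto_zero_ge x).comp hlim).norm.bddAbove_range
    exact ⟨C, fun n => hC ⟨n, rfl⟩⟩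
  obtain ⟨n, hn⟩ := exists_nat_gt C
  exact absurd (htM n) (not_lt.2 ((hC n).trans hn.le))

theorem exists_norm_le (hS : IsC0Semigroup S) (T : ℝ) :
    ∃ M : ℝ, 0 ≤ M ∧ ∀ t, 0 ≤ t → t ≤ T → ‖S t‖ ≤ M := by
  obtain ⟨δ, hδ, M, hM⟩ := hS.exists_norm_le_near_zero
  have hM0 : 0 ≤ M := (norm_nonneg _).trans (hM 0 le_rfl hδ.le)
  obtain ⟨n, hn⟩ := exists_nat_gt (T / δ)
  refine ⟨M ^ (n + 1), by positivity, fun t ht htT => ?_⟩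
  have hn1 : (0 : ℝ) < ((n + 1 : ℕ) : ℝ) := by positivity
  have e : t = ((n + 1 : ℕ) : ℝ) * (t / ((n + 1 : ℕ) : ℝ)) := by field_simp
  rw [e, hS.map_nat_mul (by positivity)]
  refine (norm_pow_le' _ (Nat.succ_pos n)).trans ?_
  gcongr
  refine hM _ (by positivity) ?_
  rw [div_le_iff₀ hn1]
  rw [div_lt_iff₀ hδ] at hn
  push_cast
  nlinarith

theorem continuousOn (hS : IsC0Semigroup S) (x : E) : ContinuousOn (fun t => S t x) (Ici 0) := by
  intro s hs
  obtain ⟨M, hM0, hM⟩ := hS.exists_norm_le (s + 1)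
  -- The same modulus serves both sides of `s`: the operator at the smaller of the two times is
  -- factored out, and its norm is at most `M`.
  have hω : Tendsto (fun t : ℝ => M * ‖S |t - s| x - x‖) (𝓝[Ici 0] s) (𝓝 0) := by
    have h1 : Tendsto (fun t : ℝ => |t - s|) (𝓝[Ici 0] s) (𝓝[≥] 0) := by
      refine tendsto_nhdsWithin_iff.2 ⟨?_, Eventually.of_forall fun t => mem_Ici.2 (abs_nonneg _)⟩
      have : Continuous fun t : ℝ => |t - s| := by fun_prop
      simpa using (this.tendsto s).mono_left nhdsWithin_le_nhds
    have h2 := ((((hS.tendsto_zero_ge x).comp h1).sub_const x).norm).const_mul M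
    simpa using h2
  rw [ContinuousWithinAt, tendsto_iff_norm_sub_tendsto_zero]
  refine squeeze_zero' (Eventually.of_forall fun t => norm_nonneg _) ?_ hω
  have hs1 : ∀ᶠ t in 𝓝[Ici 0] s, t ≤ s + 1 :=
    nhdsWithin_le_nhds (Iic_mem_nhds (by linarith))
  filter_upwards [self_mem_nhdsWithin, hs1] with t ht ht1
  have hs' : (0 : ℝ) ≤ s := hs
  have ht' : (0 : ℝ) ≤ t := ht
  rcases le_total s t with hst | hst
  · have e : S t x - S s x = S s (S |t - s| x - x) := by
      rw [map_sub, ← hS.map_add_apply hs' (abs_nonneg _), abs_of_nonneg (by linarith)]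
      congr 3; ring
    rw [e]
    exact ((S s).le_opNorm _).trans (by gcongr; exact hM s hs' (by linarith))
  · have e : S t x - S s x = - S t (S |t - s| x - x) := by
      rw [map_sub, ← hS.map_add_apply ht' (abs_nonneg _), abs_of_nonpos (by linarith), neg_sub]
      congr 3; ring
    rw [e, norm_neg]
    exact ((S t).le_opNorm _).trans (by gcongr; exact hM t ht' (by linarith))

theorem intervalIntegrable (hS : IsC0Semigroup S) (x : E) {a b : ℝ} (ha : 0 ≤ a) (hb : 0 ≤ b) :
    IntervalIntegrable (fun t => S t x) volume a b :=
  ((hS.continuousOn x).mono fun _ ht => (le_min ha hb).trans ht.1).intervalIntegrable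

/-- The operator `x ↦ ∫_0^r S(s) x ds`. -/
theorem exists_integral (hS : IsC0Semigroup S) {r : ℝ} (hr : 0 ≤ r) :
    ∃ I : E →L[ℝ] E, ∀ x, I x = ∫ s in (0 : ℝ)..r, S s x := by
  obtain ⟨M, hM0, hM⟩ := hS.exists_norm_le r
  refine ⟨LinearMap.mkContinuous
    { toFun := fun x => ∫ s in (0 : ℝ)..r, S s x
      map_add' := fun x y => by
        rw [← intervalIntegral.integral_add (hS.intervalIntegrable x le_rfl hr)
          (hS.intervalIntegrable y le_rfl hr)]
        exact intervalIntegral.integral_congr fun s _ => (S s).map_add x y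
      map_smul' := fun c x => by
        rw [RingHom.id_apply, ← intervalIntegral.integral_smul]
        exact intervalIntegral.integral_congr fun s _ => (S s).map_smul c x } (M * r) fun x => ?_, fun x => rfl⟩
  have := intervalIntegral.norm_integral_le_of_norm_le_const (a := 0) (b := r)
    (f := fun s => S s x) (C := M * ‖x‖) fun s hs => by
      rw [uIoc_of_le hr] at hs
      exact ((S s).le_opNorm x).trans (by gcongr; exact hM s hs.1.le hs.2)
  rw [sub_zero, abs_of_nonneg hr] at this
  exact this.trans (le_of_eq (by ring))

theorem eq_zero_of_integral_eq_zero (hS : IsC0Semigroup S) {x : E}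
    (h : ∀ r, 0 < r → r ≤ 1 → ∫ s in (0 : ℝ)..r, S s x = 0) : x = 0 := by
  simpa [hS.map_zero_apply] using
    eq_zero_of_intervalIntegral_eq_zero (hS.continuousOn x) h

/-- The adjoint of a strongly continuous semigroup on a Hilbert space is strongly continuous. -/
theorem adjoint (hS : IsC0Semigroup S) :
    IsC0Semigroup fun t => ContinuousLinearMap.adjoint (S t) where
  map_zero := by
    rw [hS.map_zero]; exact ContinuousLinearMap.adjoint_id
  map_add s t hs ht := by
    rw [add_comm, hS.map_add t s ht hs, ContinuousLinearMap.adjoint_comp]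
  tendsto_zero := by
    obtain ⟨M, hM0, hM⟩ := hS.exists_norm_le 2
    choose I hI using fun r : {r : ℝ // 0 < r ∧ r ≤ 1} => hS.exists_integral r.2.1.le
    -- With `I r` the integral of the semigroup over `[0, r]`, telescoping gives `‖I r ∘L S t - I r‖
    -- ≤ 2 * t * M`, so the adjoint semigroup is continuous at zero on these vectors. The bound on
    -- `[0, 2]` suffices since `r + t ≤ 2`. A vector orthogonal to all of them is killed by every `I
    -- r`, hence is zero.
    set G : Set E := {x | ∃ r y, x = ContinuousLinearMap.adjoint (I r) y} with hG
    have hdense : Dense (Submodule.span ℝ G : Set E) := by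
      rw [Submodule.dense_iff_topologicalClosure_eq_top, Submodule.topologicalClosure_eq_top_iff,
        Submodule.eq_bot_iff]
      intro z hz
      rw [Submodule.mem_orthogonal] at hz
      refine hS.eq_zero_of_integral_eq_zero fun r hr0 hr1 => ?_
      rw [← hI ⟨r, hr0, hr1⟩, ← norm_eq_zero, ← sq_eq_zero_iff, ← real_inner_self_eq_norm_sq,
        ← ContinuousLinearMap.adjoint_inner_left]
      exact hz _ (Submodule.subset_span ⟨_, _, rfl⟩)
    have hlt : ∀ᶠ t : ℝ in 𝓝[>] 0, t ≤ 1 := nhdsWithin_le_nhds (Iic_mem_nhds one_pos)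
    have hgen : ∀ x ∈ G, Tendsto (fun t => ContinuousLinearMap.adjoint (S t) x) (𝓝[>] 0) (𝓝 x) := by
      rintro _ ⟨⟨r, hr0, hr1⟩, y, rfl⟩
      rw [tendsto_iff_norm_sub_tendsto_zero]
      have hlim : Tendsto (fun t : ℝ => 2 * t * M * ‖y‖) (𝓝[>] 0) (𝓝 0) := by
        have : Continuous fun t : ℝ => 2 * t * M * ‖y‖ := by fun_prop
        simpa using (this.tendsto 0).mono_left nhdsWithin_le_nhds
      refine squeeze_zero' (Eventually.of_forall fun t => norm_nonneg _) ?_ hlim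
      filter_upwards [self_mem_nhdsWithin, hlt] with t ht0 ht1
      have ht0' : (0 : ℝ) < t := ht0
      have e : ContinuousLinearMap.adjoint (S t) (ContinuousLinearMap.adjoint (I ⟨r, hr0, hr1⟩) y) -
          ContinuousLinearMap.adjoint (I ⟨r, hr0, hr1⟩) y =
          ContinuousLinearMap.adjoint (I ⟨r, hr0, hr1⟩ ∘L S t - I ⟨r, hr0, hr1⟩) y := by
        rw [map_sub, ContinuousLinearMap.adjoint_comp]; rfl
      rw [e]
      refine (ContinuousLinearMap.le_opNorm _ _).trans ?_
      rw [LinearIsometryEquiv.norm_map]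
      gcongr
      refine ContinuousLinearMap.opNorm_le_bound _ (by positivity) fun z => ?_
      have e2 : (I ⟨r, hr0, hr1⟩ ∘L S t - I ⟨r, hr0, hr1⟩) z =
          (∫ s in r..(r + t), S s z) - ∫ s in (0 : ℝ)..t, S s z := by
        have h1 : I ⟨r, hr0, hr1⟩ (S t z) = ∫ s in t..(r + t), S s z := by
          rw [hI]
          have := intervalIntegral.integral_comp_add_right (a := 0) (b := r) (fun s => S s z) t
          rw [zero_add] at this
          rw [← this]
          refine intervalIntegral.integral_congr fun s hs => ?_
          rw [uIcc_of_le hr0.le] at hs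
          exact (hS.map_add_apply hs.1 ht0'.le z).symm
        change I ⟨r, hr0, hr1⟩ (S t z) - I ⟨r, hr0, hr1⟩ z = _
        rw [h1, hI]
        have i1 := intervalIntegral.integral_add_adjacent_intervals
          (hS.intervalIntegrable z le_rfl ht0'.le)
          (hS.intervalIntegrable z ht0'.le (add_pos hr0 ht0').le)
        have i2 := intervalIntegral.integral_add_adjacent_intervals
          (hS.intervalIntegrable z le_rfl hr0.le)
          (hS.intervalIntegrable z hr0.le (add_pos hr0 ht0').le)
        rw [← i1, ← eq_sub_iff_add_eq] at i2
        change _ - (∫ s in (0 : ℝ)..r, S s z) = _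
        rw [i2]; abel
      have hb : ∀ a, 0 ≤ a → a ≤ 1 → ‖∫ s in a..(a + t), S s z‖ ≤ M * ‖z‖ * t := fun a ha0 ha1 => by
        have := intervalIntegral.norm_integral_le_of_norm_le_const (a := a) (b := a + t)
          (f := fun s => S s z) (C := M * ‖z‖) fun s hs => by
            rw [uIoc_of_le (by linarith)] at hs
            exact ((S s).le_opNorm z).trans (by
              gcongr; exact hM s (by linarith [hs.1]) (by linarith [hs.2]))
        rwa [add_sub_cancel_left, abs_of_pos ht0'] at this
      have hb0 := hb 0 le_rfl zero_le_one
      rw [zero_add] at hb0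
      rw [e2]
      refine (norm_sub_le _ _).trans ((add_le_add (hb r hr0.le hr1) hb0).trans (le_of_eq ?_))
      ring
    refine fun x => tendsto_apply_of_dense (R := ContinuousLinearMap.id ℝ E) (M := M) ?_ hdense
      (fun x hx => ?_) x
    · filter_upwards [self_mem_nhdsWithin, hlt] with t ht0 ht1
      rw [LinearIsometryEquiv.norm_map]
      exact hM t (le_of_lt ht0) (by linarith)
    · change Tendsto _ _ (𝓝 x)
      induction hx using Submodule.span_induction with
      | mem x hx => exact hgen x hx
      | zero => simp
      | add x y _ _ hx hy => simpa using hx.add hy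
      | smul c x _ hx => simpa using hx.const_smul c

/-- A strongly continuous semigroup with `S(t) P = P S*(t)` for a positive injective `P` is
similar, through `P^{1/2}`, to a strongly continuous selfadjoint semigroup. -/
theorem exists_symmetrization (hS : IsC0Semigroup S) {P : E →L[ℝ] E} (hP : P.IsPositive)
    (hinj : Function.Injective P)
    (h : ∀ t, 0 ≤ t → S t ∘L P = P ∘L ContinuousLinearMap.adjoint (S t)) :
    ∃ T : ℝ → E →L[ℝ] E, IsC0Semigroup T ∧ (∀ t, 0 ≤ t → IsSelfAdjoint (T t)) ∧
      (∀ t, 0 ≤ t → ∀ x, T t (posSqrt P x) = posSqrt P (ContinuousLinearMap.adjoint (S t) x)) ∧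
      ∀ t, 0 ≤ t → posSqrt P ∘L T t = S t ∘L posSqrt P := by
  have hd := denseRange_posSqrt hP hinj
  have hex : ∀ t, ∃ D : E →L[ℝ] E, 0 ≤ t → (∀ x, D (posSqrt P x) =
      posSqrt P (ContinuousLinearMap.adjoint (S t) x)) ∧ ‖D‖ ≤ ‖S t‖ := fun t => by
    by_cases ht : 0 ≤ t
    · obtain ⟨D, h1, h2⟩ := exists_comp_eq_of_norm_le
        (B := posSqrt P ∘L ContinuousLinearMap.adjoint (S t)) (norm_nonneg (S t)) hd
        (norm_posSqrt_adjoint_le hP (h t ht))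
      exact ⟨D, fun _ => ⟨h1, h2⟩⟩
    · exact ⟨0, fun h => absurd h ht⟩
  choose T hT using hex
  have hT1 := fun t ht => (hT t ht).1
  have hT2 := fun t ht => (hT t ht).2
  have hsym : ∀ t, 0 ≤ t → IsSelfAdjoint (T t) := fun t ht => by
    have key : ∀ u v, ⟪T t u, v⟫ = ⟪u, T t v⟫ := by
      intro u v
      refine hd.induction_on₂ (p := fun u v => ⟪T t u, v⟫ = ⟪u, T t v⟫)
        (isClosed_eq (by fun_prop) (by fun_prop)) (fun a b => ?_) u v
      have e : P (ContinuousLinearMap.adjoint (S t) a) = S t (P a) :=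
        (congrArg (fun R : E →L[ℝ] E => R a) (h t ht)).symm
      rw [hT1 t ht, hT1 t ht, inner_posSqrt_posSqrt hP, inner_posSqrt_posSqrt hP, e,
        ContinuousLinearMap.adjoint_inner_right]
    rw [ContinuousLinearMap.isSelfAdjoint_iff']
    exact ContinuousLinearMap.ext fun u => ext_inner_right ℝ fun v => by
      rw [ContinuousLinearMap.adjoint_inner_left, key]
  have hext : ∀ A B : E →L[ℝ] E, (∀ x, A (posSqrt P x) = B (posSqrt P x)) → A = B :=
    fun A B hAB => ContinuousLinearMap.ext fun x =>
      hd.induction_on (p := fun x => A x = B x) x (isClosed_eq (by fun_prop) (by fun_prop)) hAB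
  have hSa := hS.adjoint
  refine ⟨T, ⟨?_, fun s t hs ht => ?_, fun x => ?_⟩, hsym, hT1, fun t ht => ?_⟩
  · refine hext _ _ fun x => ?_
    rw [hT1 0 le_rfl, hSa.map_zero_apply]; rfl
  · refine hext _ _ fun x => ?_
    rw [hT1 _ (add_nonneg hs ht), hSa.map_add_apply hs ht]
    change _ = T s (T t _)
    rw [hT1 t ht, hT1 s hs]
  · obtain ⟨M, hM0, hM⟩ := hS.exists_norm_le 1
    have hlt : ∀ᶠ t : ℝ in 𝓝[>] 0, t ≤ 1 := nhdsWithin_le_nhds (Iic_mem_nhds one_pos)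
    refine tendsto_apply_of_dense (R := ContinuousLinearMap.id ℝ E) (M := M) ?_ hd ?_ x
    · filter_upwards [self_mem_nhdsWithin, hlt] with t ht0 ht1
      exact (hT2 t (le_of_lt ht0)).trans (hM t (le_of_lt ht0) ht1)
    · rintro _ ⟨y, rfl⟩
      refine Tendsto.congr' ?_ (((posSqrt P).continuous.tendsto y).comp (hSa.tendsto_zero y))
      filter_upwards [self_mem_nhdsWithin] with t ht0
      exact (hT1 t (le_of_lt ht0) y).symm
  -- The second intertwining is the adjoint of the defining one, as `T t` and `posSqrt P` are
  -- selfadjoint.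
  · have e : T t ∘L posSqrt P = posSqrt P ∘L ContinuousLinearMap.adjoint (S t) :=
      ContinuousLinearMap.ext (hT1 t ht)
    have := congrArg ContinuousLinearMap.adjoint e
    rwa [ContinuousLinearMap.adjoint_comp, ContinuousLinearMap.adjoint_comp,
      ContinuousLinearMap.adjoint_adjoint, (hsym t ht).adjoint_eq,
      (posSqrt_spec hP).1.isSelfAdjoint.adjoint_eq] at this

/-- If `S u x = 0`, then `‖S (u / 2) x‖ ^ 2 = ⟪S u x, x⟫ = 0`. Halving repeatedly and using
continuity at zero gives `x = 0`. -/
theorem injective_of_isSelfAdjoint (hS : IsC0Semigroup S) (hsa : ∀ t, 0 ≤ t → IsSelfAdjoint (S t))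
    {t : ℝ} (ht : 0 ≤ t) : Function.Injective (S t) := by
  rw [injective_iff_map_eq_zero]
  intro x hx
  have hhalf : ∀ u, 0 ≤ u → S u x = 0 → S (u / 2) x = 0 := fun u hu h => by
    have h2 : (0 : ℝ) ≤ u / 2 := by positivity
    rw [← norm_eq_zero, ← sq_eq_zero_iff, ← real_inner_self_eq_norm_sq,
      ← ContinuousLinearMap.adjoint_inner_left, (hsa _ h2).adjoint_eq, ← hS.map_add_apply h2 h2,
      add_halves, h, inner_zero_left]
  have hn : ∀ n : ℕ, S (t * (1 / 2) ^ n) x = 0 := fun n => by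
    induction n with
    | zero => simpa using hx
    | succ n ih =>
      have := hhalf _ (by positivity) ih
      rwa [show t * (1 / 2) ^ n / 2 = t * (1 / 2) ^ (n + 1) by ring] at this
  have hlim : Tendsto (fun n : ℕ => t * (1 / 2 : ℝ) ^ n) atTop (𝓝[≥] 0) := by
    refine tendsto_nhdsWithin_iff.2 ⟨?_, Eventually.of_forall fun n => ?_⟩
    · simpa using (tendsto_pow_atTop_nhds_zero_of_lt_one (r := (1 / 2 : ℝ)) (by norm_num)
        (by norm_num)).const_mul t
    · exact mem_Ici.2 (by positivity)
  exact tendsto_nhds_unique ((hS.tendsto_zero_ge x).comp hlim)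
    (tendsto_const_nhds.congr fun n => (hn n).symm)

end IsC0Semigroup

end Semigroup

end OrnsteinUhlenbeck

namespace OrnsteinUhlenbeck

/-! ### The covariance operators Q_t and Q_∞ -/

section Covariance

variable {H : Type*} [NormedAddCommGroup H] [InnerProductSpace ℝ H] [CompleteSpace H]

theorem IsC0Semigroup.continuousOn_apply {S : ℝ → H →L[ℝ] H} (hS : IsC0Semigroup S) {f : ℝ → H}
    (hf : ContinuousOn f (Ici 0)) : ContinuousOn (fun s => S s (f s)) (Ici 0) := by
  intro s hs
  obtain ⟨M, hM0, hM⟩ := hS.exists_norm_le (s + 1)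
  have h1 : Tendsto (fun t => M * ‖f t - f s‖ + ‖S t (f s) - S s (f s)‖) (𝓝[Ici 0] s) (𝓝 0) := by
    have a1 := ((tendsto_iff_norm_sub_tendsto_zero.1 (hf s hs)).const_mul M).add
      (tendsto_iff_norm_sub_tendsto_zero.1 (hS.continuousOn (f s) s hs))
    simpa using a1
  rw [ContinuousWithinAt, tendsto_iff_norm_sub_tendsto_zero]
  refine squeeze_zero' (Eventually.of_forall fun t => norm_nonneg _) ?_ h1
  have hs1 : ∀ᶠ t in 𝓝[Ici 0] s, t ≤ s + 1 :=
    nhdsWithin_le_nhds (Iic_mem_nhds (by linarith))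
  filter_upwards [self_mem_nhdsWithin, hs1] with t ht ht1
  have e : S t (f t) - S s (f s) = S t (f t - f s) + (S t (f s) - S s (f s)) := by
    rw [map_sub]; abel
  rw [e]
  refine (norm_add_le _ _).trans ?_
  gcongr
  exact ((S t).le_opNorm _).trans (by gcongr; exact hM t ht ht1)

theorem inner_covKernel (S : ℝ → H →L[ℝ] H) (Q : H →L[ℝ] H) (s : ℝ) (x y : H) :
    ⟪covKernel S Q s x, y⟫ =
      ⟪Q (ContinuousLinearMap.adjoint (S s) x), ContinuousLinearMap.adjoint (S s) y⟫ := by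
  rw [ContinuousLinearMap.adjoint_inner_right]; rfl

theorem isPositive_covKernel (S : ℝ → H →L[ℝ] H) {Q : H →L[ℝ] H} (hQ : Q.IsPositive) (s : ℝ) :
    (covKernel S Q s).IsPositive :=
  hQ.conj_adjoint (S s)

/-- The operator norm of `C` is at most that of its root squared, hence at most the squared
Hilbert–Schmidt norm of the root, which is the trace. -/
theorem enorm_apply_le_trace {C : H →L[ℝ] H} (hC : C.IsPositive) (x : H) :
    ‖C x‖ₑ ≤ trace C * ‖x‖ₑ := by
  rw [← posSqrt_apply_apply hC, ← hsNormSq_posSqrt hC]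
  calc ‖posSqrt C (posSqrt C x)‖ₑ ≤ ‖posSqrt C‖ₑ * (‖posSqrt C‖ₑ * ‖x‖ₑ) :=
        ((posSqrt C).le_opENorm _).trans (by gcongr; exact (posSqrt C).le_opENorm _)
    _ = ‖posSqrt C‖ₑ ^ 2 * ‖x‖ₑ := by ring
    _ ≤ _ := by gcongr; exact enorm_sq_le_hsNormSq _

variable {S : ℝ → H →L[ℝ] H} {Q : H →L[ℝ] H}

theorem continuousOn_covKernel (hS : IsC0Semigroup S) (Q : H →L[ℝ] H) (x : H) :
    ContinuousOn (fun s => covKernel S Q s x) (Ici 0) :=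
  hS.continuousOn_apply (f := fun s => Q (ContinuousLinearMap.adjoint (S s) x))
    (Q.continuous.comp_continuousOn (hS.adjoint.continuousOn x))

theorem integrableOn_covKernel (hS : IsC0Semigroup S) (hQ : Q.IsPositive)
    (htr : ∫⁻ s in Ioi (0 : ℝ), trace (covKernel S Q s) < ∞) (x : H) :
    IntegrableOn (fun s => covKernel S Q s x) (Ioi 0) := by
  refine ⟨((continuousOn_covKernel hS Q x).mono Ioi_subset_Ici_self).aestronglyMeasurable
    measurableSet_Ioi, ?_⟩
  refine (lintegral_mono fun s => enorm_apply_le_trace (isPositive_covKernel S hQ s) x).trans_lt ?_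
  rw [lintegral_mul_const' _ _ (by simp)]
  exact ENNReal.mul_lt_top htr (by simp)

theorem exists_integral_covKernel (hS : IsC0Semigroup S) (hQ : Q.IsPositive)
    (htr : ∫⁻ s in Ioi (0 : ℝ), trace (covKernel S Q s) < ∞) {A : Set ℝ} (hA : A ⊆ Ioi 0) :
    ∃ V : H →L[ℝ] H, V.IsPositive ∧ trace V < ∞ ∧
      (∀ x, V x = ∫ s in A, covKernel S Q s x) ∧
      ∀ x y, ⟪V x, y⟫ = ∫ s in A, ⟪covKernel S Q s x, y⟫ := by
  have hint : ∀ x, IntegrableOn (fun s => covKernel S Q s x) A := fun x =>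
    (integrableOn_covKernel hS hQ htr x).mono_set hA
  have htrA : ∫⁻ s in A, trace (covKernel S Q s) < ∞ := (lintegral_mono_set hA).trans_lt htr
  set c := ∫⁻ s in A, trace (covKernel S Q s) with hc
  let V : H →L[ℝ] H := LinearMap.mkContinuous
    { toFun := fun x => ∫ s in A, covKernel S Q s x
      map_add' := fun x y => by
        rw [← integral_add (hint x) (hint y)]
        exact integral_congr_ae (Eventually.of_forall fun s => (covKernel S Q s).map_add x y)
      map_smul' := fun a x => by
        rw [RingHom.id_apply, ← integral_smul]
        exact integral_congr_ae (Eventually.of_forall fun s => (covKernel S Q s).map_smul a x) }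
    c.toReal fun x => by
      have h : ‖∫ s in A, covKernel S Q s x‖ₑ ≤ c * ‖x‖ₑ := by
        refine (enorm_integral_le_lintegral_enorm _).trans ?_
        rw [hc, ← lintegral_mul_const' _ _ (by simp)]
        exact lintegral_mono fun s => enorm_apply_le_trace (isPositive_covKernel S hQ s) x
      have := ENNReal.toReal_mono (ENNReal.mul_ne_top htrA.ne (by simp)) h
      simpa using this
  have hV : ∀ x, V x = ∫ s in A, covKernel S Q s x := fun x => rfl
  have hVi : ∀ x y, ⟪V x, y⟫ = ∫ s in A, ⟪covKernel S Q s x, y⟫ := fun x y => by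
    rw [hV, real_inner_comm, ← integral_inner (hint x)]
    exact integral_congr_ae (Eventually.of_forall fun s => real_inner_comm _ _)
  have hinti : ∀ x y, IntegrableOn (fun s => ⟪covKernel S Q s x, y⟫) A := fun x y =>
    ((hint x).inner_const (𝕜 := ℝ) y)
  refine ⟨V, ?_, ?_, hV, hVi⟩
  · rw [ContinuousLinearMap.isPositive_iff]
    refine ⟨fun x y => ?_, fun x => ?_⟩
    · change ⟪V x, y⟫ = ⟪x, V y⟫
      rw [hVi, real_inner_comm (V y) x, hVi]
      refine integral_congr_ae (Eventually.of_forall fun s => ?_)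
      change ⟪_, _⟫ = ⟪_, _⟫
      rw [(isPositive_covKernel S hQ s).inner_left_eq_inner_right, real_inner_comm]
    · rw [hVi]
      exact integral_nonneg fun s => (isPositive_covKernel S hQ s).inner_nonneg_left x
  · refine lt_of_le_of_lt ?_ htrA
    -- Only finite partial sums are exchanged with the integral: separability is not assumed here,
    -- so the basis may be uncountable.
    rw [trace, ENNReal.tsum_eq_iSup_sum]
    refine iSup_le fun F => ?_
    have h1 : ∀ i, ENNReal.ofReal ⟪V (basis H i), basis H i⟫ =
        ∫⁻ s in A, ENNReal.ofReal ⟪covKernel S Q s (basis H i), basis H i⟫ := fun i => by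
      rw [hVi, ofReal_integral_eq_lintegral_ofReal (hinti _ _)
        (Eventually.of_forall fun s => (isPositive_covKernel S hQ s).inner_nonneg_left _)]
    simp_rw [h1]
    rw [← lintegral_finsetSum' _ fun i _ => (hinti _ _).aemeasurable.ennreal_ofReal]
    exact lintegral_mono fun s => ENNReal.sum_le_tsum F

/-- The part of the integral beyond `t` becomes, after a shift and the semigroup law, the full
integral at adjoint images: Q_∞ = Q_t + S(t)Q_∞S*(t) in weak form. -/
theorem integral_covKernel_add (hS : IsC0Semigroup S) (hQ : Q.IsPositive)
    (htr : ∫⁻ s in Ioi (0 : ℝ), trace (covKernel S Q s) < ∞) {t : ℝ} (ht : 0 ≤ t) (x y : H) :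
    ∫ s in Ioi 0, ⟪covKernel S Q s x, y⟫ = (∫ s in Ioc 0 t, ⟪covKernel S Q s x, y⟫) +
      ∫ s in Ioi 0, ⟪covKernel S Q s (ContinuousLinearMap.adjoint (S t) x),
        ContinuousLinearMap.adjoint (S t) y⟫ := by
  have hint : IntegrableOn (fun s => ⟪covKernel S Q s x, y⟫) (Ioi 0) :=
    ((integrableOn_covKernel hS hQ htr x).inner_const (𝕜 := ℝ) y)
  rw [← Ioc_union_Ioi_eq_Ioi ht, setIntegral_union (Ioc_disjoint_Ioi le_rfl) measurableSet_Ioi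
    (hint.mono_set Ioc_subset_Ioi_self) (hint.mono_set (Ioi_subset_Ioi ht)),
    Ioc_union_Ioi_eq_Ioi ht]
  congr 1
  have hmp := measurePreserving_add_right (volume : Measure ℝ) t
  have he := (MeasurableEquiv.addRight t).measurableEmbedding
  have h2 := hmp.setIntegral_preimage_emb he (fun s => ⟪covKernel S Q s x, y⟫) (Ioi t)
  rw [← h2]
  have e : (fun s : ℝ => s + t) ⁻¹' Ioi t = Ioi 0 := by ext s; simp
  rw [e]
  refine setIntegral_congr_fun measurableSet_Ioi fun s hs => ?_
  have hs0 : 0 ≤ s := le_of_lt hs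
  simp only [inner_covKernel]
  rw [add_comm, hS.map_add t s ht hs0, ContinuousLinearMap.adjoint_comp]
  rfl

end Covariance

end OrnsteinUhlenbeck

namespace OrnsteinUhlenbeck

open ProbabilityTheory

/-! ### Independent standard Gaussian coordinates -/

section WhiteNoise

variable (ι : Type*)

/-- The law of a family of independent standard real Gaussian variables. -/
noncomputable def whiteNoise : Measure (ι → ℝ) := Measure.infinitePi fun _ : ι => gaussianReal 0 1

instance : IsProbabilityMeasure (whiteNoise ι) := by
  unfold whiteNoise; infer_instance

variable {ι}

theorem integral_sq_gaussianReal : ∫ x : ℝ, x * x ∂(gaussianReal 0 1) = 1 := by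
  have h := variance_id_gaussianReal (μ := 0) (v := 1)
  rw [variance_eq_sub (memLp_id_gaussianReal 2)] at h
  simp only [id_eq, integral_id_gaussianReal, Pi.pow_apply] at h
  simpa [pow_two] using h

theorem memLp_eval_whiteNoise (i : ι) : MemLp (fun ω : ι → ℝ => ω i) 2 (whiteNoise ι) :=
  (memLp_id_gaussianReal (μ := 0) (v := 1) 2).comp_measurePreserving
    (measurePreserving_eval_infinitePi (fun _ : ι => gaussianReal 0 1) i)

theorem iIndepFun_whiteNoise : iIndepFun (fun (i : ι) (ω : ι → ℝ) => ω i) (whiteNoise ι) :=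
  iIndepFun_infinitePi (P := fun _ : ι => gaussianReal 0 1) (X := fun _ x => x)
    fun _ => measurable_id

theorem map_eval_whiteNoise (i : ι) : (whiteNoise ι).map (fun ω => ω i) = gaussianReal 0 1 :=
  (measurePreserving_eval_infinitePi (fun _ : ι => gaussianReal 0 1) i).map_eq

open Classical in
theorem integral_eval_mul_eval_whiteNoise (i j : ι) :
    ∫ ω, ω i * ω j ∂(whiteNoise ι) = if i = j then 1 else 0 := by
  have hm := fun i : ι => measurePreserving_eval_infinitePi (fun _ : ι => gaussianReal 0 1) i
  split_ifs with h
  · subst h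
    rw [← integral_sq_gaussianReal, ← map_eval_whiteNoise i,
      integral_map (hm i).measurable.aemeasurable (by fun_prop)]
  · have h1 := (iIndepFun_whiteNoise.indepFun h).integral_mul_eq_mul_integral
      (memLp_eval_whiteNoise i).1 (memLp_eval_whiteNoise j).1
    have h2 : ∫ ω, ω i ∂(whiteNoise ι) = 0 := by
      have h3 := integral_id_gaussianReal (μ := 0) (v := 1)
      rwa [← map_eval_whiteNoise i, integral_map (hm i).measurable.aemeasurable (by fun_prop)] at h3
    rw [h2, zero_mul] at h1
    exact h1

theorem integral_exp_sum_whiteNoise (s : Finset ι) (c : ι → ℝ) :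
    ∫ ω, Complex.exp ((∑ i ∈ s, ω i * c i : ℝ) * Complex.I) ∂(whiteNoise ι) =
      Complex.exp (-((∑ i ∈ s, c i ^ 2 : ℝ) : ℂ) / 2) := by
  have hind : iIndepFun (fun (i : ι) (ω : ι → ℝ) => ω i * c i) (whiteNoise ι) :=
    iIndepFun_infinitePi (P := fun _ : ι => gaussianReal 0 1) (X := fun i x => x * c i)
      fun _ => by fun_prop
  have hm : ∀ i, Measurable fun ω : ι → ℝ => ω i * c i := fun i =>
    (measurable_pi_apply i).mul_const _
  have h := congrFun ((hind.restrict s).charFun_map_fun_finsetSum_eq_prod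
    (X := fun (i : ι) (ω : ι → ℝ) => ω i * c i) (s := s) (P := whiteNoise ι)
    fun i _ => (hm i).aemeasurable) 1
  rw [charFun_apply_real, integral_map (Finset.measurable_sum s fun i _ => hm i).aemeasurable
    (by fun_prop)] at h
  simp only [Complex.ofReal_one, one_mul] at h
  rw [h, Finset.prod_apply]
  have h1 : ∀ i, charFun ((whiteNoise ι).map fun ω => ω i * c i) 1 =
      Complex.exp (-((c i ^ 2 : ℝ) : ℂ) / 2) := fun i => by
    have e : (whiteNoise ι).map (fun ω => ω i * c i) = (gaussianReal 0 1).map (fun x => x * c i) := by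
      rw [← map_eval_whiteNoise i, Measure.map_map (by fun_prop) (by fun_prop)]; rfl
    rw [e, gaussianReal_map_mul_const, charFun_gaussianReal]
    congr 1
    simp [neg_div]
  simp_rw [h1]
  rw [← Complex.exp_sum, ← Finset.sum_div, Finset.sum_neg_distrib]
  push_cast
  rfl

end WhiteNoise

theorem norm_exp_mul_I_sub_le (a b : ℝ) :
    ‖Complex.exp (a * Complex.I) - Complex.exp (b * Complex.I)‖ ≤ |a - b| := by
  have e : Complex.exp (a * Complex.I) - Complex.exp (b * Complex.I) =
      Complex.exp (b * Complex.I) * (Complex.exp (Complex.I * ((a - b : ℝ) : ℂ)) - 1) := by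
    rw [mul_sub, ← Complex.exp_add, mul_one]
    congr 2
    push_cast; ring
  rw [e, norm_mul, Complex.norm_exp_ofReal_mul_I, one_mul]
  exact Real.norm_exp_I_mul_ofReal_sub_one_le

/-! ### Gaussian measures on a Hilbert space -/

section Hilbert

variable {H : Type*} [NormedAddCommGroup H] [InnerProductSpace ℝ H] [CompleteSpace H]

theorem memLp_eval_smul {ι : Type*} (i : ι) (r : H) :
    MemLp (fun ω : ι → ℝ => ω i • r) 2 (whiteNoise ι) :=
  (ContinuousLinearMap.toSpanSingleton ℝ r).comp_memLp' (memLp_eval_whiteNoise i)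

open Classical in
theorem inner_toLp_eval_smul {ι : Type*} (r : ι → H) (i j : ι) :
    ⟪(memLp_eval_smul i (r i)).toLp, (memLp_eval_smul j (r j)).toLp⟫ =
      if i = j then ‖r i‖ ^ 2 else 0 := by
  rw [L2.inner_def]
  have h : ∀ᵐ ω ∂(whiteNoise ι), ⟪((memLp_eval_smul i (r i)).toLp : Lp H 2 (whiteNoise ι)) ω,
      ((memLp_eval_smul j (r j)).toLp : Lp H 2 (whiteNoise ι)) ω⟫ = (ω i * ω j) * ⟪r i, r j⟫ := by
    filter_upwards [(memLp_eval_smul i (r i)).coeFn_toLp, (memLp_eval_smul j (r j)).coeFn_toLp]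
      with ω h1 h2
    rw [h1, h2, real_inner_smul_left, real_inner_smul_right]; ring
  rw [integral_congr_ae h, integral_mul_const, integral_eval_mul_eval_whiteNoise]
  split_ifs with hij
  · subst hij; rw [one_mul, real_inner_self_eq_norm_sq]
  · rw [zero_mul]

theorem norm_sum_toLp_eval_smul_sq {ι : Type*} (r : ι → H) (s : Finset ι) :
    ‖∑ i ∈ s, (memLp_eval_smul i (r i)).toLp‖ ^ 2 = ∑ i ∈ s, ‖r i‖ ^ 2 := by
  classical
  rw [← real_inner_self_eq_norm_sq, sum_inner]
  refine Finset.sum_congr rfl fun i hi => ?_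
  rw [inner_sum]
  simp_rw [inner_toLp_eval_smul r]
  rw [Finset.sum_ite_eq, if_pos hi]

/-- The terms are orthogonal in L², so the Cauchy criterion for the vector series is that of the
numerical series of squared norms. -/
theorem summable_toLp_eval_smul {ι : Type*} {r : ι → H} (hr : Summable fun i => ‖r i‖ ^ 2) :
    Summable fun i => (memLp_eval_smul i (r i)).toLp := by
  rw [summable_iff_vanishing_norm] at hr ⊢
  intro ε hε
  obtain ⟨s, hs⟩ := hr (ε ^ 2) (by positivity)
  refine ⟨s, fun t ht => ?_⟩
  have h := hs t ht
  rw [← norm_sum_toLp_eval_smul_sq, Real.norm_of_nonneg (sq_nonneg _)] at h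
  exact lt_of_pow_lt_pow_left₀ 2 hε.le h

variable [MeasurableSpace H] [BorelSpace H] [SecondCountableTopology H]

/-- The measure is the law of ∑ ξ_i C^{1/2}e_i with independent standard ξ_i; the series converges
in L² because ∑ ‖C^{1/2}e_i‖² = tr C. Its characteristic function is the limit of those of the
partial sums. -/
theorem exists_isGaussianMeasure_zero {C : H →L[ℝ] H} (hC : C.IsPositive) (htr : trace C < ∞) :
    ∃ ν, IsGaussianMeasure 0 C ν := by
  set b := basis H with hb
  set R := posSqrt C with hR
  set r : basisSet H → H := fun i => R (b i) with hr
  have hsum : Summable fun i => ‖r i‖ ^ 2 := by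
    have h : ∑' i, ENNReal.ofReal (‖r i‖ ^ 2) < ∞ := by
      rw [← hsNormSq_posSqrt hC, hsNormSq] at htr
      simpa only [enorm_sq_eq_ofReal_norm_sq] using htr
    have := ENNReal.summable_toReal h.ne
    simpa using this
  set P := whiteNoise (basisSet H) with hP
  obtain ⟨X, hX⟩ : Summable fun i => ((memLp_eval_smul i (r i)).toLp : Lp H 2 P) :=
    summable_toLp_eval_smul hsum
  have hXm : AEMeasurable X P := (Lp.aestronglyMeasurable X).aemeasurable
  refine ⟨P.map X, Measure.isProbabilityMeasure_map hXm, fun z => ?_⟩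
  rw [charFun_apply, integral_map hXm (by fun_prop)]
  set Xs : Finset (basisSet H) → Lp H 2 P := fun s => ∑ i ∈ s, (memLp_eval_smul i (r i)).toLp with hXs
  have hXt : Tendsto Xs atTop (𝓝 X) := by simpa [HasSum] using hX
  classical
  have hXs_ae : ∀ s, ∀ᵐ ω ∂P, ⟪Xs s ω, z⟫ = ∑ i ∈ s, ω i * ⟪r i, z⟫ := fun s => by
    have h1 : ∀ᵐ ω ∂P, Xs s ω = ∑ i ∈ s, ω i • r i := by
      induction s using Finset.induction_on with
      | empty =>
        simp only [hXs, Finset.sum_empty]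
        exact Lp.coeFn_zero _ _ _
      | insert a s ha ih =>
        have e : Xs (insert a s) = (memLp_eval_smul a (r a)).toLp + Xs s := by
          simp only [hXs, Finset.sum_insert ha]
        rw [e]
        filter_upwards [ih, Lp.coeFn_add ((memLp_eval_smul a (r a)).toLp) (Xs s),
          (memLp_eval_smul a (r a)).coeFn_toLp] with ω h1 h2 h3
        rw [h2, Pi.add_apply, h1, h3, Finset.sum_insert ha]
    filter_upwards [h1] with ω h
    rw [h, sum_inner]
    exact Finset.sum_congr rfl fun i _ => real_inner_smul_left _ _ _
  have hlim1 : Tendsto (fun s => ∫ ω, Complex.exp ((⟪Xs s ω, z⟫ : ℝ) * Complex.I) ∂P) atTop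
      (𝓝 (∫ ω, Complex.exp ((⟪X ω, z⟫ : ℝ) * Complex.I) ∂P)) := by
    rw [tendsto_iff_norm_sub_tendsto_zero]
    have h0 : Tendsto (fun s => ‖Xs s - X‖ * ‖z‖) atTop (𝓝 0) := by
      have := (tendsto_iff_norm_sub_tendsto_zero.1 hXt).mul_const ‖z‖
      rwa [zero_mul] at this
    refine squeeze_zero (fun s => norm_nonneg _) (fun s => ?_) h0
    have hint : ∀ Y : Lp H 2 P, Integrable (fun ω => Complex.exp ((⟪Y ω, z⟫ : ℝ) * Complex.I)) P := by
      intro Y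
      have hY := Lp.aestronglyMeasurable Y
      refine Integrable.of_bound (C := 1) ?_ (Eventually.of_forall fun ω => ?_)
      · have h1 : AEStronglyMeasurable (fun ω => ⟪Y ω, z⟫) P := hY.inner aestronglyMeasurable_const
        exact (by fun_prop : Continuous fun x : ℝ => Complex.exp (x * Complex.I)).comp_aestronglyMeasurable h1
      · rw [Complex.norm_exp_ofReal_mul_I]
    rw [← integral_sub (hint _) (hint _)]
    have hD : Integrable (fun ω => ‖(Xs s - X) ω‖) P :=
      ((Lp.memLp (Xs s - X)).integrable one_le_two).norm
    calc ‖∫ ω, Complex.exp ((⟪Xs s ω, z⟫ : ℝ) * Complex.I) -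
          Complex.exp ((⟪X ω, z⟫ : ℝ) * Complex.I) ∂P‖
        ≤ ∫ ω, ‖(Xs s - X) ω‖ * ‖z‖ ∂P := by
          refine norm_integral_le_of_norm_le (hD.mul_const _) ?_
          filter_upwards [Lp.coeFn_sub (Xs s) X] with ω h
          rw [h, Pi.sub_apply]
          refine (norm_exp_mul_I_sub_le _ _).trans ?_
          rw [← inner_sub_left]
          exact abs_real_inner_le_norm _ _
      _ = (∫ ω, ‖(Xs s - X) ω‖ ∂P) * ‖z‖ := integral_mul_const _ _
      _ ≤ ‖Xs s - X‖ * ‖z‖ := by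
          gcongr
          rw [Lp.norm_def, integral_norm_eq_lintegral_enorm (Lp.aestronglyMeasurable _)]
          refine ENNReal.toReal_mono (Lp.eLpNorm_ne_top _) ?_
          rw [← eLpNorm_one_eq_lintegral_enorm]
          exact eLpNorm_le_eLpNorm_of_exponent_le one_le_two (Lp.aestronglyMeasurable _)
  have hval : ∀ s, ∫ ω, Complex.exp ((⟪Xs s ω, z⟫ : ℝ) * Complex.I) ∂P =
      Complex.exp (-((∑ i ∈ s, ⟪r i, z⟫ ^ 2 : ℝ) : ℂ) / 2) := fun s => by
    rw [← integral_exp_sum_whiteNoise]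
    refine integral_congr_ae ?_
    filter_upwards [hXs_ae s] with ω h
    rw [h]
  have hlim2 : Tendsto (fun s : Finset (basisSet H) =>
      Complex.exp (-((∑ i ∈ s, ⟪r i, z⟫ ^ 2 : ℝ) : ℂ) / 2)) atTop
      (𝓝 (Complex.exp (-((⟪C z, z⟫ : ℝ) : ℂ) / 2))) := by
    -- Parseval for `R z`: the variances of the partial sums exhaust `‖R z‖ ^ 2`.
    have h1 : HasSum (fun i => ⟪r i, z⟫ ^ 2) ⟪C z, z⟫ := by
      rw [← inner_posSqrt_posSqrt hC]
      refine (b.hasSum_inner_mul_inner (R z) (R z)).congr_fun fun i => ?_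
      rw [hr, pow_two]
      simp only
      rw [hR, inner_posSqrt_left hC, real_inner_comm]
    have hc : Continuous fun x : ℝ => Complex.exp (-(x : ℂ) / 2) := by fun_prop
    exact (hc.tendsto _).comp h1
  simp_rw [hval] at hlim1
  rw [tendsto_nhds_unique hlim1 hlim2]
  congr 1
  simp [neg_div]

theorem IsGaussianMeasure.unique {m : H} {C : H → H} {ν ν' : Measure H}
    (h : IsGaussianMeasure m C ν) (h' : IsGaussianMeasure m C ν') : ν = ν' := by
  have := h.1
  have := h'.1
  exact Measure.ext_of_charFun (funext fun z => by rw [h.2, h'.2])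

theorem IsGaussianMeasure.map_add {C : H → H} {ν : Measure H} (h : IsGaussianMeasure 0 C ν) (m : H) :
    IsGaussianMeasure m C (ν.map (m + ·)) := by
  have := h.1
  refine ⟨Measure.isProbabilityMeasure_map (by fun_prop), fun z => ?_⟩
  rw [charFun_map_const_add, h.2, ← Complex.exp_add]
  congr 1
  simp
  ring

theorem IsGaussianMeasure.map {C : H →L[ℝ] H} {ν : Measure H} (h : IsGaussianMeasure 0 C ν)
    (A : H →L[ℝ] H) :
    IsGaussianMeasure 0 (A ∘L C ∘L ContinuousLinearMap.adjoint A) (ν.map A) := by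
  have := h.1
  refine ⟨Measure.isProbabilityMeasure_map (by fun_prop), fun z => ?_⟩
  have e : charFun (ν.map A) z = charFun ν (ContinuousLinearMap.adjoint A z) := by
    rw [charFun_apply, charFun_apply, integral_map (by fun_prop) (by fun_prop)]
    simp_rw [ContinuousLinearMap.adjoint_inner_right]
  rw [e, h.2]
  simp [← ContinuousLinearMap.adjoint_inner_right]

theorem isGaussianMeasure_gaussianMeasure_zero {C : H →L[ℝ] H} (hC : C.IsPositive)
    (htr : trace C < ∞) : IsGaussianMeasure 0 C (gaussianMeasure 0 C) := by
  have h := exists_isGaussianMeasure_zero hC htr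
  rw [gaussianMeasure, dif_pos h]
  exact h.choose_spec

theorem gaussianMeasure_eq_map_add {C : H →L[ℝ] H} (hC : C.IsPositive)
    (htr : trace C < ∞) (m : H) :
    gaussianMeasure m C = (gaussianMeasure 0 C).map (m + ·) := by
  have h1 := (isGaussianMeasure_gaussianMeasure_zero hC htr).map_add m
  have h : ∃ ν, IsGaussianMeasure m C ν := ⟨_, h1⟩
  rw [gaussianMeasure, dif_pos h]
  exact h.choose_spec.unique h1

/-- The passage to `IsGaussian`, which provides the moments and the rotation invariance used later.
-/
theorem IsGaussianMeasure.isGaussian_and_covarianceBilin {C : H →L[ℝ] H} (hC : C.IsPositive)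
    {ν : Measure H} (h : IsGaussianMeasure 0 C ν) :
    IsGaussian ν ∧ ∫ x, x ∂ν = 0 ∧ ∀ x y, covarianceBilin ν x y = ⟪C x, y⟫ := by
  have := h.1
  set f : H →L[ℝ] H →L[ℝ] ℝ := (innerSL ℝ) ∘L C with hf
  have hfa : ∀ x y, f x y = ⟪C x, y⟫ := fun x y => rfl
  have hpos : f.toBilinForm.IsPosSemidef :=
    ⟨⟨fun x y => by
      simp [hfa]; rw [hC.inner_left_eq_inner_right, real_inner_comm]⟩,
      ⟨fun x => by simpa [hfa] using hC.inner_nonneg_left x⟩⟩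
  have hch : ∀ t, charFun ν t = Complex.exp ((⟪t, (0 : H)⟫ : ℝ) * Complex.I - (f t t : ℝ) / 2) := by
    intro t; rw [h.2, hfa]; simp
  have hg : IsGaussian ν := isGaussian_iff_gaussian_charFun.2 ⟨0, f, hpos, hch⟩
  have := gaussian_charFun_congr 0 f hpos hch
  exact ⟨hg, this.1.symm, fun x y => by rw [← this.2, hfa]⟩

theorem IsGaussianMeasure.integral_inner_mul_inner {C : H →L[ℝ] H} (hC : C.IsPositive)
    {ν : Measure H} (h : IsGaussianMeasure 0 C ν) (x y : H) :
    ∫ z, ⟪x, z⟫ * ⟪y, z⟫ ∂ν = ⟪C x, y⟫ := by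
  obtain ⟨hg, hm, hc⟩ := h.isGaussian_and_covarianceBilin hC
  rw [← hc, covarianceBilin_apply IsGaussian.memLp_two_id]
  simp [hm]

end Hilbert

end OrnsteinUhlenbeck

namespace OrnsteinUhlenbeck

open ProbabilityTheory

/-! ### The joint law of (Z(0), Z(t)) and what symmetry says about it -/

section JointLaw

variable {H : Type*} [NormedAddCommGroup H] [InnerProductSpace ℝ H] [CompleteSpace H]

/-- `V` and `Vt t` are the bounded operators `Q_∞` and `Q_t`. -/
structure IsCovariance (S : ℝ → H →L[ℝ] H) (Q V : H →L[ℝ] H) (Vt : ℝ → H →L[ℝ] H) : Prop where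
  isPositive : V.IsPositive
  trace_lt_top : trace V < ∞
  coe_eq : covOpInf S Q = V
  inner_eq : ∀ x y, ⟪V x, y⟫ = ∫ s in Ioi 0, ⟪covKernel S Q s x, y⟫
  isPositive_t : ∀ t, (Vt t).IsPositive
  trace_t_lt_top : ∀ t, trace (Vt t) < ∞
  coe_t_eq : ∀ t, covOp S Q t = Vt t
  inner_t_eq : ∀ t x y, ⟪Vt t x, y⟫ = ∫ s in Ioc 0 t, ⟪covKernel S Q s x, y⟫
  add_eq : ∀ t, 0 ≤ t → ∀ x, Vt t x + S t (V (ContinuousLinearMap.adjoint (S t) x)) = V x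

theorem exists_isCovariance {S : ℝ → H →L[ℝ] H} {Q : H →L[ℝ] H} (hS : IsC0Semigroup S)
    (hQ : Q.IsPositive) (htr : ∫⁻ s in Ioi (0 : ℝ), trace (covKernel S Q s) < ∞) :
    ∃ V Vt, IsCovariance S Q V Vt := by
  obtain ⟨V, h1, h2, h3, h4⟩ := exists_integral_covKernel hS hQ htr subset_rfl
  choose Vt g1 g2 g3 g4 using fun t : ℝ =>
    exists_integral_covKernel hS hQ htr (Ioc_subset_Ioi_self : Ioc 0 t ⊆ Ioi 0)
  refine ⟨V, Vt, h1, h2, funext fun x => (h3 x).symm, h4, g1, g2,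
    fun t => funext fun x => (g3 t x).symm, g4, fun t ht x => ?_⟩
  refine ext_inner_right ℝ fun y => ?_
  rw [inner_add_left, ← ContinuousLinearMap.adjoint_inner_right (S t), g4, h4, h4,
    ← integral_covKernel_add hS hQ htr ht]

variable [MeasurableSpace H] [BorelSpace H] [SecondCountableTopology H]

/-- The joint law of `(Z(0), Z(t))`, where `Z` solves the equation and `Z(0)` has law `μ`. -/
noncomputable def jointLaw (S : ℝ → H →L[ℝ] H) (Q : H →L[ℝ] H) (t : ℝ) : Measure (H × H) :=
  ((invMeasure S Q).prod (gaussianMeasure 0 (covOp S Q t))).map fun p => (p.1, S t p.1 + p.2)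

variable {S : ℝ → H →L[ℝ] H} {Q V : H →L[ℝ] H} {Vt : ℝ → H →L[ℝ] H}

namespace IsCovariance

theorem isGaussianMeasure_inf (hV : IsCovariance S Q V Vt) :
    IsGaussianMeasure 0 V (invMeasure S Q) := by
  rw [invMeasure, hV.coe_eq]
  exact isGaussianMeasure_gaussianMeasure_zero hV.isPositive hV.trace_lt_top

theorem isProbabilityMeasure_inf (hV : IsCovariance S Q V Vt) :
    IsProbabilityMeasure (invMeasure S Q) := hV.isGaussianMeasure_inf.1

theorem isGaussianMeasure_t (hV : IsCovariance S Q V Vt) (t : ℝ) :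
    IsGaussianMeasure 0 (Vt t) (gaussianMeasure 0 (covOp S Q t)) := by
  rw [hV.coe_t_eq]
  exact isGaussianMeasure_gaussianMeasure_zero (hV.isPositive_t t) (hV.trace_t_lt_top t)

theorem isProbabilityMeasure_t (hV : IsCovariance S Q V Vt) (t : ℝ) :
    IsProbabilityMeasure (gaussianMeasure 0 (covOp S Q t)) := (hV.isGaussianMeasure_t t).1

theorem transition_eq (hV : IsCovariance S Q V Vt) (t : ℝ) {φ : H → ℝ} (hφ : Measurable φ) (x : H) :
    transition S Q t φ x = ∫ y, φ (S t x + y) ∂(gaussianMeasure 0 (covOp S Q t)) := by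
  rw [transition, hV.coe_t_eq, gaussianMeasure_eq_map_add (hV.isPositive_t t) (hV.trace_t_lt_top t),
    integral_map (by fun_prop) hφ.aestronglyMeasurable]

theorem measurable_jointMap (S : ℝ → H →L[ℝ] H) (t : ℝ) :
    Measurable fun p : H × H => (p.1, S t p.1 + p.2) := by fun_prop

theorem isProbabilityMeasure_jointLaw (hV : IsCovariance S Q V Vt) (t : ℝ) :
    IsProbabilityMeasure (jointLaw S Q t) := by
  have := hV.isProbabilityMeasure_inf
  have := hV.isProbabilityMeasure_t t
  exact Measure.isProbabilityMeasure_map (measurable_jointMap S t).aemeasurable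

theorem map_fst_jointLaw (hV : IsCovariance S Q V Vt) (t : ℝ) :
    (jointLaw S Q t).map Prod.fst = invMeasure S Q := by
  have := hV.isProbabilityMeasure_inf
  have := hV.isProbabilityMeasure_t t
  rw [jointLaw, Measure.map_map measurable_fst (measurable_jointMap S t)]
  exact Measure.fst_prod

theorem measurable_transition (hV : IsCovariance S Q V Vt) (t : ℝ) {φ : H → ℝ}
    (hφ : Measurable φ) : Measurable (transition S Q t φ) := by
  have := hV.isProbabilityMeasure_t t
  have e : transition S Q t φ =
      fun x => ∫ y, φ (S t x + y) ∂(gaussianMeasure 0 (covOp S Q t)) :=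
    funext (hV.transition_eq t hφ)
  rw [e]
  have hm : Measurable fun p : H × H => φ (S t p.1 + p.2) := hφ.comp (by fun_prop)
  exact (hm.stronglyMeasurable.integral_prod_right').measurable

theorem isBoundedBorel_transition (hV : IsCovariance S Q V Vt) (t : ℝ) {φ : H → ℝ}
    (hφ : IsBoundedBorel φ) : IsBoundedBorel (transition S Q t φ) := by
  have := hV.isProbabilityMeasure_t t
  obtain ⟨hm, M, hM⟩ := hφ
  refine ⟨hV.measurable_transition t hm, M, fun x => ?_⟩
  rw [hV.transition_eq t hm, ← Real.norm_eq_abs]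
  simpa using norm_integral_le_of_norm_le_const (μ := gaussianMeasure 0 (covOp S Q t))
    (f := fun y => φ (S t x + y)) (C := M) (Eventually.of_forall fun y => hM _)

theorem integral_jointLaw (hV : IsCovariance S Q V Vt) (t : ℝ) {φ ψ : H → ℝ}
    (hφ : IsBoundedBorel φ) (hψ : IsBoundedBorel ψ) :
    ∫ p, ψ p.1 * φ p.2 ∂(jointLaw S Q t) = ∫ x, ψ x * transition S Q t φ x ∂(invMeasure S Q) := by
  have := hV.isProbabilityMeasure_inf
  have := hV.isProbabilityMeasure_t t
  obtain ⟨hφm, M, hM⟩ := hφ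
  obtain ⟨hψm, N, hN⟩ := hψ
  have hm : Measurable fun p : H × H => ψ p.1 * φ p.2 :=
    (hψm.comp measurable_fst).mul (hφm.comp measurable_snd)
  rw [jointLaw, integral_map (measurable_jointMap S t).aemeasurable hm.aestronglyMeasurable,
    integral_prod]
  · refine integral_congr_ae (Eventually.of_forall fun x => ?_)
    simp only
    rw [integral_const_mul, hV.transition_eq t hφm]
  · refine Integrable.of_bound (C := N * M)
      (hm.comp (measurable_jointMap S t)).aestronglyMeasurable (Eventually.of_forall fun p => ?_)
    rw [norm_mul]
    exact mul_le_mul (hN _) (hM _) (norm_nonneg _) ((abs_nonneg _).trans (hN 0))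

/-- Symmetry tested on indicators is exchangeability on rectangles, and rectangles determine a
probability measure on the product. -/
theorem jointLaw_map_swap (hV : IsCovariance S Q V Vt) (hsymm : IsSymmetricOU S Q) {t : ℝ}
    (ht : 0 ≤ t) : (jointLaw S Q t).map Prod.swap = jointLaw S Q t := by
  have := hV.isProbabilityMeasure_jointLaw t
  have := Measure.isProbabilityMeasure_map (μ := jointLaw S Q t)
    (measurable_swap (α := H) (β := H)).aemeasurable
  refine Measure.ext_prod fun {A B} hA hB => ?_
  have hbb : ∀ {A : Set H}, MeasurableSet A → IsBoundedBorel (A.indicator fun _ => (1 : ℝ)) :=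
    fun {A} hA => ⟨measurable_const.indicator hA, 1, fun x => by
      by_cases hx : x ∈ A <;> simp [hx]⟩
  have hval : ∀ {A B : Set H}, MeasurableSet A → MeasurableSet B → (jointLaw S Q t).real (A ×ˢ B) =
      ∫ p, A.indicator (fun _ => (1 : ℝ)) p.1 * B.indicator (fun _ => (1 : ℝ)) p.2
        ∂(jointLaw S Q t) := by
    intro A B hA hB
    rw [← integral_indicator_one (hA.prod hB)]
    refine integral_congr_ae (Eventually.of_forall fun p => ?_)
    by_cases h1 : p.1 ∈ A <;> by_cases h2 : p.2 ∈ B <;> simp [indicator, h1, h2]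
  rw [Measure.map_apply measurable_swap (hA.prod hB), preimage_swap_prod]
  refine (measureReal_eq_measureReal_iff).1 ?_
  rw [hval hB hA, hval hA hB, hV.integral_jointLaw t (hbb hA) (hbb hB),
    hV.integral_jointLaw t (hbb hB) (hbb hA)]
  exact hsymm t ht _ _ (hbb hA) (hbb hB)

theorem map_snd_jointLaw (hV : IsCovariance S Q V Vt) (hsymm : IsSymmetricOU S Q) {t : ℝ}
    (ht : 0 ≤ t) : (jointLaw S Q t).map Prod.snd = invMeasure S Q := by
  rw [← hV.jointLaw_map_swap hsymm ht, Measure.map_map measurable_snd measurable_swap]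
  exact hV.map_fst_jointLaw t

/-- The integral factors over the initial value and the independent noise; `add_eq` merges the noise
covariance with the propagated one into `⟪V b, b⟫`. -/
theorem charFun_jointLaw (hV : IsCovariance S Q V Vt) {t : ℝ} (ht : 0 ≤ t) (a b : H) :
    ∫ p, Complex.exp ((⟪p.1, a⟫ + ⟪p.2, b⟫ : ℝ) * Complex.I) ∂(jointLaw S Q t) =
      Complex.exp (((-(⟪V a, a⟫ + 2 * ⟪S t (V a), b⟫ + ⟪V b, b⟫) / 2 : ℝ) : ℂ)) := by
  have := hV.isProbabilityMeasure_inf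
  have := hV.isProbabilityMeasure_t t
  rw [jointLaw, integral_map (measurable_jointMap S t).aemeasurable (by fun_prop)]
  have e : ∀ p : H × H, Complex.exp ((⟪p.1, a⟫ + ⟪S t p.1 + p.2, b⟫ : ℝ) * Complex.I) =
      Complex.exp ((⟪p.1, a + ContinuousLinearMap.adjoint (S t) b⟫ : ℝ) * Complex.I) *
        Complex.exp ((⟪p.2, b⟫ : ℝ) * Complex.I) := fun p => by
    rw [← Complex.exp_add]
    congr 1
    rw [inner_add_left, inner_add_right, ContinuousLinearMap.adjoint_inner_right]
    push_cast; ring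
  simp only [e]
  rw [integral_prod_mul (μ := invMeasure S Q) (ν := gaussianMeasure 0 (covOp S Q t))
    (fun x => Complex.exp ((⟪x, a + ContinuousLinearMap.adjoint (S t) b⟫ : ℝ) * Complex.I))
    (fun y => Complex.exp ((⟪y, b⟫ : ℝ) * Complex.I)), ← charFun_apply, ← charFun_apply,
    hV.isGaussianMeasure_inf.2, (hV.isGaussianMeasure_t t).2, ← Complex.exp_add]
  congr 1
  have h1 : ⟪V (a + ContinuousLinearMap.adjoint (S t) b),
      a + ContinuousLinearMap.adjoint (S t) b⟫ + ⟪Vt t b, b⟫ =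
      ⟪V a, a⟫ + 2 * ⟪S t (V a), b⟫ + ⟪V b, b⟫ := by
    have h2 : ⟪V (ContinuousLinearMap.adjoint (S t) b), a⟫ =
        ⟪V a, ContinuousLinearMap.adjoint (S t) b⟫ := by
      rw [hV.isPositive.inner_left_eq_inner_right, real_inner_comm]
    rw [← hV.add_eq t ht b, inner_add_left (Vt t b), ← ContinuousLinearMap.adjoint_inner_right (S t),
      ← ContinuousLinearMap.adjoint_inner_right (S t)]
    simp only [map_add, inner_add_left, inner_add_right]
    rw [h2]; ring
  rw [← h1]
  push_cast
  simp
  ring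

/-- Exchangeability swaps `a` and `b` in the characteristic function. The exponents are real, so
they agree, and only the cross term can change: `⟪S t (V a), b⟫` is symmetric in `a` and `b`. -/
theorem comp_eq_comp_adjoint (hV : IsCovariance S Q V Vt) (hsymm : IsSymmetricOU S Q) {t : ℝ}
    (ht : 0 ≤ t) : S t ∘L V = V ∘L ContinuousLinearMap.adjoint (S t) := by
  have key : ∀ a b, ⟪S t (V a), b⟫ = ⟪S t (V b), a⟫ := fun a b => by
    have h := hV.charFun_jointLaw ht a b
    rw [← hV.jointLaw_map_swap hsymm ht, integral_map measurable_swap.aemeasurable (by fun_prop)]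
      at h
    have e : ∀ p : H × H, (⟪p.swap.1, a⟫ + ⟪p.swap.2, b⟫ : ℝ) = ⟪p.1, b⟫ + ⟪p.2, a⟫ := fun p => by
      rw [add_comm]; rfl
    simp only [e] at h
    rw [hV.charFun_jointLaw ht b a, ← Complex.ofReal_exp, ← Complex.ofReal_exp,
      Complex.ofReal_inj, Real.exp_eq_exp] at h
    linarith
  refine ContinuousLinearMap.ext fun a => ext_inner_right ℝ fun b => ?_
  change ⟪S t (V a), b⟫ = ⟪V (ContinuousLinearMap.adjoint (S t) a), b⟫
  rw [key, hV.isPositive.inner_left_eq_inner_right, ContinuousLinearMap.adjoint_inner_left,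
    real_inner_comm]

end IsCovariance

end JointLaw

end OrnsteinUhlenbeck

namespace OrnsteinUhlenbeck

/-! ### Commutation with the covariances and unitary equivalence of the two symmetrizations -/

section Symmetric

variable {H : Type*} [NormedAddCommGroup H] [InnerProductSpace ℝ H] [CompleteSpace H]
  {S : ℝ → H →L[ℝ] H} {Q V : H →L[ℝ] H} {Vt : ℝ → H →L[ℝ] H}

/-- `S(t) P = P S*(t)` for all `t ≥ 0`. -/
def Symmetrizes (S : ℝ → H →L[ℝ] H) (P : H →L[ℝ] H) : Prop :=
  ∀ t, 0 ≤ t → S t ∘L P = P ∘L ContinuousLinearMap.adjoint (S t)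

theorem Symmetrizes.apply {P : H →L[ℝ] H} (h : Symmetrizes S P) {t : ℝ} (ht : 0 ≤ t) (x : H) :
    S t (P x) = P (ContinuousLinearMap.adjoint (S t) x) :=
  congrArg (fun A : H →L[ℝ] H => A x) (h t ht)

theorem IsC0Semigroup.apply_comm (hS : IsC0Semigroup S) {s t : ℝ} (hs : 0 ≤ s) (ht : 0 ≤ t) (x : H) :
    S s (S t x) = S t (S s x) := by
  rw [← hS.map_add_apply hs ht, ← hS.map_add_apply ht hs, add_comm]

namespace IsCovariance

/-- Q_r = V - S(r)VS*(r), and S(t) commutes with S(r). -/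
theorem symmetrizes_t (hV : IsCovariance S Q V Vt) (hS : IsC0Semigroup S) (h : Symmetrizes S V)
    {r : ℝ} (hr : 0 ≤ r) : Symmetrizes S (Vt r) := by
  intro t ht
  refine ContinuousLinearMap.ext fun x => ?_
  change S t (Vt r x) = Vt r (ContinuousLinearMap.adjoint (S t) x)
  have h1 := fun x => eq_sub_of_add_eq (hV.add_eq r hr x)
  rw [h1, h1, map_sub, ← h.apply ht x, hS.adjoint.apply_comm hr ht, ← h.apply ht,
    hS.apply_comm ht hr]

/-- Q is the integrand of Q_r at time zero. The identity for all small r, being an integrated one,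
localises at s = 0. -/
theorem symmetrizes_Q (hV : IsCovariance S Q V Vt) (hS : IsC0Semigroup S) (h : Symmetrizes S V) :
    Symmetrizes S Q := by
  intro t ht
  have hcK : ∀ x y, ContinuousOn (fun s => ⟪covKernel S Q s x, y⟫) (Ici 0) := fun x y =>
    ContinuousOn.inner (𝕜 := ℝ) (continuousOn_covKernel hS Q x) continuousOn_const
  have hiK : ∀ x y r, 0 ≤ r → IntervalIntegrable (fun s => ⟪covKernel S Q s x, y⟫) volume 0 r :=
    fun x y r hr => ((hcK x y).mono fun s hs => by
      rw [uIcc_of_le hr] at hs; exact hs.1).intervalIntegrable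
  have hK0 : covKernel S Q 0 = Q := by
    rw [covKernel, hS.map_zero]
    ext x
    simp [ContinuousLinearMap.adjoint_id]
  refine ContinuousLinearMap.ext fun x => ext_inner_right ℝ fun y => ?_
  have h0 := eq_zero_of_intervalIntegral_eq_zero (f := fun s =>
      ⟪covKernel S Q s x, ContinuousLinearMap.adjoint (S t) y⟫ -
        ⟪covKernel S Q s (ContinuousLinearMap.adjoint (S t) x), y⟫)
    ((hcK _ _).sub (hcK _ _)) fun r hr _ => by
      rw [intervalIntegral.integral_sub (hiK _ _ r hr.le) (hiK _ _ r hr.le),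
        intervalIntegral.integral_of_le hr.le, intervalIntegral.integral_of_le hr.le,
        ← hV.inner_t_eq, ← hV.inner_t_eq, ContinuousLinearMap.adjoint_inner_right,
        (hV.symmetrizes_t hS h hr.le).apply ht, sub_self]
  simp only [hK0] at h0
  rw [ContinuousLinearMap.adjoint_inner_right] at h0
  exact sub_eq_zero.1 h0

theorem injective_of_injective (hV : IsCovariance S Q V Vt)
    (hinj : Function.Injective (covOpInf S Q)) : Function.Injective V := by
  rwa [← hV.coe_eq]

theorem covKernel_eq (hS : IsC0Semigroup S) (h : Symmetrizes S Q) {s : ℝ} (hs : 0 ≤ s) (x : H) :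
    covKernel S Q s x = S (2 * s) (Q x) := by
  rw [two_mul, hS.map_add_apply hs hs, h.apply hs]; rfl

theorem injective_Q (hV : IsCovariance S Q V Vt) (hS : IsC0Semigroup S) (h : Symmetrizes S Q)
    (hinj : Function.Injective V) : Function.Injective Q := by
  rw [injective_iff_map_eq_zero] at hinj ⊢
  refine fun x hx => hinj x (ext_inner_right ℝ fun y => ?_)
  rw [hV.inner_eq, inner_zero_left]
  refine setIntegral_eq_zero_of_forall_eq_zero fun s hs => ?_
  rw [covKernel_eq hS h (le_of_lt hs), hx, map_zero, inner_zero_left]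

/-- An integrated form of the Lyapunov equation 2AQ_∞ = -Q. The kernel is S(2s)Q, so integrating it
over [0, R/2] and rescaling produces both the factor 2 and the endpoint R. -/
theorem integral_apply_Q (hV : IsCovariance S Q V Vt) (hS : IsC0Semigroup S) (h : Symmetrizes S V)
    (x y : H) {R : ℝ} (hR : 0 ≤ R) :
    ∫ s in (0 : ℝ)..R, ⟪S s (Q x), y⟫ = 2 * ⟪V x - S R (V x), y⟫ := by
  have hR2 : (0 : ℝ) ≤ R / 2 := by positivity
  have hQ := hV.symmetrizes_Q hS h
  have h1 := hV.inner_t_eq (R / 2) x y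
  have h2 : ∫ s in Ioc 0 (R / 2), ⟪covKernel S Q s x, y⟫ =
      ∫ s in (0 : ℝ)..(R / 2), ⟪S (2 * s) (Q x), y⟫ := by
    rw [intervalIntegral.integral_of_le hR2]
    refine setIntegral_congr_fun measurableSet_Ioc fun s hs => ?_
    rw [covKernel_eq hS hQ hs.1.le]
  have h3 := intervalIntegral.mul_integral_comp_mul_left (a := 0) (b := R / 2) (c := 2)
    (f := fun s => ⟪S s (Q x), y⟫)
  rw [mul_zero, mul_div_cancel₀ _ (two_ne_zero' ℝ)] at h3
  rw [← h3, ← h2, ← h1, eq_sub_of_add_eq (hV.add_eq (R / 2) hR2 x), ← h.apply hR2,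
    ← hS.map_add_apply hR2 hR2, add_halves]

theorem inner_covKernel_integrableOn (hS : IsC0Semigroup S) (hQ : Q.IsPositive)
    (htr : ∫⁻ s in Ioi (0 : ℝ), trace (covKernel S Q s) < ∞) (x y : H) :
    IntegrableOn (fun s => ⟪covKernel S Q s x, y⟫) (Ioi 0) :=
  (integrableOn_covKernel hS hQ htr x).inner_const (𝕜 := ℝ) y

/-- `⟪Q_∞ S*(t) x, S*(t) x⟫ → 0` as `t → ∞`. -/
theorem tendsto_inner_atTop (hV : IsCovariance S Q V Vt) (hS : IsC0Semigroup S) (hQ : Q.IsPositive)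
    (htr : ∫⁻ s in Ioi (0 : ℝ), trace (covKernel S Q s) < ∞) (x : H) :
    Tendsto (fun t => ⟪V (ContinuousLinearMap.adjoint (S t) x), ContinuousLinearMap.adjoint (S t) x⟫)
      atTop (𝓝 0) := by
  have h1 := intervalIntegral_tendsto_integral_Ioi 0 (inner_covKernel_integrableOn hS hQ htr x x)
    tendsto_id
  rw [← hV.inner_eq] at h1
  have h2 := h1.const_sub ⟪V x, x⟫
  rw [sub_self] at h2
  refine h2.congr' ?_
  filter_upwards [eventually_ge_atTop 0] with t ht
  rw [id, intervalIntegral.integral_of_le ht, ← hV.inner_t_eq, ← inner_sub_left,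
    sub_eq_of_eq_add' (hV.add_eq t ht x).symm, ContinuousLinearMap.adjoint_inner_right]

/-- The difference is the quadratic form of Q_t. This is what makes the symmetrization through Q_∞ a
contraction. -/
theorem inner_adjoint_le (hV : IsCovariance S Q V Vt) {t : ℝ} (ht : 0 ≤ t) (x : H) :
    ⟪V (ContinuousLinearMap.adjoint (S t) x), ContinuousLinearMap.adjoint (S t) x⟫ ≤ ⟪V x, x⟫ := by
  rw [ContinuousLinearMap.adjoint_inner_right, ← hV.add_eq t ht x, inner_add_left]
  linarith [(hV.isPositive_t t).inner_nonneg_left x]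

theorem inner_t_le (hV : IsCovariance S Q V Vt) {t : ℝ} (ht : 0 ≤ t) (x : H) :
    ⟪Vt t x, x⟫ ≤ ⟪V x, x⟫ := by
  rw [← hV.add_eq t ht x, inner_add_left, ← ContinuousLinearMap.adjoint_inner_right (S t)]
  linarith [hV.isPositive.inner_nonneg_left (ContinuousLinearMap.adjoint (S t) x)]

end IsCovariance

/-- `T` is the selfadjoint semigroup `P^{-1/2} S(t) P^{1/2}`. -/
structure IsSymmetrization (S : ℝ → H →L[ℝ] H) (P : H →L[ℝ] H) (T : ℝ → H →L[ℝ] H) : Prop where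
  isC0Semigroup : IsC0Semigroup T
  isSelfAdjoint : ∀ t, 0 ≤ t → IsSelfAdjoint (T t)
  apply_sqrt : ∀ t, 0 ≤ t → ∀ x, T t (posSqrt P x) = posSqrt P (ContinuousLinearMap.adjoint (S t) x)
  sqrt_comp : ∀ t, 0 ≤ t → posSqrt P ∘L T t = S t ∘L posSqrt P

theorem isSymmetrization_SQ (hS : IsC0Semigroup S) (hQ : Q.IsPositive) (hinj : Function.Injective Q)
    (h : Symmetrizes S Q) : IsSymmetrization S Q (SQ S Q) := by
  obtain ⟨T, h1, h2, h3, h4⟩ := hS.exists_symmetrization hQ hinj h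
  have e : ∀ t, 0 ≤ t → SQ S Q t = T t := fun t ht => by
    have hex : ∃ T : H →L[ℝ] H, posSqrt Q ∘L T = S t ∘L posSqrt Q := ⟨T t, h4 t ht⟩
    have hsp : posSqrt Q ∘L SQ S Q t = S t ∘L posSqrt Q := by
      rw [SQ, dif_pos hex]; exact hex.choose_spec
    refine ContinuousLinearMap.ext fun x => injective_posSqrt hQ hinj ?_
    exact congrArg (fun A : H →L[ℝ] H => A x) (hsp.trans (h4 t ht).symm)
  refine ⟨h1.congr e, fun t ht => ?_, fun t ht => ?_, fun t ht => ?_⟩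
  · rw [e t ht]; exact h2 t ht
  · rw [e t ht]; exact h3 t ht
  · rw [e t ht]; exact h4 t ht

namespace IsSymmetrization

theorem inner_apply {P : H →L[ℝ] H} {T : ℝ → H →L[ℝ] H} (hT : IsSymmetrization S P T) {t : ℝ}
    (ht : 0 ≤ t) (x y : H) : ⟪T t x, y⟫ = ⟪x, T t y⟫ := by
  rw [← ContinuousLinearMap.adjoint_inner_right, (hT.isSelfAdjoint t ht).adjoint_eq]

theorem sqrt_apply {P : H →L[ℝ] H} {T : ℝ → H →L[ℝ] H} (hT : IsSymmetrization S P T) {t : ℝ}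
    (ht : 0 ≤ t) (x : H) : posSqrt P (T t x) = S t (posSqrt P x) :=
  congrArg (fun A : H →L[ℝ] H => A x) (hT.sqrt_comp t ht)

theorem inner_apply_sqrt {P : H →L[ℝ] H} {T : ℝ → H →L[ℝ] H} (hT : IsSymmetrization S P T)
    (hP : P.IsPositive) {t : ℝ} (ht : 0 ≤ t) (x y : H) :
    ⟪T t (posSqrt P x), posSqrt P y⟫ = ⟪S t (P x), y⟫ := by
  rw [← inner_posSqrt_left hP, hT.sqrt_apply ht, posSqrt_apply_apply hP]

theorem norm_apply_sqrt_sq {P : H →L[ℝ] H} {T : ℝ → H →L[ℝ] H} (hT : IsSymmetrization S P T)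
    (hP : P.IsPositive) {t : ℝ} (ht : 0 ≤ t) (x : H) :
    ‖T t (posSqrt P x)‖ ^ 2 = ⟪covKernel S P t x, x⟫ := by
  rw [hT.apply_sqrt t ht, norm_posSqrt_sq hP, inner_covKernel]

variable {T₀ : ℝ → H →L[ℝ] H}

theorem norm_le_one (hT : IsSymmetrization S V T₀) (hV : IsCovariance S Q V Vt)
    (hinj : Function.Injective V) {t : ℝ} (ht : 0 ≤ t) : ‖T₀ t‖ ≤ 1 := by
  refine ContinuousLinearMap.opNorm_le_bound _ zero_le_one fun x => ?_
  refine (denseRange_posSqrt hV.isPositive hinj).induction_on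
    (p := fun x => ‖T₀ t x‖ ≤ 1 * ‖x‖) x (isClosed_le (by fun_prop) (by fun_prop)) fun y => ?_
  rw [one_mul, hT.apply_sqrt t ht]
  refine le_of_sq_le_sq ?_ (norm_nonneg _)
  rw [norm_posSqrt_sq hV.isPositive, norm_posSqrt_sq hV.isPositive]
  exact hV.inner_adjoint_le ht y

theorem tendsto_atTop (hT : IsSymmetrization S V T₀) (hV : IsCovariance S Q V Vt)
    (hS : IsC0Semigroup S) (hQ : Q.IsPositive)
    (htr : ∫⁻ s in Ioi (0 : ℝ), trace (covKernel S Q s) < ∞)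
    (hinj : Function.Injective V) (x : H) : Tendsto (fun t => T₀ t x) atTop (𝓝 0) := by
  refine tendsto_apply_of_dense (R := 0) (M := 1) ?_ (denseRange_posSqrt hV.isPositive hinj) ?_ x
  · filter_upwards [eventually_ge_atTop 0] with t ht using hT.norm_le_one hV hinj ht
  · rintro _ ⟨y, rfl⟩
    change Tendsto _ _ (𝓝 0)
    rw [tendsto_zero_iff_norm_tendsto_zero]
    have h := (hV.tendsto_inner_atTop hS hQ htr y).sqrt
    rw [Real.sqrt_zero] at h
    refine h.congr' ?_
    filter_upwards [eventually_ge_atTop 0] with t ht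
    rw [← norm_posSqrt_sq hV.isPositive, Real.sqrt_sq (norm_nonneg _), hT.apply_sqrt t ht]

/-- The semigroups `Q^{-1/2} S(t) Q^{1/2}` and `Q_∞^{-1/2} S(t) Q_∞^{1/2}` are unitarily
equivalent. -/
theorem exists_unitary (hV : IsCovariance S Q V Vt) (hS : IsC0Semigroup S) (hQ : Q.IsPositive)
    (htr : ∫⁻ s in Ioi (0 : ℝ), trace (covKernel S Q s) < ∞) (h : Symmetrizes S V)
    (hinj : Function.Injective V) {T₁ : ℝ → H →L[ℝ] H} (hT₁ : IsSymmetrization S Q T₁)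
    (hT₀ : IsSymmetrization S V T₀) :
    ∃ U : H ≃ₗᵢ[ℝ] H, ∀ t, 0 ≤ t → ∀ x, T₁ t (U x) = U (T₀ t x) := by
  have hVp := hV.isPositive
  have hQs := hV.symmetrizes_Q hS h
  have hQi := hV.injective_Q hS hQs hinj
  have hdV := denseRange_posSqrt hVp hinj
  have hdQ := denseRange_posSqrt hQ hQi
  obtain ⟨M, hM0, hM⟩ := hT₁.isC0Semigroup.exists_norm_le 1
  -- For `s` in `(0, 1]`, `T₁ 1 = T₁ (1 - s) ∘ T₁ s`, so the squared norm is at most `M ^ 2 *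
  -- ⟪covKernel S Q s x, x⟫`. Averaging over `s` replaces the kernel by Q_1, which is dominated by
  -- `V`. Hence `T₁ 1 ∘L posSqrt Q` factors through `posSqrt V`, and the factor is `G`.
  have hbound : ∀ x, ‖(T₁ 1 ∘L posSqrt Q) x‖ ≤ M * ‖posSqrt V x‖ := fun x => by
    refine le_of_sq_le_sq ?_ (by positivity)
    rw [mul_pow, norm_posSqrt_sq hVp]
    have h1 : ∀ s ∈ Ioc (0 : ℝ) 1, ‖T₁ 1 (posSqrt Q x)‖ ^ 2 ≤ M ^ 2 * ⟪covKernel S Q s x, x⟫ := by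
      intro s hs
      have e : T₁ 1 (posSqrt Q x) = T₁ (1 - s) (T₁ s (posSqrt Q x)) := by
        rw [← hT₁.isC0Semigroup.map_add_apply (by linarith [hs.2]) hs.1.le, sub_add_cancel]
      rw [e, ← hT₁.norm_apply_sqrt_sq hQ hs.1.le, ← mul_pow]
      gcongr
      exact ((T₁ (1 - s)).le_opNorm _).trans (by
        gcongr; exact hM _ (by linarith [hs.2]) (by linarith [hs.1]))
    have h2 := setIntegral_mono_on (μ := volume) (f := fun _ => ‖T₁ 1 (posSqrt Q x)‖ ^ 2)
      (g := fun s => M ^ 2 * ⟪covKernel S Q s x, x⟫) (s := Ioc (0 : ℝ) 1) (by simp)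
      (((IsCovariance.inner_covKernel_integrableOn hS hQ htr x x).mono_set
        Ioc_subset_Ioi_self).const_mul _) measurableSet_Ioc h1
    rw [integral_const_mul, ← hV.inner_t_eq] at h2
    simp only [integral_const, MeasurableSet.univ, measureReal_restrict_apply, univ_inter,
      Real.volume_real_Ioc, sub_zero, zero_le_one, sup_of_le_left, one_smul] at h2
    refine h2.trans ?_
    gcongr
    exact hV.inner_t_le zero_le_one x
  obtain ⟨G, hG, -⟩ := exists_comp_eq_of_norm_le hM0 hdV hbound
  have hGV : ∀ x, G (posSqrt V x) = T₁ 1 (posSqrt Q x) := hG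
  have hcomm : ∀ t : {t : ℝ // 0 ≤ t}, T₁ t ∘L G = G ∘L T₀ t := fun ⟨t, ht⟩ => by
    refine ContinuousLinearMap.ext fun x => ?_
    refine hdV.induction_on (p := fun x => T₁ t (G x) = G (T₀ t x)) x
      (isClosed_eq (by fun_prop) (by fun_prop)) fun y => ?_
    rw [hGV, hT₀.apply_sqrt t ht, hGV, ← hT₁.apply_sqrt t ht,
      hT₁.isC0Semigroup.apply_comm ht zero_le_one]
  have hdG : DenseRange G := by
    have hd1 : DenseRange (T₁ 1) := denseRange_of_injective_of_isSelfAdjoint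
      (hT₁.isSelfAdjoint 1 zero_le_one)
      (hT₁.isC0Semigroup.injective_of_isSelfAdjoint hT₁.isSelfAdjoint zero_le_one)
    have hd2 : DenseRange (T₁ 1 ∘ posSqrt Q) := hd1.comp hdQ (T₁ 1).continuous
    refine hd2.mono ?_
    rintro _ ⟨x, rfl⟩
    exact ⟨posSqrt V x, hGV x⟩
  have hGi : Function.Injective G := by
    rw [injective_iff_map_eq_zero]
    intro z hz
    -- If `G z = 0`, then `z` is orthogonal to the range of `G*`, hence to the differences on the
    -- right. Letting `R → ∞` removes `T₀ (1 + R)` and leaves `z` orthogonal to the dense range of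
    -- `T₀ 1 ∘ posSqrt V`.
    have hadj : ∀ (R : ℝ), 0 ≤ R → ∀ x, ContinuousLinearMap.adjoint G
        (∫ s in (0 : ℝ)..R, T₁ s (posSqrt Q x)) =
        (2 : ℝ) • (T₀ 1 (posSqrt V x) - T₀ (1 + R) (posSqrt V x)) := by
      intro R hR x
      have hR1 : (0 : ℝ) ≤ 1 + R := by positivity
      refine hdV.eq_of_inner_left (𝕜 := ℝ) ?_
      intro u
      have hint : IntervalIntegrable (fun s => T₁ s (posSqrt Q x)) volume 0 R :=
        hT₁.isC0Semigroup.intervalIntegrable _ le_rfl hR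
      have h1 := (innerSL ℝ (T₁ 1 (posSqrt Q u))).intervalIntegral_comp_comm hint
      have h2 : ∀ s ∈ uIcc 0 R, ⟪T₁ 1 (posSqrt Q u), T₁ s (posSqrt Q x)⟫ =
          ⟪S s (Q x), ContinuousLinearMap.adjoint (S 1) u⟫ := fun s hs => by
        rw [uIcc_of_le hR] at hs
        rw [real_inner_comm, ← hT₁.inner_apply zero_le_one,
          ← hT₁.isC0Semigroup.map_add_apply zero_le_one hs.1,
          hT₁.inner_apply_sqrt hQ (add_nonneg zero_le_one hs.1),
          hS.map_add_apply zero_le_one hs.1, ContinuousLinearMap.adjoint_inner_right]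
      rw [ContinuousLinearMap.adjoint_inner_left, hGV, real_inner_comm]
      refine h1.symm.trans ((intervalIntegral.integral_congr h2).trans ?_)
      rw [hV.integral_apply_Q hS h x _ hR, ContinuousLinearMap.adjoint_inner_right, map_sub,
        ← hS.map_add_apply zero_le_one hR, inner_sub_left, real_inner_smul_left, inner_sub_left,
        hT₀.inner_apply_sqrt hVp zero_le_one, hT₀.inner_apply_sqrt hVp hR1]
    have horth : ∀ x, ⟪z, T₀ 1 (posSqrt V x)⟫ = 0 := fun x => by
      have h1 : ∀ᶠ R : ℝ in atTop, ⟪z, T₀ (1 + R) (posSqrt V x)⟫ = ⟪z, T₀ 1 (posSqrt V x)⟫ := by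
        filter_upwards [eventually_ge_atTop 0] with R hR
        have h2 := congrArg (fun y => ⟪z, y⟫) (hadj R hR x)
        rw [ContinuousLinearMap.adjoint_inner_right, hz, inner_zero_left, real_inner_smul_right,
          inner_sub_right] at h2
        linarith
      have h2 : Tendsto (fun R : ℝ => ⟪z, T₀ (1 + R) (posSqrt V x)⟫) atTop (𝓝 0) := by
        have h3 := (hT₀.tendsto_atTop hV hS hQ htr hinj (posSqrt V x)).comp
          (tendsto_atTop_add_const_left atTop (1 : ℝ) tendsto_id)
        simpa using (tendsto_const_nhds (x := z)).inner (𝕜 := ℝ) h3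
      exact (tendsto_nhds_unique (h2.congr' h1) tendsto_const_nhds).symm
    have hz1 : T₀ 1 z = 0 := by
      refine hdV.eq_zero_of_inner_left (𝕜 := ℝ) ?_
      intro u
      rw [hT₀.inner_apply zero_le_one]
      exact horth u
    exact (injective_iff_map_eq_zero _).1
      (hT₀.isC0Semigroup.injective_of_isSelfAdjoint hT₀.isSelfAdjoint zero_le_one) z hz1
  obtain ⟨U, hU⟩ := exists_unitary_intertwine (ι := {t : ℝ // 0 ≤ t}) (A := fun t => T₁ t)
    (B := fun t => T₀ t) (fun t => hT₁.isSelfAdjoint t t.2) (fun t => hT₀.isSelfAdjoint t t.2)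
    hGi hdG hcomm
  exact ⟨U, fun t ht => hU ⟨t, ht⟩⟩

end IsSymmetrization

end Symmetric

end OrnsteinUhlenbeck

namespace OrnsteinUhlenbeck

open ProbabilityTheory

/-! ### The operator R_t on L²(H, μ) and the first Wiener chaos -/

section Transition

variable {H : Type*} [NormedAddCommGroup H] [InnerProductSpace ℝ H] [CompleteSpace H]
  [MeasurableSpace H] [BorelSpace H] [SecondCountableTopology H]
  {S : ℝ → H →L[ℝ] H} {Q V : H →L[ℝ] H} {Vt : ℝ → H →L[ℝ] H}

theorem isBoundedBorel_indicator {A : Set H} (hA : MeasurableSet A) (c : ℝ) :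
    IsBoundedBorel (A.indicator fun _ => c) :=
  ⟨measurable_const.indicator hA, |c|, fun x => by by_cases hx : x ∈ A <;> simp [hx]⟩

namespace IsCovariance

theorem measurePreserving_fst (hV : IsCovariance S Q V Vt) (t : ℝ) :
    MeasurePreserving Prod.fst (jointLaw S Q t) (invMeasure S Q) :=
  ⟨measurable_fst, hV.map_fst_jointLaw t⟩

theorem measurePreserving_snd (hV : IsCovariance S Q V Vt) (hsymm : IsSymmetricOU S Q) {t : ℝ}
    (ht : 0 ≤ t) : MeasurePreserving Prod.snd (jointLaw S Q t) (invMeasure S Q) :=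
  ⟨measurable_snd, hV.map_snd_jointLaw hsymm ht⟩

theorem memLp_of_isBoundedBorel (hV : IsCovariance S Q V Vt) {φ : H → ℝ} (hφ : IsBoundedBorel φ) :
    MemLp φ 2 (invMeasure S Q) := by
  have := hV.isProbabilityMeasure_inf
  obtain ⟨hm, M, hM⟩ := hφ
  exact MemLp.of_bound hm.aestronglyMeasurable M (Eventually.of_forall hM)

/-- Through the joint law of `(Z(0), Z(t))`, the extension of `R_t` to `L²(H, μ)` exists. -/
theorem exists_isL2Extension (hV : IsCovariance S Q V Vt) (hsymm : IsSymmetricOU S Q) {t : ℝ}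
    (ht : 0 ≤ t) : ∃ T : L2 S Q →L[ℝ] L2 S Q, IsL2Extension S Q t T ∧
      ∀ (f g : H → ℝ) (hf : MemLp f 2 (invMeasure S Q)) (hg : MemLp g 2 (invMeasure S Q)),
        ⟪T hf.toLp, hg.toLp⟫ = ∫ p, f p.2 * g p.1 ∂(jointLaw S Q t) := by
  have := hV.isProbabilityMeasure_inf
  have h1 := hV.measurePreserving_fst t
  have h2 := hV.measurePreserving_snd hsymm ht
  -- `K` and `J` compose a function with the first and second coordinate; both are isometries
  -- because both marginals are μ. The operator `K* J` is then the conditional expectation of a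
  -- function of Z(t) given Z(0).
  let K : L2 S Q →L[ℝ] Lp ℝ 2 (jointLaw S Q t) :=
    (Lp.compMeasurePreservingₗᵢ ℝ Prod.fst h1).toContinuousLinearMap
  let J : L2 S Q →L[ℝ] Lp ℝ 2 (jointLaw S Q t) :=
    (Lp.compMeasurePreservingₗᵢ ℝ Prod.snd h2).toContinuousLinearMap
  set T := ContinuousLinearMap.adjoint K ∘L J with hT
  have key : ∀ (f g : H → ℝ) (hf : MemLp f 2 (invMeasure S Q)) (hg : MemLp g 2 (invMeasure S Q)),
        ⟪T hf.toLp, hg.toLp⟫ = ∫ p, f p.2 * g p.1 ∂(jointLaw S Q t) := fun f g hf hg => by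
    rw [hT, ContinuousLinearMap.comp_apply, ContinuousLinearMap.adjoint_inner_left, L2.inner_def]
    have e1 : J hf.toLp = (hf.comp_measurePreserving h2).toLp := Lp.toLp_compMeasurePreserving hf h2
    have e2 : K hg.toLp = (hg.comp_measurePreserving h1).toLp := Lp.toLp_compMeasurePreserving hg h1
    rw [e1, e2]
    refine integral_congr_ae ?_
    filter_upwards [(hf.comp_measurePreserving h2).coeFn_toLp,
      (hg.comp_measurePreserving h1).coeFn_toLp] with p hp1 hp2
    rw [hp1, hp2, real_inner_eq_re_inner, real_inner_comm]
    rfl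
  refine ⟨T, fun φ hφ h => ?_, key⟩
  have htr := hV.isBoundedBorel_transition t hφ
  have htrL := hV.memLp_of_isBoundedBorel htr
  refine Integrable.ae_eq_of_forall_setIntegral_eq _ _ ((Lp.memLp _).integrable one_le_two)
    (htrL.integrable one_le_two) fun A hA _ => ?_
  have hA1 := memLp_indicator_const (μ := invMeasure S Q) 2 hA (1 : ℝ)
    (Or.inr (measure_ne_top _ A))
  have e := L2.inner_indicatorConstLp_one (𝕜 := ℝ) hA (measure_ne_top (invMeasure S Q) A)
    (T (h.toLp φ))
  rw [← e, real_inner_comm]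
  refine (key φ _ h hA1).trans ?_
  simp_rw [mul_comm (φ _)]
  rw [hV.integral_jointLaw t hφ (isBoundedBorel_indicator hA 1), ← integral_indicator hA]
  refine integral_congr_ae (Eventually.of_forall fun x => ?_)
  by_cases hx : x ∈ A <;> simp [hx]

theorem isL2Extension_unique (hV : IsCovariance S Q V Vt) {t : ℝ} {T T' : L2 S Q →L[ℝ] L2 S Q}
    (hT : IsL2Extension S Q t T) (hT' : IsL2Extension S Q t T') : T = T' := by
  have := hV.isProbabilityMeasure_inf
  refine ContinuousLinearMap.ext fun f => ?_
  refine Lp.induction (by norm_num) (motive := fun f => T f = T' f) (fun c {A} hA hA' => ?_)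
    (fun f g hf hg _ h1 h2 => ?_) (isClosed_eq T.continuous T'.continuous) f
  · have hm := memLp_indicator_const (μ := invMeasure S Q) 2 hA c (Or.inr (measure_ne_top _ A))
    refine Lp.ext ?_
    exact (hT _ (isBoundedBorel_indicator hA c) hm).trans
      (hT' _ (isBoundedBorel_indicator hA c) hm).symm
  · rw [map_add, map_add, h1, h2]

theorem isL2Extension_transitionL2 (hV : IsCovariance S Q V Vt) (hsymm : IsSymmetricOU S Q) {t : ℝ}
    (ht : 0 ≤ t) : IsL2Extension S Q t (transitionL2 S Q t) := by
  obtain ⟨T, hT, -⟩ := hV.exists_isL2Extension hsymm ht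
  have hex : ∃ T, IsL2Extension S Q t T := ⟨T, hT⟩
  rw [transitionL2, dif_pos hex]
  exact hex.choose_spec

theorem inner_transitionL2 (hV : IsCovariance S Q V Vt) (hsymm : IsSymmetricOU S Q) {t : ℝ}
    (ht : 0 ≤ t) {f g : H → ℝ} (hf : MemLp f 2 (invMeasure S Q)) (hg : MemLp g 2 (invMeasure S Q)) :
    ⟪transitionL2 S Q t hf.toLp, hg.toLp⟫ = ∫ p, f p.2 * g p.1 ∂(jointLaw S Q t) := by
  obtain ⟨T, hT, h⟩ := hV.exists_isL2Extension hsymm ht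
  rw [hV.isL2Extension_unique (hV.isL2Extension_transitionL2 hsymm ht) hT]
  exact h f g hf hg

theorem memLp_inner {C : H →L[ℝ] H} (hC : C.IsPositive) {ν : Measure H}
    (hν : IsGaussianMeasure 0 C ν) (a : H) : MemLp (fun x => ⟪a, x⟫) 2 ν := by
  have := (hν.isGaussian_and_covarianceBilin hC).1
  exact (innerSL ℝ a).comp_memLp' (IsGaussian.memLp_two_id (μ := ν))

theorem integral_inner_eq_zero {C : H →L[ℝ] H} (hC : C.IsPositive) {ν : Measure H}
    (hν : IsGaussianMeasure 0 C ν) (a : H) : ∫ x, ⟪a, x⟫ ∂ν = 0 := by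
  obtain ⟨hg, h0, -⟩ := hν.isGaussian_and_covarianceBilin hC
  have e := integral_inner (𝕜 := ℝ) (f := fun x : H => x) (IsGaussian.integrable_id (μ := ν)) a
  rw [e, h0, inner_zero_right]

/-- The noise is centred and independent of the initial value, so only the propagated part
contributes to the covariance. -/
theorem integral_inner_mul_inner_jointLaw (hV : IsCovariance S Q V Vt) (h : Symmetrizes S V) {t : ℝ}
    (ht : 0 ≤ t) (a b : H) :
    ∫ p, ⟪a, p.2⟫ * ⟪b, p.1⟫ ∂(jointLaw S Q t) = ⟪S t (V a), b⟫ := by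
  have := hV.isProbabilityMeasure_inf
  have := hV.isProbabilityMeasure_t t
  have hμ := hV.isGaussianMeasure_inf
  have hν := hV.isGaussianMeasure_t t
  rw [jointLaw, integral_map (measurable_jointMap S t).aemeasurable (by fun_prop)]
  have e : ∀ p : H × H, ⟪a, S t p.1 + p.2⟫ * ⟪b, p.1⟫ =
      ⟪ContinuousLinearMap.adjoint (S t) a, p.1⟫ * ⟪b, p.1⟫ + ⟪b, p.1⟫ * ⟪a, p.2⟫ := fun p => by
    rw [inner_add_right, ContinuousLinearMap.adjoint_inner_left]; ring
  simp only [e]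
  have i1 : Integrable (fun x => ⟪ContinuousLinearMap.adjoint (S t) a, x⟫ * ⟪b, x⟫)
      (invMeasure S Q) :=
    (memLp_inner hV.isPositive hμ _).integrable_mul (memLp_inner hV.isPositive hμ _)
  rw [integral_add (i1.comp_fst _)
    (((memLp_inner hV.isPositive hμ b).integrable one_le_two).mul_prod
      ((memLp_inner (hV.isPositive_t t) hν a).integrable one_le_two)),
    integral_prod_mul (μ := invMeasure S Q) (ν := gaussianMeasure 0 (covOp S Q t))
      (fun x => ⟪b, x⟫) (fun y => ⟪a, y⟫), integral_inner_eq_zero (hV.isPositive_t t) hν a, mul_zero,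
    add_zero, integral_fun_fst
      (fun x => ⟪ContinuousLinearMap.adjoint (S t) a, x⟫ * ⟪b, x⟫),
    hμ.integral_inner_mul_inner hV.isPositive, ← h.apply ht]
  simp

/-- The first Wiener chaos: an isometry `Φ : H → L²(H, μ)` with `Φ(Q_∞^{1/2} a) = ⟪a, ·⟫`, for which
`Φ* R_t Φ = Q_∞^{-1/2} S(t) Q_∞^{1/2}`. -/
theorem exists_firstChaos (hV : IsCovariance S Q V Vt) (hsymm : IsSymmetricOU S Q)
    (hinj : Function.Injective V) {T₀ : ℝ → H →L[ℝ] H} (hT₀ : IsSymmetrization S V T₀)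
    (h : Symmetrizes S V) :
    ∃ Φ : H →L[ℝ] L2 S Q, (∀ x, ‖Φ x‖ = ‖x‖) ∧ ∀ t, 0 ≤ t →
      ContinuousLinearMap.adjoint Φ ∘L transitionL2 S Q t ∘L Φ = T₀ t := by
  have hVp := hV.isPositive
  have hμ := hV.isGaussianMeasure_inf
  have hd := denseRange_posSqrt hVp hinj
  have hL := memLp_inner hVp hμ
  have hinner : ∀ a b, ⟪(hL a).toLp, (hL b).toLp⟫ = ⟪V a, b⟫ := fun a b => by
    rw [L2.inner_def, ← hμ.integral_inner_mul_inner hVp]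
    refine integral_congr_ae ?_
    filter_upwards [(hL a).coeFn_toLp, (hL b).coeFn_toLp] with x h1 h2
    rw [h1, h2, real_inner_comm]
    rfl
  -- The functional `⟪a, ·⟫` has norm `‖posSqrt V a‖` in L², so `a ↦ ⟪a, ·⟫` factors isometrically
  -- through `posSqrt V`.
  have hnorm : ∀ a, ‖((hL a).toLp : L2 S Q)‖ = ‖posSqrt V a‖ := fun a => by
    refine (sq_eq_sq₀ (norm_nonneg _) (norm_nonneg _)).1 ?_
    rw [← real_inner_self_eq_norm_sq, hinner, norm_posSqrt_sq hVp]
  let A : H →L[ℝ] L2 S Q := LinearMap.mkContinuous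
    { toFun := fun a => (hL a).toLp
      map_add' := fun a b => by
        rw [← MemLp.toLp_add]
        exact MemLp.toLp_congr _ _ (Eventually.of_forall fun x => inner_add_left _ _ _)
      map_smul' := fun c a => by
        rw [RingHom.id_apply, ← MemLp.toLp_const_smul]
        exact MemLp.toLp_congr _ _ (Eventually.of_forall fun x => real_inner_smul_left _ _ _) }
    ‖posSqrt V‖ fun a => (hnorm a).le.trans ((posSqrt V).le_opNorm a)
  have hA : ∀ a, A a = (hL a).toLp := fun a => rfl
  obtain ⟨Φ, hΦ, -⟩ := exists_comp_eq_of_norm_le (A := posSqrt V) (B := A) zero_le_one hd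
    fun a => by rw [one_mul, hA, hnorm]
  refine ⟨Φ, fun x => ?_, fun t ht => ?_⟩
  · refine hd.induction_on (p := fun x => ‖Φ x‖ = ‖x‖) x (isClosed_eq (by fun_prop) (by fun_prop))
      fun y => by rw [hΦ, hA, hnorm]
  · refine ContinuousLinearMap.ext fun x => ext_inner_right ℝ fun y => ?_
    change ⟪ContinuousLinearMap.adjoint Φ (transitionL2 S Q t (Φ x)), y⟫ = _
    rw [ContinuousLinearMap.adjoint_inner_left]
    refine hd.induction_on₂ (p := fun x y => ⟪transitionL2 S Q t (Φ x), Φ y⟫ = ⟪T₀ t x, y⟫)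
      (isClosed_eq (by fun_prop) (by fun_prop)) (fun a b => ?_) x y
    rw [hΦ, hΦ, hA, hA, hV.inner_transitionL2 hsymm ht,
      hV.integral_inner_mul_inner_jointLaw h ht, hT₀.inner_apply_sqrt hVp ht]

/-- A compression to a subspace does not increase the Hilbert–Schmidt norm: the chaos carries a
basis to an orthonormal system, and its adjoint is a contraction. -/
theorem hsNormSq_le_hsNormSq_transitionL2 (hV : IsCovariance S Q V Vt) (hsymm : IsSymmetricOU S Q)
    (hinj : Function.Injective V) {T₀ : ℝ → H →L[ℝ] H} (hT₀ : IsSymmetrization S V T₀)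
    (h : Symmetrizes S V) {t : ℝ} (ht : 0 ≤ t) :
    hsNormSq (T₀ t) ≤ hsNormSq (transitionL2 S Q t) := by
  obtain ⟨Φ, hΦ, hΦT⟩ := hV.exists_firstChaos hsymm hinj hT₀ h
  let Φ' : H →ₗᵢ[ℝ] L2 S Q := ⟨Φ, hΦ⟩
  have horth : Orthonormal ℝ fun i => Φ (basis H i) :=
    (basis H).orthonormal.comp_linearIsometry Φ'
  refine le_trans ?_ (tsum_enorm_apply_sq_le horth (transitionL2 S Q t))
  rw [hsNormSq]
  refine ENNReal.tsum_le_tsum fun i => ?_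
  gcongr
  rw [← hΦT t ht]
  change ‖ContinuousLinearMap.adjoint Φ (transitionL2 S Q t (Φ (basis H i)))‖ₑ ≤ _
  refine (ContinuousLinearMap.le_opENorm _ _).trans ?_
  have h1 : ‖ContinuousLinearMap.adjoint Φ‖ₑ ≤ 1 := by
    rw [← ofReal_norm, LinearIsometryEquiv.norm_map]
    exact ENNReal.ofReal_le_one.2 (Φ'.norm_toContinuousLinearMap_le)
  calc _ ≤ 1 * ‖transitionL2 S Q t (Φ (basis H i))‖ₑ := by gcongr
    _ = _ := one_mul _

end IsCovariance

end Transition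

/-! ### Exponential stability -/

section Stability

variable {E : Type*} [NormedAddCommGroup E] [InnerProductSpace ℝ E] [CompleteSpace E]

theorem IsC0Semigroup.isExponentiallyStable_of_norm_lt_one {T : ℝ → E →L[ℝ] E}
    (hT : IsC0Semigroup T) {r : ℝ} (hr : 0 < r) (h : ‖T r‖ < 1) : IsExponentiallyStable T := by
  obtain ⟨M, hM0, hM⟩ := hT.exists_norm_le r
  -- The lower bound 1/2 keeps `log q` meaningful when `T r = 0`. Writing `t` as `k * r` plus a
  -- remainder below `r` costs the factor `q⁻¹`.
  set q := max ‖T r‖ (1 / 2) with hq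
  have hq0 : 0 < q := lt_of_lt_of_le (by norm_num) (le_max_right _ _)
  have hq1 : q < 1 := max_lt h (by norm_num)
  have hlog : Real.log q < 0 := Real.log_neg hq0 hq1
  refine ⟨M * q⁻¹, -Real.log q / r, div_pos (neg_pos.2 hlog) hr, fun t ht => ?_⟩
  set k := ⌊t / r⌋₊ with hk
  have hk1 : (k : ℝ) * r ≤ t := (le_div_iff₀ hr).1 (Nat.floor_le (by positivity))
  have hk2 : t < (k + 1 : ℝ) * r := (div_lt_iff₀ hr).1 (Nat.lt_floor_add_one _)
  have e : T t = T (t - k * r) * T r ^ k := by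
    rw [← hT.map_nat_mul hr.le]
    change _ = T (t - k * r) ∘L T (k * r)
    rw [← hT.map_add _ _ (by linarith) (by positivity), sub_add_cancel]
  have h1 : ‖T r ^ k‖ ≤ q ^ k := by
    rcases Nat.eq_zero_or_pos k with h0 | h0
    · rw [h0, pow_zero, pow_zero]; exact ContinuousLinearMap.norm_id_le
    · exact (norm_pow_le' _ h0).trans (by gcongr; exact le_max_left _ _)
  have h2 : q ^ k ≤ q⁻¹ * Real.exp (-(-Real.log q / r) * t) := by
    rw [← Real.exp_log hq0, ← Real.exp_nat_mul, ← Real.exp_neg, ← Real.exp_add, Real.log_exp]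
    gcongr
    have h3 : -Real.log q * (t / r) ≤ -Real.log q * (k + 1) := by
      have h4 : t / r ≤ k + 1 := by rw [div_le_iff₀ hr]; exact hk2.le
      exact mul_le_mul_of_nonneg_left h4 (by linarith)
    have h5 : -(-Real.log q / r) * t = Real.log q * (t / r) := by ring
    rw [h5]; linarith
  calc ‖T t‖ ≤ ‖T (t - k * r)‖ * ‖T r ^ k‖ := by rw [e]; exact norm_mul_le _ _
    _ ≤ M * (q⁻¹ * Real.exp (-(-Real.log q / r) * t)) := by
      gcongr
      · exact hM _ (by linarith) (by linarith)
      · exact h1.trans h2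
    _ = _ := by ring

/-- A semigroup of contractions which converges strongly to zero and contains a Hilbert–Schmidt
operator is exponentially stable. -/
theorem IsC0Semigroup.isExponentiallyStable_of_hsNormSq_lt_top {T : ℝ → E →L[ℝ] E}
    (hT : IsC0Semigroup T) (hc : ∀ t, 0 ≤ t → ‖T t‖ ≤ 1)
    (hlim : ∀ x, Tendsto (fun t => T t x) atTop (𝓝 0)) (hHS : hsNormSq (T 1) < ∞) :
    IsExponentiallyStable T := by
  have hsum : Summable fun i => ‖T 1 (basis E i)‖ ^ 2 := by
    rw [hsNormSq] at hHS
    simp_rw [enorm_sq_eq_ofReal_norm_sq] at hHS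
    simpa using ENNReal.summable_toReal hHS.ne
  have hle : ∀ n : ℕ, ∀ i, ‖T n (T 1 (basis E i))‖ ^ 2 ≤ ‖T 1 (basis E i)‖ ^ 2 := fun n i => by
    gcongr
    exact ((T n).le_opNorm _).trans (mul_le_of_le_one_left (norm_nonneg _) (hc n n.cast_nonneg))
  -- Dominated convergence for series upgrades strong convergence on the basis images to convergence
  -- of the Hilbert–Schmidt norm of `T n ∘L T 1 = T (n + 1)`, which dominates the operator norm.
  have h0 : Tendsto (fun n : ℕ => ∑' i, ‖T n (T 1 (basis E i))‖ ^ 2) atTop (𝓝 0) := by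
    have := tendsto_tsum_of_dominated_convergence (𝓕 := atTop)
      (f := fun (n : ℕ) i => ‖T n (T 1 (basis E i))‖ ^ 2) (g := fun _ => (0 : ℝ)) hsum (fun i => ?_)
      (Eventually.of_forall fun n i => ?_)
    · simpa using this
    · have := (((hlim (T 1 (basis E i))).comp tendsto_natCast_atTop_atTop).norm).pow 2
      simpa using this
    · rw [Real.norm_of_nonneg (sq_nonneg _)]; exact hle n i
  obtain ⟨n, hn⟩ := (h0.eventually_lt_const one_pos).exists
  have hn0 : (0 : ℝ) < n + 1 := by positivity
  refine hT.isExponentiallyStable_of_norm_lt_one hn0 ?_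
  have h1 := enorm_sq_le_hsNormSq (T n ∘L T 1)
  rw [hsNormSq] at h1
  simp_rw [enorm_sq_eq_ofReal_norm_sq, ContinuousLinearMap.comp_apply] at h1
  rw [← ENNReal.ofReal_tsum_of_nonneg (fun i => sq_nonneg _)
    (Summable.of_nonneg_of_le (fun i => sq_nonneg _) (hle n) hsum),
    ENNReal.ofReal_le_ofReal_iff (tsum_nonneg fun i => sq_nonneg _),
    ← hT.map_add _ _ n.cast_nonneg zero_le_one] at h1
  have h2 : ‖T (n + 1)‖ ^ 2 < 1 := h1.trans_lt hn
  exact (sq_lt_one_iff₀ (norm_nonneg _)).1 h2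

/-- For exponentially stable selfadjoint semigroups `‖T(t)‖ < 1` for `t > 0`. -/
theorem IsC0Semigroup.norm_lt_one_of_isExponentiallyStable {T : ℝ → E →L[ℝ] E}
    (hT : IsC0Semigroup T) (hsa : ∀ t, 0 ≤ t → IsSelfAdjoint (T t)) (h : IsExponentiallyStable T)
    {t : ℝ} (ht : 0 < t) : ‖T t‖ < 1 := by
  by_contra hge
  rw [not_lt] at hge
  obtain ⟨M, β, hβ, hM⟩ := h
  -- For selfadjoint operators the norm of a power of order `2 ^ n` is the power of the norm, so a
  -- norm at least 1 cannot decay along the times `2 ^ n * t`.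
  have h1 : ∀ n : ℕ, 1 ≤ ‖T ((2 ^ n : ℕ) * t)‖ := fun n => by
    rw [hT.map_nat_mul ht.le, (hsa t ht.le).norm_pow_two_pow]
    exact one_le_pow₀ hge
  have h2 : Tendsto (fun n : ℕ => M * Real.exp (-β * ((2 ^ n : ℕ) * t))) atTop (𝓝 0) := by
    have h3 : Tendsto (fun n : ℕ => ((2 ^ n : ℕ) : ℝ) * (β * t)) atTop atTop :=
      (tendsto_natCast_atTop_atTop.comp (tendsto_pow_atTop_atTop_of_one_lt one_lt_two)).atTop_mul_const
        (by positivity)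
    have h4 := ((Real.tendsto_exp_neg_atTop_nhds_zero).comp h3).const_mul M
    rw [mul_zero] at h4
    refine h4.congr fun n => ?_
    simp only [Function.comp]
    congr 2; ring
  have := ge_of_tendsto' h2 fun n => (h1 n).trans (hM _ (by positivity))
  linarith

theorem IsExponentiallyStable.of_intertwine {T T' : ℝ → E →L[ℝ] E} (h : IsExponentiallyStable T)
    (U : E ≃ₗᵢ[ℝ] E) (hU : ∀ t, 0 ≤ t → ∀ x, T' t (U x) = U (T t x)) : IsExponentiallyStable T' := by
  obtain ⟨M, β, hβ, hM⟩ := h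
  refine ⟨M, β, hβ, fun t ht => le_trans ?_ (hM t ht)⟩
  refine ContinuousLinearMap.opNorm_le_bound _ (norm_nonneg _) fun x => ?_
  obtain ⟨y, rfl⟩ := U.surjective x
  rw [hU t ht, U.norm_map, U.norm_map]
  exact (T t).le_opNorm y

end Stability

end OrnsteinUhlenbeck

namespace OrnsteinUhlenbeck

open ProbabilityTheory

/-! ### Measures with a square integrable density -/

section SqDominates

variable {α β : Type*} [MeasurableSpace α] [MeasurableSpace β]

/-- `(∫ F dρ)² ≤ c ∫ F² dm` for all `F ≥ 0`: `ρ` has a density in `L²(m)` of squared norm at most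
`c`. -/
def SqDominates (c : ℝ≥0∞) (m ρ : Measure α) : Prop :=
  ∀ F : α → ℝ≥0∞, Measurable F → (∫⁻ x, F x ∂ρ) ^ 2 ≤ c * ∫⁻ x, F x ^ 2 ∂m

theorem sq_lintegral_mul_le (m : Measure α) {f g : α → ℝ≥0∞} (hf : Measurable f)
    (hg : Measurable g) :
    (∫⁻ x, f x * g x ∂m) ^ 2 ≤ (∫⁻ x, g x ^ 2 ∂m) * ∫⁻ x, f x ^ 2 ∂m := by
  have h := ENNReal.lintegral_mul_le_Lp_mul_Lq m Real.HolderConjugate.two_two hf.aemeasurable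
    hg.aemeasurable
  have e : ∀ a : ℝ≥0∞, (a ^ (1 / 2 : ℝ)) ^ 2 = a := fun a => by
    rw [← ENNReal.rpow_two, ← ENNReal.rpow_mul]; norm_num
  refine (pow_le_pow_left' h 2).trans_eq ?_
  rw [mul_pow, e, e, mul_comm]
  simp only [ENNReal.rpow_two]

theorem sqDominates_withDensity (m : Measure α) {k : α → ℝ≥0∞} (hk : Measurable k) :
    SqDominates (∫⁻ x, k x ^ 2 ∂m) m (m.withDensity k) := fun F hF => by
  rw [lintegral_withDensity_eq_lintegral_mul _ hk hF]
  simp only [Pi.mul_apply, mul_comm (k _)]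
  exact sq_lintegral_mul_le m hF hk

theorem SqDominates.mono {c d : ℝ≥0∞} {m ρ : Measure α} (h : SqDominates c m ρ) (hcd : c ≤ d) :
    SqDominates d m ρ := fun F hF => (h F hF).trans (by gcongr)

theorem SqDominates.map {c : ℝ≥0∞} {m ρ : Measure α} (h : SqDominates c m ρ) {f : α → β}
    (hf : Measurable f) : SqDominates c (m.map f) (ρ.map f) := fun F hF => by
  rw [lintegral_map hF hf, lintegral_map (hF.pow_const 2) hf]
  exact h _ (hF.comp hf)

/-- The first bound is applied to the inner integral of `F`, the second to each section; Tonelli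
combines them and the constants multiply. -/
theorem SqDominates.prod {c d : ℝ≥0∞} {m ρ : Measure α} {m' ρ' : Measure β} [SFinite m] [SFinite ρ]
    [SFinite m'] [SFinite ρ'] (h : SqDominates c m ρ) (h' : SqDominates d m' ρ') :
    SqDominates (c * d) (m.prod m') (ρ.prod ρ') := fun F hF => by
  rw [lintegral_prod _ hF.aemeasurable, lintegral_prod _ (hF.pow_const 2).aemeasurable]
  refine (h _ hF.lintegral_prod_right').trans ?_
  rw [mul_assoc, ← lintegral_const_mul _ (hF.pow_const 2).lintegral_prod_right']
  gcongr with x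
  exact h' _ (hF.comp measurable_prodMk_left)

theorem SqDominates.pi {n : ℕ} {c : Fin n → ℝ≥0∞} {m ρ : Fin n → Measure α}
    [∀ i, IsProbabilityMeasure (m i)] [∀ i, IsProbabilityMeasure (ρ i)]
    (h : ∀ i, SqDominates (c i) (m i) (ρ i)) :
    SqDominates (∏ i, c i) (Measure.pi m) (Measure.pi ρ) := by
  induction n with
  | zero =>
    intro F hF
    rw [Measure.pi_of_empty, Measure.pi_of_empty]
    simp
  | succ n ih =>
    have h1 := ((h 0).prod (ih fun i => h i.succ)).map
      (MeasurableEquiv.piFinSuccAbove (fun _ : Fin (n + 1) => α) 0).symm.measurable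
    have e1 := (measurePreserving_piFinSuccAbove m 0).symm.map_eq
    have e2 := (measurePreserving_piFinSuccAbove ρ 0).symm.map_eq
    simp only [Fin.zero_succAbove] at e1 e2
    rw [e1, e2] at h1
    rwa [Fin.prod_univ_succ]

theorem le_rpow_half_mul_iff (a b c : ℝ≥0∞) :
    a ≤ c ^ (1 / 2 : ℝ) * b ^ (1 / 2 : ℝ) ↔ a ^ 2 ≤ c * b := by
  rw [← ENNReal.mul_rpow_of_nonneg _ _ (by norm_num), one_div,
    ENNReal.le_rpow_inv_iff two_pos, ENNReal.rpow_two]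

theorem eLpNorm_two_eq_rpow_half (m : Measure α) (f : α → ℝ) :
    eLpNorm f 2 m = (∫⁻ x, ‖f x‖ₑ ^ 2 ∂m) ^ (1 / 2 : ℝ) := by
  rw [eLpNorm_eq_lintegral_rpow_enorm_toReal two_ne_zero ENNReal.ofNat_ne_top]
  simp

/-- Approximating in L²(m + ρ) makes one bounded continuous function close for both measures at
once. -/
theorem sq_lintegral_enorm_le_of_boundedContinuous [TopologicalSpace α]
    [TopologicalSpace.PseudoMetrizableSpace α] [BorelSpace α] {c : ℝ≥0∞} (hc : c ≠ ∞)
    {m ρ : Measure α} [IsFiniteMeasure m] [IsProbabilityMeasure ρ]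
    (h : ∀ g : BoundedContinuousFunction α ℝ,
      (∫⁻ x, ‖g x‖ₑ ∂ρ) ^ 2 ≤ c * ∫⁻ x, ‖g x‖ₑ ^ 2 ∂m) {f : α → ℝ} (hL : MemLp f 2 (m + ρ)) :
    (∫⁻ x, ‖f x‖ₑ ∂ρ) ^ 2 ≤ c * ∫⁻ x, ‖f x‖ₑ ^ 2 ∂m := by
  have hc' : c ^ (1 / 2 : ℝ) ≠ ∞ := ENNReal.rpow_ne_top_of_nonneg (by norm_num) hc
  have hm : m ≤ m + ρ := Measure.le_add_right le_rfl
  have hρ : ρ ≤ m + ρ := Measure.le_add_left le_rfl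
  rw [← le_rpow_half_mul_iff, ← eLpNorm_two_eq_rpow_half, ← eLpNorm_one_eq_lintegral_enorm]
  have key : ∀ ε : ℝ≥0∞, 0 < ε →
      eLpNorm f 1 ρ ≤ ε + c ^ (1 / 2 : ℝ) * (eLpNorm f 2 m + ε) := fun ε hε => by
    obtain ⟨g, hg, hgL⟩ := hL.exists_boundedContinuous_eLpNorm_sub_le (by norm_num) hε.ne'
    have hd := (hL.sub hgL).aestronglyMeasurable
    have h1 : eLpNorm (f - ⇑g) 2 m ≤ ε := (eLpNorm_mono_measure _ hm).trans hg
    have h2 : eLpNorm (f - ⇑g) 1 ρ ≤ ε :=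
      (eLpNorm_le_eLpNorm_of_exponent_le one_le_two (hd.mono_measure hρ)).trans
        ((eLpNorm_mono_measure _ hρ).trans hg)
    have h3 : eLpNorm g 1 ρ ≤ c ^ (1 / 2 : ℝ) * eLpNorm g 2 m := by
      rw [eLpNorm_two_eq_rpow_half, eLpNorm_one_eq_lintegral_enorm, le_rpow_half_mul_iff]
      exact h g
    have h4 : eLpNorm g 2 m ≤ eLpNorm f 2 m + ε := by
      have e : ⇑g = f - (f - ⇑g) := (sub_sub_cancel _ _).symm
      rw [e]
      exact (eLpNorm_sub_le (hL.aestronglyMeasurable.mono_measure hm) (hd.mono_measure hm)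
        one_le_two).trans (add_le_add_right h1 _)
    have h5 : eLpNorm f 1 ρ ≤ eLpNorm (f - ⇑g) 1 ρ + eLpNorm g 1 ρ := by
      have e : f = (f - ⇑g) + ⇑g := (sub_add_cancel _ _).symm
      conv_lhs => rw [e]
      exact eLpNorm_add_le (hd.mono_measure hρ) (hgL.aestronglyMeasurable.mono_measure hρ) le_rfl
    exact h5.trans (add_le_add h2 (h3.trans (by gcongr)))
  have hlim : Tendsto (fun ε : ℝ≥0∞ => ε + c ^ (1 / 2 : ℝ) * (eLpNorm f 2 m + ε)) (𝓝[>] 0)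
      (𝓝 (0 + c ^ (1 / 2 : ℝ) * (eLpNorm f 2 m + 0))) := by
    have hid : Tendsto (fun ε : ℝ≥0∞ => ε) (𝓝[>] 0) (𝓝 0) := nhdsWithin_le_nhds
    exact hid.add (ENNReal.Tendsto.const_mul (tendsto_const_nhds.add hid) (Or.inr hc'))
  rw [zero_add, add_zero] at hlim
  exact ge_of_tendsto hlim (eventually_nhdsWithin_of_forall key)

/-- Truncation at height `n` gives functions in L²; monotone convergence removes it. Testing on
continuous functions is what allows limits of cylinder projections. -/
theorem SqDominates.of_boundedContinuous [TopologicalSpace α]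
    [TopologicalSpace.PseudoMetrizableSpace α] [BorelSpace α] {c : ℝ≥0∞} (hc : c ≠ ∞)
    {m ρ : Measure α} [IsFiniteMeasure m] [IsProbabilityMeasure ρ]
    (h : ∀ g : BoundedContinuousFunction α ℝ,
      (∫⁻ x, ‖g x‖ₑ ∂ρ) ^ 2 ≤ c * ∫⁻ x, ‖g x‖ₑ ^ 2 ∂m) : SqDominates c m ρ := by
  intro F hF
  have hmin : ∀ n : ℕ, (∫⁻ x, min (F x) n ∂ρ) ^ 2 ≤ c * ∫⁻ x, F x ^ 2 ∂m := fun n => by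
    have e : ∀ x, ‖(min (F x) n).toReal‖ₑ = min (F x) n := fun x => by
      rw [← ofReal_norm, Real.norm_of_nonneg ENNReal.toReal_nonneg, ENNReal.ofReal_toReal]
      exact ne_top_of_le_ne_top (ENNReal.natCast_ne_top n) (min_le_right _ _)
    have hL : MemLp (fun x => (min (F x) n).toReal) 2 (m + ρ) := by
      refine MemLp.of_bound (C := n)
        (hF.min measurable_const).ennreal_toReal.aestronglyMeasurable (Eventually.of_forall fun x => ?_)
      rw [Real.norm_of_nonneg ENNReal.toReal_nonneg]
      exact ENNReal.toReal_le_of_le_ofReal n.cast_nonneg (by simp)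
    have := sq_lintegral_enorm_le_of_boundedContinuous hc h hL
    simp only [e] at this
    refine this.trans ?_
    gcongr
    exact min_le_left _ _
  have hsup : Tendsto (fun n : ℕ => ∫⁻ x, min (F x) n ∂ρ) atTop (𝓝 (∫⁻ x, F x ∂ρ)) := by
    refine lintegral_tendsto_of_tendsto_of_monotone
      (fun n => (hF.min measurable_const).aemeasurable) (Eventually.of_forall fun x i j hij => ?_)
      (Eventually.of_forall fun x => ?_)
    · exact min_le_min le_rfl (by exact_mod_cast hij)
    · have := (tendsto_const_nhds (x := F x)).min ENNReal.tendsto_nat_nhds_top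
      simpa using this
  exact le_of_tendsto ((ENNReal.continuous_pow 2).tendsto _ |>.comp hsup) (Eventually.of_forall hmin)

end SqDominates

/-! ### The two-dimensional standard Gaussian law with correlation `r` -/

section Correlated

/-- The law of `(X, r X + √(1 - r²) Y)` for independent standard Gaussian `X`, `Y`. -/
noncomputable def correlatedGaussian (r : ℝ) : Measure (ℝ × ℝ) :=
  ((gaussianReal 0 1).prod (gaussianReal 0 1)).map fun p => (p.1, r * p.1 + √(1 - r ^ 2) * p.2)

instance (r : ℝ) : IsProbabilityMeasure (correlatedGaussian r) :=
  Measure.isProbabilityMeasure_map (by fun_prop)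

theorem correlatedGaussian_zero :
    correlatedGaussian 0 = (gaussianReal 0 1).prod (gaussianReal 0 1) := by
  simp [correlatedGaussian]

theorem integral_exp_correlatedGaussian {r : ℝ} (hr : |r| ≤ 1) (s t : ℝ) :
    ∫ p, Complex.exp ((s * p.1 + t * p.2 : ℝ) * Complex.I) ∂(correlatedGaussian r) =
      Complex.exp ((-(s ^ 2 + 2 * r * s * t + t ^ 2) / 2 : ℝ)) := by
  have hr2 : 0 ≤ 1 - r ^ 2 := by nlinarith [abs_le.1 hr]
  rw [correlatedGaussian, integral_map (by fun_prop) (by fun_prop)]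
  have e : ∀ p : ℝ × ℝ, Complex.exp ((s * p.1 + t * (r * p.1 + √(1 - r ^ 2) * p.2) : ℝ) * Complex.I)
      = Complex.exp (((s + r * t : ℝ)) * p.1 * Complex.I) *
        Complex.exp (((√(1 - r ^ 2) * t : ℝ)) * p.2 * Complex.I) := fun p => by
    rw [← Complex.exp_add]
    congr 1
    push_cast; ring
  simp only [e]
  rw [integral_prod_mul (μ := gaussianReal 0 1) (ν := gaussianReal 0 1)
    (fun x : ℝ => Complex.exp (((s + r * t : ℝ)) * x * Complex.I))
    (fun x : ℝ => Complex.exp (((√(1 - r ^ 2) * t : ℝ)) * x * Complex.I)), ← charFun_apply_real,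
    ← charFun_apply_real, charFun_gaussianReal, charFun_gaussianReal, ← Complex.exp_add]
  congr 1
  have h : (√(1 - r ^ 2) * t) ^ 2 = (1 - r ^ 2) * t ^ 2 := by rw [mul_pow, Real.sq_sqrt hr2]
  have h2 : -(s ^ 2 + 2 * r * s * t + t ^ 2) / 2 =
    -((s + r * t) ^ 2 + (√(1 - r ^ 2) * t) ^ 2) / 2 := by rw [h]; ring
  rw [h2]
  push_cast
  simp
  ring

theorem gaussianReal_eq_withDensity {μ : ℝ} {v : NNReal} (hv : v ≠ 0) :
    gaussianReal μ v = (gaussianReal 0 1).withDensity fun y =>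
      ENNReal.ofReal (gaussianPDFReal μ v y / gaussianPDFReal 0 1 y) := by
  rw [gaussianReal_of_var_ne_zero _ hv, gaussianReal_of_var_ne_zero _ one_ne_zero,
    ← withDensity_mul _ (measurable_gaussianPDF 0 1) (by fun_prop)]
  congr 1
  funext y
  have h := gaussianPDFReal_pos 0 1 y one_ne_zero
  rw [Pi.mul_apply, gaussianPDF, gaussianPDF, ← ENNReal.ofReal_mul h.le]
  congr 1
  field_simp

/-- Completing the square. With `v₁ * v₂ = 1` the right side is `v⁻¹` times a probability density on
the plane, written as a marginal times a conditional density, so it can be integrated at sight. -/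
theorem gaussianPDFReal_density_sq {r : ℝ} {v v₁ v₂ : NNReal} (hv : (v : ℝ) = 1 - r ^ 2)
    (hv0 : 0 < (v : ℝ)) (hv₁ : (v₁ : ℝ) = v / (1 + r ^ 2)) (hv₂ : (v₂ : ℝ) = (1 + r ^ 2) / v)
    (x y : ℝ) :
    gaussianPDFReal 0 1 x * (gaussianPDFReal 0 1 y *
      (gaussianPDFReal (r * x) v y / gaussianPDFReal 0 1 y) ^ 2) =
      (v : ℝ)⁻¹ * (gaussianPDFReal 0 v₂ x * gaussianPDFReal (2 * r / (1 + r ^ 2) * x) v₁ y) := by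
  have hr : 0 < 1 + r ^ 2 := by positivity
  have hp : 0 < √(2 * Real.pi * 1) := by positivity
  have hs1 : √(2 * Real.pi * v₂) * √(2 * Real.pi * v₁) = 2 * Real.pi := by
    rw [← Real.sqrt_mul (by positivity), hv₁, hv₂,
      show 2 * Real.pi * ((1 + r ^ 2) / v) * (2 * Real.pi * (v / (1 + r ^ 2))) = (2 * Real.pi) ^ 2 by
        field_simp, Real.sqrt_sq (by positivity)]
  have hs2 : √(2 * Real.pi * v) ^ 2 = 2 * Real.pi * v := Real.sq_sqrt (by positivity)
  simp only [gaussianPDFReal, NNReal.coe_one]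
  have hE : Real.exp (-(x - 0) ^ 2 / (2 * 1)) * (Real.exp (-(y - 0) ^ 2 / (2 * 1)) *
      (Real.exp (-(y - r * x) ^ 2 / (2 * v)) / Real.exp (-(y - 0) ^ 2 / (2 * 1))) ^ 2) =
      Real.exp (-(x - 0) ^ 2 / (2 * v₂)) *
        Real.exp (-(y - 2 * r / (1 + r ^ 2) * x) ^ 2 / (2 * v₁)) := by
    rw [← Real.exp_sub, ← Real.exp_nat_mul, ← Real.exp_add, ← Real.exp_add, ← Real.exp_add]
    congr 1
    have hr2 : 1 - r ^ 2 ≠ 0 := (hv ▸ hv0).ne'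
    rw [hv₁, hv₂, hv]
    push_cast
    field_simp
    ring
  set a := √(2 * Real.pi * 1)
  set b := √(2 * Real.pi * v)
  calc _ = (b ^ 2)⁻¹ * (Real.exp (-(x - 0) ^ 2 / (2 * 1)) * (Real.exp (-(y - 0) ^ 2 / (2 * 1)) *
      (Real.exp (-(y - r * x) ^ 2 / (2 * v)) / Real.exp (-(y - 0) ^ 2 / (2 * 1))) ^ 2)) := by
        field_simp
    _ = (v : ℝ)⁻¹ * (√(2 * Real.pi * v₂) * √(2 * Real.pi * v₁))⁻¹ *
        (Real.exp (-(x - 0) ^ 2 / (2 * v₂)) *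
          Real.exp (-(y - 2 * r / (1 + r ^ 2) * x) ^ 2 / (2 * v₁))) := by
        rw [hE, hs1, hs2, mul_inv_rev]
    _ = _ := by rw [mul_inv]; ring

/-- The density `k` compares the conditional law N(r x, 1 - r²) with N(0, 1). Its squared norm is
exactly `(1 - r ^ 2)⁻¹`, and Cauchy–Schwarz concludes. -/
theorem sqDominates_correlatedGaussian {r : ℝ} (hr : |r| < 1) :
    SqDominates (ENNReal.ofReal (1 - r ^ 2)⁻¹) ((gaussianReal 0 1).prod (gaussianReal 0 1))
      (correlatedGaussian r) := by
  have hr2 : 0 < 1 - r ^ 2 := by nlinarith [abs_lt.1 hr]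
  set v : NNReal := ⟨1 - r ^ 2, hr2.le⟩ with hvdef
  have hv : (v : ℝ) = 1 - r ^ 2 := rfl
  have hv0 : v ≠ 0 := fun h => hr2.ne' (by rw [← hv, h]; rfl)
  have hr1 : 0 < 1 + r ^ 2 := by positivity
  set v₁ : NNReal := ⟨v / (1 + r ^ 2), by positivity⟩ with hv₁
  set v₂ : NNReal := ⟨(1 + r ^ 2) / v, by positivity⟩ with hv₂
  have hv₁0 : v₁ ≠ 0 := fun h => by
    have : (v₁ : ℝ) ≠ 0 := (div_pos (hv ▸ hr2) hr1).ne'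
    exact this (by rw [h]; rfl)
  have hv₂0 : v₂ ≠ 0 := fun h => by
    have : (v₂ : ℝ) ≠ 0 := (div_pos hr1 (hv ▸ hr2)).ne'
    exact this (by rw [h]; rfl)
  set k : ℝ × ℝ → ℝ≥0∞ := fun p =>
    ENNReal.ofReal (gaussianPDFReal (r * p.1) v p.2 / gaussianPDFReal 0 1 p.2) with hk
  have hkm : Measurable k := by
    refine (Measurable.div ?_ ((measurable_gaussianPDFReal 0 1).comp measurable_snd)).ennreal_ofReal
    unfold gaussianPDFReal
    fun_prop
  have e1 : correlatedGaussian r = ((gaussianReal 0 1).prod (gaussianReal 0 1)).withDensity k := by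
    refine Measure.ext_of_lintegral _ fun F hF => ?_
    rw [lintegral_withDensity_eq_lintegral_mul _ hkm hF, correlatedGaussian,
      lintegral_map hF (by fun_prop), lintegral_prod _ (by fun_prop),
      lintegral_prod _ (by fun_prop)]
    refine lintegral_congr fun x => ?_
    have hmap : (gaussianReal 0 1).map (fun y => r * x + √(1 - r ^ 2) * y) =
        gaussianReal (r * x) v := by
      have := gaussianReal_map_const_mul (μ := 0) (v := 1) (√(1 - r ^ 2))
      have h2 := gaussianReal_map_const_add (μ := √(1 - r ^ 2) * 0)
        (v := .mk (√(1 - r ^ 2) ^ 2) (sq_nonneg _) * 1) (r * x)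
      rw [← this, Measure.map_map (by fun_prop) (by fun_prop)] at h2
      refine h2.trans ?_
      rw [mul_zero, zero_add, mul_one]
      congr 1
      exact Subtype.ext (Real.sq_sqrt hr2.le)
    have hFx : Measurable fun y => F (x, y) := hF.comp measurable_prodMk_left
    have h3 := lintegral_map (μ := gaussianReal 0 1) hFx
      (g := fun y => r * x + √(1 - r ^ 2) * y) (by fun_prop)
    rw [hmap, gaussianReal_eq_withDensity hv0, lintegral_withDensity_eq_lintegral_mul _
      (f := fun y => k (x, y)) (hkm.comp measurable_prodMk_left) hFx] at h3
    exact h3.symm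
  have e2 : ∫⁻ p, k p ^ 2 ∂((gaussianReal 0 1).prod (gaussianReal 0 1)) =
      ENNReal.ofReal (1 - r ^ 2)⁻¹ := by
    rw [lintegral_prod _ (hkm.pow_const 2).aemeasurable,
      gaussianReal_of_var_ne_zero 0 one_ne_zero,
      lintegral_withDensity_eq_lintegral_mul _ (measurable_gaussianPDF 0 1)
        (hkm.pow_const 2).lintegral_prod_right']
    have hkx : ∀ x, Measurable fun y => k (x, y) ^ 2 := fun x =>
      (hkm.pow_const 2).comp measurable_prodMk_left
    have h1 : ∀ x, ∫⁻ y, k (x, y) ^ 2 ∂(volume.withDensity (gaussianPDF 0 1)) =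
        ∫⁻ y, gaussianPDF 0 1 y * k (x, y) ^ 2 := fun x => by
      rw [lintegral_withDensity_eq_lintegral_mul _ (measurable_gaussianPDF 0 1)
        (hkx x)]
      rfl
    have h2 : ∀ x, gaussianPDF 0 1 x * ∫⁻ y, gaussianPDF 0 1 y * k (x, y) ^ 2 =
        ENNReal.ofReal (1 - r ^ 2)⁻¹ * gaussianPDF 0 v₂ x := fun x => by
      rw [← lintegral_const_mul (f := fun y => gaussianPDF 0 1 y * k (x, y) ^ 2) _
        ((measurable_gaussianPDF 0 1).mul (hkx x))]
      have h3 : ∀ y, gaussianPDF 0 1 x * (gaussianPDF 0 1 y * k (x, y) ^ 2) =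
          ENNReal.ofReal (1 - r ^ 2)⁻¹ * gaussianPDF 0 v₂ x *
            gaussianPDF (2 * r / (1 + r ^ 2) * x) v₁ y := fun y => by
        have n1 := gaussianPDFReal_nonneg 0 1 x
        have n2 := gaussianPDFReal_nonneg 0 1 y
        have n3 := gaussianPDFReal_nonneg (r * x) v y
        have n4 := gaussianPDFReal_nonneg 0 v₂ x
        simp only [gaussianPDF, hk]
        rw [← ENNReal.ofReal_pow (by positivity), ← ENNReal.ofReal_mul n2, ← ENNReal.ofReal_mul n1,
          gaussianPDFReal_density_sq (v₁ := v₁) (v₂ := v₂) hv (hv ▸ hr2) rfl rfl, ← ENNReal.ofReal_mul (by positivity),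
          ← ENNReal.ofReal_mul (by positivity), mul_assoc, hv]
      simp only [h3]
      rw [lintegral_const_mul _ (measurable_gaussianPDF _ _), lintegral_gaussianPDF_eq_one _ hv₁0,
        mul_one]
    simp only [Pi.mul_apply, h1, h2]
    rw [lintegral_const_mul _ (measurable_gaussianPDF _ _), lintegral_gaussianPDF_eq_one _ hv₂0,
      mul_one]
  rw [e1, ← e2]
  exact sqDominates_withDensity _ hkm

end Correlated

end OrnsteinUhlenbeck

namespace OrnsteinUhlenbeck

open ProbabilityTheory

/-! ### Diagonalisation and finite-dimensional marginals -/

section FiniteDimensional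

variable {H : Type*} [NormedAddCommGroup H] [InnerProductSpace ℝ H]

/-- Distinct members lie at distance √2, so the balls of radius 1/2 around them are disjoint. -/
theorem countable_of_orthonormal [SecondCountableTopology H] {ι : Type*} {v : ι → H}
    (hv : Orthonormal ℝ v) : Countable ι := by
  refine Pairwise.countable_of_isOpen_disjoint (s := fun i => Metric.ball (v i) (1 / 2))
    (fun i j hij => ?_) (fun i => Metric.isOpen_ball) fun i => ⟨v i, by simp⟩
  refine Metric.ball_disjoint_ball ?_
  have h : ‖v i - v j‖ ^ 2 = 2 := by
    rw [norm_sub_sq_real, hv.1, hv.1, hv.2 hij]; norm_num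
  rw [dist_eq_norm]
  nlinarith [norm_nonneg (v i - v j)]

/-- Dominated convergence along finite subsets of the basis and exchange of sum and integral require
countability. -/
instance [CompleteSpace H] [SecondCountableTopology H] : Countable (basisSet H) :=
  countable_of_orthonormal (basis H).orthonormal

/-- The spectral theorem for the compression of `T` to `E`. The subspace need not be invariant under
`T`, hence the conclusion in terms of matrix entries only. -/
theorem exists_diagonalization {T : H →L[ℝ] H} (hT : ∀ x y, ⟪T x, y⟫ = ⟪x, T y⟫)
    (E : Submodule ℝ H) [FiniteDimensional ℝ E] :
    ∃ (n : ℕ) (u : Fin n → H), Orthonormal ℝ u ∧ (∀ i, u i ∈ E) ∧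
      (∀ x ∈ E, x = ∑ i, ⟪u i, x⟫ • u i) ∧ ∀ i j, i ≠ j → ⟪T (u i), u j⟫ = 0 := by
  let A : E →ₗ[ℝ] E := E.orthogonalProjectionOnto.toLinearMap ∘ₗ T.toLinearMap ∘ₗ E.subtype
  have hA : ∀ x y : E, ⟪A x, y⟫ = ⟪T x, (y : H)⟫ := fun x y =>
    Submodule.inner_orthogonalProjectionOnto_eq_of_mem_right y (T x)
  have hs : A.IsSymmetric := fun x y => (hA x y).trans ((hT _ _).trans
    (Submodule.inner_orthogonalProjectionOnto_eq_of_mem_left x (T y)).symm)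
  have hes := hs.apply_eigenvectorBasis rfl
  generalize hs.eigenvectorBasis rfl = e at hes
  refine ⟨_, fun i => (e i : H), e.orthonormal.comp_linearIsometry E.subtypeₗᵢ, fun i => (e i).2,
    fun x hx => ?_, fun i j hij => ?_⟩
  · have := congrArg (Subtype.val) (e.sum_repr' ⟨x, hx⟩)
    simpa using this.symm
  · rw [← hA, hes, inner_smul_left, e.orthonormal.2 hij, mul_zero]

variable [MeasurableSpace H] [BorelSpace H] [SecondCountableTopology H]

/-- An exponent without mixed terms between different indices means that the pairs of coordinates
are independent. -/
theorem map_eq_pi_correlatedGaussian {ρ : Measure (H × H)} [IsProbabilityMeasure ρ] {n : ℕ}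
    (w : Fin n → H) {r : Fin n → ℝ} (hr : ∀ i, |r i| ≤ 1)
    (hρ : ∀ s t : Fin n → ℝ,
      ∫ p, Complex.exp ((⟪p.1, ∑ i, s i • w i⟫ + ⟪p.2, ∑ i, t i • w i⟫ : ℝ) * Complex.I) ∂ρ =
        Complex.exp ((-(∑ i, (s i ^ 2 + 2 * r i * s i * t i + t i ^ 2)) / 2 : ℝ))) :
    ρ.map (fun p i => (⟪p.1, w i⟫, ⟪p.2, w i⟫)) = Measure.pi fun i => correlatedGaussian (r i) := by
  have hm : Measurable fun (p : H × H) (i : Fin n) => (⟪p.1, w i⟫, ⟪p.2, w i⟫) := by fun_prop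
  have := Measure.isProbabilityMeasure_map (μ := ρ) hm.aemeasurable
  refine charFunDual_eq_pi_iff.1 fun L => ?_
  set s : Fin n → ℝ := fun i => L (Pi.single i (1, 0))
  set t : Fin n → ℝ := fun i => L (Pi.single i (0, 1))
  have hL : ∀ (i : Fin n) (z : ℝ × ℝ),
      L.comp (ContinuousLinearMap.single ℝ (fun _ => ℝ × ℝ) i) z = s i * z.1 + t i * z.2 := by
    intro i z
    have e : z = z.1 • (1, 0) + z.2 • (0, 1) := by ext <;> simp
    conv_lhs => rw [e]
    rw [map_add, map_smul, map_smul, smul_eq_mul, smul_eq_mul, mul_comm, mul_comm z.2]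
    rfl
  have hi : ∀ i, charFunDual (correlatedGaussian (r i))
      (L.comp (ContinuousLinearMap.single ℝ (fun _ => ℝ × ℝ) i)) =
      Complex.exp ((-(s i ^ 2 + 2 * r i * s i * t i + t i ^ 2) / 2 : ℝ)) := fun i => by
    rw [charFunDual_apply, ← integral_exp_correlatedGaussian (hr i)]
    simp only [hL]
  simp only [hi]
  rw [← Complex.exp_sum, charFunDual_apply, integral_map hm.aemeasurable (by fun_prop)]
  rw [← Complex.ofReal_sum, ← Finset.sum_div, Finset.sum_neg_distrib, ← hρ s t]
  refine integral_congr_ae (Eventually.of_forall fun p => ?_)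
  simp only
  congr 3
  rw [← L.sum_comp_single]
  simp only [hL, inner_sum, real_inner_smul_right, Finset.sum_add_distrib]

end FiniteDimensional

/-! ### The joint law is dominated by μ ⊗ μ in the L² sense -/

section Kernel

variable {H : Type*} [NormedAddCommGroup H] [InnerProductSpace ℝ H] [CompleteSpace H]
  [MeasurableSpace H] [BorelSpace H] [SecondCountableTopology H]
  {S : ℝ → H →L[ℝ] H} {Q V : H →L[ℝ] H} {Vt : ℝ → H →L[ℝ] H} {T₀ : ℝ → H →L[ℝ] H}

theorem inv_one_sub_le_exp {x c : ℝ} (hx : 0 ≤ x) (hxc : x ≤ c) (hc : c < 1) :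
    (1 - x)⁻¹ ≤ Real.exp (x / (1 - c)) := by
  have h1 : 0 < 1 - c := by linarith
  have h2 : 0 < 1 - x := by linarith
  calc (1 - x)⁻¹ = x / (1 - x) + 1 := by field_simp; ring
    _ ≤ x / (1 - c) + 1 := by gcongr
    _ ≤ _ := Real.add_one_le_exp _

theorem integral_exp_prod {ν : Measure H} (hν : IsGaussianMeasure 0 V ν) (a b : H) :
    ∫ p, Complex.exp ((⟪p.1, a⟫ + ⟪p.2, b⟫ : ℝ) * Complex.I) ∂(ν.prod ν) =
      Complex.exp ((-(⟪V a, a⟫ + ⟪V b, b⟫) / 2 : ℝ)) := by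
  have := hν.1
  have e : ∀ p : H × H, Complex.exp ((⟪p.1, a⟫ + ⟪p.2, b⟫ : ℝ) * Complex.I) =
      Complex.exp ((⟪p.1, a⟫ : ℝ) * Complex.I) * Complex.exp ((⟪p.2, b⟫ : ℝ) * Complex.I) :=
    fun p => by
      rw [← Complex.exp_add]
      congr 1
      push_cast; ring
  simp only [e]
  rw [integral_prod_mul (μ := ν) (ν := ν) (fun x => Complex.exp ((⟪x, a⟫ : ℝ) * Complex.I))
    (fun y => Complex.exp ((⟪y, b⟫ : ℝ) * Complex.I)), ← charFun_apply, ← charFun_apply,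
    hν.2, hν.2, ← Complex.exp_add]
  congr 1
  push_cast
  simp
  ring

/-- `exp(‖T‖²_HS / (1 - ‖T‖²))`, a bound for the squared norm of the Mehler kernel associated with
`T`. -/
noncomputable def kernelBound (T : H →L[ℝ] H) : ℝ≥0∞ :=
  ENNReal.ofReal (Real.exp ((hsNormSq T).toReal / (1 - ‖T‖ ^ 2)))

theorem kernelBound_ne_top (T : H →L[ℝ] H) : kernelBound T ≠ ∞ := ENNReal.ofReal_ne_top

/-- The inequality 1/(1 - x) ≤ exp(x/(1 - c)) for 0 ≤ x ≤ c < 1 turns the product into the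
exponential of a sum of squared diagonal entries, which the Hilbert–Schmidt norm controls whatever
the number of factors. -/
theorem prod_ofReal_le_kernelBound {T : H →L[ℝ] H} (hT : hsNormSq T < ∞) (h1 : ‖T‖ < 1) {n : ℕ}
    {u : Fin n → H} (hu : Orthonormal ℝ u) :
    ∏ i, ENNReal.ofReal (1 - ⟪T (u i), u i⟫ ^ 2)⁻¹ ≤ kernelBound T := by
  have h2 : 0 < 1 - ‖T‖ ^ 2 := by nlinarith [norm_nonneg T]
  have hle : ∀ i, ⟪T (u i), u i⟫ ^ 2 ≤ ‖T (u i)‖ ^ 2 := fun i => by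
    have := abs_real_inner_le_norm (T (u i)) (u i)
    rw [hu.1, mul_one] at this
    exact sq_le_sq' (abs_le.1 this).1 (abs_le.1 this).2
  have hsum : ∑ i, ‖T (u i)‖ ^ 2 ≤ (hsNormSq T).toReal := by
    have := tsum_enorm_apply_sq_le hu T
    rw [tsum_fintype] at this
    simp only [enorm_sq_eq_ofReal_norm_sq] at this
    rwa [← ENNReal.ofReal_sum_of_nonneg (fun i _ => sq_nonneg _),
      ENNReal.ofReal_le_iff_le_toReal hT.ne] at this
  have hn : ∀ i, ‖T (u i)‖ ^ 2 ≤ ‖T‖ ^ 2 := fun i => by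
    have := T.le_opNorm (u i)
    rw [hu.1, mul_one] at this
    gcongr
  rw [← ENNReal.ofReal_prod_of_nonneg (fun i _ => inv_nonneg.2 (by linarith [hle i, hn i]))]
  refine ENNReal.ofReal_le_ofReal ?_
  calc ∏ i, (1 - ⟪T (u i), u i⟫ ^ 2)⁻¹
      ≤ ∏ i, Real.exp (⟪T (u i), u i⟫ ^ 2 / (1 - ‖T‖ ^ 2)) :=
        Finset.prod_le_prod (fun i _ => inv_nonneg.2 (by linarith [hle i, hn i])) fun i _ =>
          inv_one_sub_le_exp (sq_nonneg _) ((hle i).trans (hn i)) (by linarith)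
    _ = Real.exp ((∑ i, ⟪T (u i), u i⟫ ^ 2) / (1 - ‖T‖ ^ 2)) := by
        rw [← Real.exp_sum, Finset.sum_div]
    _ ≤ _ := by
        gcongr
        exact (Finset.sum_le_sum fun i _ => hle i).trans hsum

theorem inner_posSqrt_sum {T : H →L[ℝ] H} {n : ℕ} {u w : Fin n → H}
    (hT : ∀ i j, i ≠ j → ⟪T (u i), u j⟫ = 0) (hw : ∀ i, posSqrt V (w i) = u i) (s t : Fin n → ℝ) :
    ⟪T (posSqrt V (∑ i, s i • w i)), posSqrt V (∑ i, t i • w i)⟫ =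
      ∑ i, ⟪T (u i), u i⟫ * s i * t i := by
  simp only [map_sum, map_smul, hw, sum_inner, inner_sum, real_inner_smul_left,
    real_inner_smul_right]
  refine Finset.sum_congr rfl fun i _ => ?_
  rw [Finset.sum_eq_single i (fun j _ hij => by rw [hT j i hij]; ring) (by simp)]
  ring

namespace IsCovariance

/-- On finite-dimensional cylinders, the joint law of `(Z(0), Z(t))` has a density with respect to
`μ ⊗ μ` which is bounded in `L²` uniformly in the cylinder. -/
theorem sqDominates_map (hV : IsCovariance S Q V Vt) (hinj : Function.Injective V)
    (hT₀ : IsSymmetrization S V T₀) {t : ℝ} (ht : 0 ≤ t) (hHS : hsNormSq (T₀ t) < ∞)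
    (h1 : ‖T₀ t‖ < 1) (s : Finset (basisSet H)) :
    ∃ (n : ℕ) (w : Fin n → H), (∀ j ∈ s, basis H j ∈ Submodule.span ℝ (range w)) ∧
      SqDominates (kernelBound (T₀ t))
        (((invMeasure S Q).prod (invMeasure S Q)).map fun p i => (⟪p.1, w i⟫, ⟪p.2, w i⟫))
        ((jointLaw S Q t).map fun p i => (⟪p.1, w i⟫, ⟪p.2, w i⟫)) := by
  classical
  have := hV.isProbabilityMeasure_inf
  have := hV.isProbabilityMeasure_jointLaw t
  have hVp := hV.isPositive
  set M := posSqrt V with hM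
  set E₀ : Submodule ℝ H := Submodule.span ℝ (s.image (basis H)) with hE₀
  -- Under μ the covariance of `⟪·, a⟫` and `⟪·, b⟫` is `⟪M a, M b⟫`. Orthonormal vectors `u i = M
  -- (w i)` in the image thus give standard coordinates `⟪·, w i⟫`, and diagonalising `T₀ t` there
  -- decouples the pairs.
  set E : Submodule ℝ H := E₀.map M.toLinearMap with hE
  have : FiniteDimensional ℝ E₀ := FiniteDimensional.span_finset ℝ _
  obtain ⟨n, u, hu, huE, hrep, hdiag⟩ := exists_diagonalization (hT₀.inner_apply ht) E
  have hex : ∀ i, ∃ w ∈ E₀, M w = u i := fun i => huE i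
  choose w hwE hw using hex
  have hr : ∀ i, |⟪T₀ t (u i), u i⟫| < 1 := fun i => by
    refine lt_of_le_of_lt ((abs_real_inner_le_norm _ _).trans ?_) h1
    have := (T₀ t).le_opNorm (u i)
    rwa [hu.1, mul_one] at this ⊢
  have hw1 : ∀ a b : Fin n → ℝ,
      ⟪M (∑ i, a i • w i), M (∑ i, b i • w i)⟫ = ∑ i, a i * b i := fun a b => by
    have := inner_posSqrt_sum (T := ContinuousLinearMap.id ℝ H) (V := V) (u := u) (w := w)
      (fun i j hij => hu.2 hij) hw a b
    simp only [ContinuousLinearMap.id_apply] at this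
    rw [this]
    refine Finset.sum_congr rfl fun i _ => ?_
    rw [real_inner_self_eq_norm_sq, hu.1]; ring
  refine ⟨n, w, fun j hj => ?_, ?_⟩
  · have hb : M (basis H j) ∈ E :=
      ⟨basis H j, Submodule.subset_span (Finset.mem_coe.2 (Finset.mem_image_of_mem _ hj)), rfl⟩
    have : basis H j = ∑ i, ⟪u i, M (basis H j)⟫ • w i := by
      refine injective_posSqrt hVp hinj ?_
      rw [map_sum]
      simp only [map_smul]
      rw [← hM]
      simp only [hw]
      exact hrep _ hb
    rw [this]
    exact Submodule.sum_mem _ fun i _ => Submodule.smul_mem _ _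
      (Submodule.subset_span (mem_range_self i))
  · rw [map_eq_pi_correlatedGaussian (ρ := jointLaw S Q t) w (fun i => (hr i).le) fun a b => ?_,
      map_eq_pi_correlatedGaussian (ρ := (invMeasure S Q).prod (invMeasure S Q)) w (r := fun _ => 0)
        (by simp) fun a b => ?_]
    · refine (SqDominates.pi fun i => ?_).mono (prod_ofReal_le_kernelBound hHS h1 hu)
      rw [correlatedGaussian_zero]
      exact sqDominates_correlatedGaussian (hr i)
    · rw [integral_exp_prod hV.isGaussianMeasure_inf]
      congr 2
      rw [← inner_posSqrt_posSqrt hVp, ← inner_posSqrt_posSqrt hVp, hw1, hw1,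
        ← Finset.sum_add_distrib]
      congr 2
      refine Finset.sum_congr rfl fun i _ => ?_
      ring
    · rw [hV.charFun_jointLaw ht]
      congr 2
      rw [← hT₀.inner_apply_sqrt hVp ht, inner_posSqrt_sum hdiag hw,
        ← inner_posSqrt_posSqrt hVp, ← inner_posSqrt_posSqrt hVp, hw1, hw1, Finset.mul_sum,
        ← Finset.sum_add_distrib, ← Finset.sum_add_distrib]
      congr 2
      refine Finset.sum_congr rfl fun i _ => ?_
      ring

end IsCovariance

/-- The orthogonal projection onto the span of finitely many basis vectors. -/
noncomputable def basisProj (s : Finset (basisSet H)) : H →L[ℝ] H :=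
  ∑ j ∈ s, (innerSL ℝ (basis H j)).smulRight (basis H j)

theorem basisProj_apply (s : Finset (basisSet H)) (x : H) :
    basisProj s x = ∑ j ∈ s, ⟪basis H j, x⟫ • basis H j := by
  simp [basisProj]

theorem tendsto_basisProj (x : H) : Tendsto (fun s => basisProj s x) atTop (𝓝 x) := by
  have h := (basis H).hasSum_repr x
  simp only [HilbertBasis.repr_apply_apply] at h
  simp only [basisProj_apply]
  exact h

namespace IsCovariance

/-- For a bounded continuous function, composing with a finite projection gives a cylinder function,
to which the uniform bound applies. The projections converge strongly to the identity, and the bound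
survives. -/
theorem sqDominates_jointLaw (hV : IsCovariance S Q V Vt) (hinj : Function.Injective V)
    (hT₀ : IsSymmetrization S V T₀) {t : ℝ} (ht : 0 ≤ t) (hHS : hsNormSq (T₀ t) < ∞)
    (h1 : ‖T₀ t‖ < 1) :
    SqDominates (kernelBound (T₀ t)) ((invMeasure S Q).prod (invMeasure S Q)) (jointLaw S Q t) := by
  have := hV.isProbabilityMeasure_inf
  have := hV.isProbabilityMeasure_jointLaw t
  refine SqDominates.of_boundedContinuous (kernelBound_ne_top _) fun g => ?_
  have hlim : ∀ {m : Measure (H × H)} [IsProbabilityMeasure m] {k : ℕ},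
      Tendsto (fun s => ∫⁻ p, ‖g (basisProj s p.1, basisProj s p.2)‖ₑ ^ k ∂m) atTop
        (𝓝 (∫⁻ p, ‖g p‖ₑ ^ k ∂m)) := by
    intro m _ k
    refine tendsto_lintegral_filter_of_dominated_convergence (fun _ => ‖g‖ₑ ^ k)
      (Eventually.of_forall fun s =>
        Continuous.measurable (by fun_prop)) (Eventually.of_forall fun s =>
        Eventually.of_forall fun p => ?_) (by simp) (Eventually.of_forall fun p => ?_)
    · gcongr
      exact enorm_le_iff_norm_le.2 (g.norm_coe_le_norm _)
    · have hp := (tendsto_basisProj p.1).prodMk_nhds (tendsto_basisProj p.2)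
      exact (ENNReal.continuous_pow k).tendsto _ |>.comp
        ((continuous_enorm.tendsto _).comp ((g.continuous.tendsto _).comp hp))
  have h2 := hlim (m := (invMeasure S Q).prod (invMeasure S Q)) (k := 2)
  have h3 := hlim (m := jointLaw S Q t) (k := 1)
  simp only [pow_one] at h3
  refine le_of_tendsto_of_tendsto' ((ENNReal.continuous_pow 2).tendsto _ |>.comp h3)
    (ENNReal.Tendsto.const_mul h2 (Or.inr (kernelBound_ne_top _))) fun s => ?_
  obtain ⟨n, w, hw, hdom⟩ := hV.sqDominates_map hinj hT₀ ht hHS h1 s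
  have hc : ∀ j, ∃ c : Fin n → ℝ, j ∈ s → ∑ i, c i • w i = basis H j := fun j => by
    by_cases hj : j ∈ s
    · obtain ⟨c, hc⟩ := (Submodule.mem_span_range_iff_exists_fun ℝ).1 (hw j hj)
      exact ⟨c, fun _ => hc⟩
    · exact ⟨0, fun h => absurd h hj⟩
  choose c hc using hc
  -- `A` rebuilds the projected vector from the cylinder coordinates, since each basis vector
  -- indexed by `s` is a combination of the `w i`.
  set A : (Fin n → ℝ) → H := fun z => ∑ j ∈ s, (∑ i, c j i * z i) • basis H j with hA
  have hAm : Continuous A := by fun_prop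
  have hAp : ∀ x, basisProj s x = A fun i => ⟪x, w i⟫ := fun x => by
    rw [basisProj_apply, hA]
    refine Finset.sum_congr rfl fun j hj => ?_
    congr 1
    conv_lhs => rw [← hc j hj]
    rw [sum_inner]
    refine Finset.sum_congr rfl fun i _ => ?_
    rw [real_inner_smul_left, real_inner_comm]
  have hG : Measurable fun z : Fin n → ℝ × ℝ => ‖g (A fun i => (z i).1, A fun i => (z i).2)‖ₑ := by
    refine Continuous.measurable ?_
    fun_prop
  have := hdom _ hG
  rw [lintegral_map hG (by fun_prop), lintegral_map (hG.pow_const 2) (by fun_prop)] at this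
  simpa only [Function.comp_def, hAp] using this

end IsCovariance

end Kernel

end OrnsteinUhlenbeck

namespace OrnsteinUhlenbeck

open ProbabilityTheory

/-! ### From domination of the joint law to the Hilbert–Schmidt property -/

section HilbertSchmidt

variable {H : Type*} [NormedAddCommGroup H] [InnerProductSpace ℝ H] [CompleteSpace H]
  [MeasurableSpace H] [BorelSpace H] [SecondCountableTopology H]
  {S : ℝ → H →L[ℝ] H} {Q V : H →L[ℝ] H} {Vt : ℝ → H →L[ℝ] H}

/-- An operator on `L²(H, μ)` whose bilinear form is given by a measure with a square integrable
density is Hilbert–Schmidt. -/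
theorem IsCovariance.hsNormSq_transitionL2_le (hV : IsCovariance S Q V Vt)
    (hsymm : IsSymmetricOU S Q) {t : ℝ} (ht : 0 ≤ t) {c : ℝ≥0∞}
    (hc : SqDominates c ((invMeasure S Q).prod (invMeasure S Q)) (jointLaw S Q t)) :
    hsNormSq (transitionL2 S Q t) ≤ c := by
  have := hV.isProbabilityMeasure_inf
  have := hV.isProbabilityMeasure_jointLaw t
  set R := transitionL2 S Q t with hR
  set b := basis (L2 S Q) with hb
  rw [hsNormSq, ENNReal.tsum_eq_iSup_sum]
  refine iSup_le fun s => ?_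
  -- This is the optimal test function: its integral against the joint law and, by orthonormality of
  -- `b`, the integral of its square against μ ⊗ μ both equal `A`. Domination then reads `A ^ 2 ≤ c
  -- * A`.
  set G : H × H → ℝ := fun p => ∑ i ∈ s, b i p.2 * R (b i) p.1 with hG
  have hm : ∀ f : L2 S Q, Measurable f := fun f => (Lp.stronglyMeasurable f).measurable
  have hGm : Measurable G := Finset.measurable_sum _ fun i _ =>
    ((hm _).comp measurable_snd).mul ((hm _).comp measurable_fst)
  have hL2 : ∀ f : L2 S Q, MemLp f 2 (invMeasure S Q) := Lp.memLp
  have hinner : ∀ f g : L2 S Q, ⟪f, g⟫ = ∫ x, f x * g x ∂(invMeasure S Q) := fun f g => by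
    rw [L2.inner_def]
    refine integral_congr_ae (Eventually.of_forall fun x => ?_)
    exact real_inner_comm _ _ |>.trans rfl
  set A : ℝ := ∑ i ∈ s, ‖R (b i)‖ ^ 2 with hA
  have h1 : A = ∫ p, G p ∂(jointLaw S Q t) := by
    have hi : ∀ i, Integrable (fun p : H × H => b i p.2 * R (b i) p.1) (jointLaw S Q t) := fun i =>
      ((hL2 _).comp_measurePreserving (hV.measurePreserving_snd hsymm ht)).integrable_mul
        ((hL2 _).comp_measurePreserving (hV.measurePreserving_fst t))
    rw [integral_finsetSum s fun i _ => hi i]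
    refine Finset.sum_congr rfl fun i _ => ?_
    rw [← real_inner_self_eq_norm_sq, ← hV.inner_transitionL2 hsymm ht (hL2 _) (hL2 _),
      Lp.toLp_coeFn, Lp.toLp_coeFn]
  have hint : ∀ f f' g g' : L2 S Q, Integrable (fun p : H × H => f p.2 * g p.1 * (f' p.2 * g' p.1))
      ((invMeasure S Q).prod (invMeasure S Q)) := fun f f' g g' => by
    have := ((hL2 g).integrable_mul (hL2 g')).mul_prod ((hL2 f).integrable_mul (hL2 f'))
    refine this.congr (Eventually.of_forall fun p => ?_)
    simp only [Pi.mul_apply]; ring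
  have hval : ∀ f f' g g' : L2 S Q, ∫ p : H × H, f p.2 * g p.1 * (f' p.2 * g' p.1)
      ∂((invMeasure S Q).prod (invMeasure S Q)) = ⟪g, g'⟫ * ⟪f, f'⟫ := fun f f' g g' => by
    rw [hinner, hinner, ← integral_prod_mul]
    refine integral_congr_ae (Eventually.of_forall fun p => ?_)
    simp only; ring
  have e2 : ∀ p, G p ^ 2 = ∑ i ∈ s, ∑ j ∈ s, b i p.2 * R (b i) p.1 * (b j p.2 * R (b j) p.1) :=
    fun p => by rw [pow_two, hG, Finset.sum_mul_sum]
  have h2 : ∫ p, G p ^ 2 ∂((invMeasure S Q).prod (invMeasure S Q)) = A := by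
    simp only [e2]
    rw [integral_finsetSum _ fun i _ => integrable_finsetSum _ fun j _ => hint _ _ _ _]
    refine Finset.sum_congr rfl fun i hi => ?_
    rw [integral_finsetSum _ fun j _ => hint _ _ _ _, Finset.sum_eq_single i]
    · rw [hval, real_inner_self_eq_norm_sq, real_inner_self_eq_norm_sq, b.orthonormal.1]; ring
    · intro j _ hij
      rw [hval, b.orthonormal.2 hij.symm, mul_zero]
    · exact fun h => absurd hi h
  have h3 : ∫⁻ p, ‖G p‖ₑ ^ 2 ∂((invMeasure S Q).prod (invMeasure S Q)) = ENNReal.ofReal A := by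
    have hi : Integrable (fun p => G p ^ 2) ((invMeasure S Q).prod (invMeasure S Q)) := by
      simp only [e2]
      exact integrable_finsetSum _ fun i _ => integrable_finsetSum _ fun j _ => hint _ _ _ _
    rw [← h2, ofReal_integral_eq_lintegral_ofReal hi (Eventually.of_forall fun p => sq_nonneg _)]
    refine lintegral_congr fun p => ?_
    rw [enorm_sq_eq_ofReal_norm_sq, Real.norm_eq_abs, sq_abs]
  have h4 : ENNReal.ofReal A ≤ ∫⁻ p, ‖G p‖ₑ ∂(jointLaw S Q t) := by
    rw [h1]
    refine le_trans ?_ (enorm_integral_le_lintegral_enorm G)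
    rw [← ofReal_norm]
    exact ENNReal.ofReal_le_ofReal (Real.le_norm_self _)
  have h5 : ENNReal.ofReal A ^ 2 ≤ c * ENNReal.ofReal A := by
    rw [← h3]
    exact (pow_le_pow_left' (h3 ▸ h4) 2).trans (hc _ hGm.enorm)
  have h6 : ∑ i ∈ s, ‖R (b i)‖ₑ ^ 2 = ENNReal.ofReal A := by
    rw [hA, ENNReal.ofReal_sum_of_nonneg fun i _ => sq_nonneg _]
    simp only [enorm_sq_eq_ofReal_norm_sq]
  rw [h6]
  by_cases hz : ENNReal.ofReal A = 0
  · rw [hz]; exact zero_le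
  · rw [pow_two] at h5
    exact (ENNReal.mul_le_mul_iff_left hz ENNReal.ofReal_ne_top).1 h5

end HilbertSchmidt

end OrnsteinUhlenbeck

namespace OrnsteinUhlenbeck

open ProbabilityTheory

/-! ### When μ is concentrated on the range of Q^{1/2} -/

section Support

variable {H : Type*} [NormedAddCommGroup H] [InnerProductSpace ℝ H] [CompleteSpace H]

/-- This lets the covariance results apply to a semigroup driven by the identity instead of Q. -/
theorem trace_covKernel_one (T : ℝ → H →L[ℝ] H) (s : ℝ) : trace (covKernel T 1 s) = hsNormSq (T s) := by
  rw [← hsNormSq_adjoint, trace, hsNormSq]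
  refine tsum_congr fun i => ?_
  rw [enorm_sq_eq_ofReal_norm_sq, inner_covKernel, one_apply_eq_self,
    real_inner_self_eq_norm_sq]

/-- A finite integral yields a Hilbert–Schmidt operator at some time before `t`, and composing on
the left with a bounded operator preserves the property. -/
theorem IsC0Semigroup.isHilbertSchmidtSemigroup {T : ℝ → H →L[ℝ] H} (hT : IsC0Semigroup T)
    (h : ∫⁻ t in Ioi (0 : ℝ), hsNormSq (T t) < ∞) : IsHilbertSchmidtSemigroup T := by
  intro t ht
  have h1 : ∫⁻ s in Ioo 0 t, hsNormSq (T s) ≠ ∞ :=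
    ((lintegral_mono_set Ioo_subset_Ioi_self).trans_lt h).ne
  obtain ⟨s, hs, hs'⟩ : ∃ s ∈ Ioo 0 t, hsNormSq (T s) < ∞ := by
    by_contra! hcon
    refine h1 (top_unique ?_)
    calc (∞ : ℝ≥0∞) = ∫⁻ _ in Ioo 0 t, ∞ := by simp [ht]
      _ ≤ _ := setLIntegral_mono' measurableSet_Ioo hcon
  have e : T t = T (t - s) ∘L T s := by
    rw [← hT.map_add _ _ (sub_nonneg.2 hs.2.le) hs.1.le, sub_add_cancel]
  rw [e]
  exact (hsNormSq_comp_le _ _).trans_lt (ENNReal.mul_lt_top (by simp) hs')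

variable [MeasurableSpace H] [BorelSpace H] [SecondCountableTopology H]
  {S : ℝ → H →L[ℝ] H} {Q V : H →L[ℝ] H} {Vt : ℝ → H →L[ℝ] H} {T₁ : ℝ → H →L[ℝ] H}

namespace IsSymmetrization

theorem inner_covKernel_one (hT : IsSymmetrization S Q T₁) (hQ : Q.IsPositive) {s : ℝ} (hs : 0 ≤ s)
    (x y : H) :
    ⟪covKernel T₁ 1 s (posSqrt Q x), posSqrt Q y⟫ = ⟪covKernel S Q s x, y⟫ := by
  rw [inner_covKernel, inner_covKernel, one_apply_eq_self,
    (hT.isSelfAdjoint s hs).adjoint_eq, hT.apply_sqrt s hs, hT.apply_sqrt s hs,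
    inner_posSqrt_posSqrt hQ]

/-- The integral of T₁T₁* is a trace class covariance, and its conjugate by Q^{1/2} is `V`. By
uniqueness μ is an image measure under Q^{1/2}. -/
theorem invMeasure_range_eq_one (hT : IsSymmetrization S Q T₁) (hV : IsCovariance S Q V Vt)
    (hQ : Q.IsPositive) (h : ∫⁻ t in Ioi (0 : ℝ), hsNormSq (T₁ t) < ∞) :
    invMeasure S Q (range (posSqrt Q)) = 1 := by
  have := hV.isProbabilityMeasure_inf
  simp only [← trace_covKernel_one] at h
  obtain ⟨L, hL, htr, -, hin⟩ :=
    exists_integral_covKernel hT.isC0Semigroup ContinuousLinearMap.isPositive_one h subset_rfl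
  obtain ⟨ν, hν⟩ := exists_isGaussianMeasure_zero hL htr
  have := hν.1
  have hq := (posSqrt_spec hQ).1.isSelfAdjoint.adjoint_eq
  have hcov : posSqrt Q ∘L L ∘L ContinuousLinearMap.adjoint (posSqrt Q) = V := by
    refine ContinuousLinearMap.ext fun x => ext_inner_right ℝ fun y => ?_
    change ⟪posSqrt Q (L (ContinuousLinearMap.adjoint (posSqrt Q) x)), y⟫ = _
    rw [hq, inner_posSqrt_left hQ, hin, hV.inner_eq]
    exact setIntegral_congr_fun measurableSet_Ioi fun s hs =>
      hT.inner_covKernel_one hQ (le_of_lt hs) x y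
  have hmap := hν.map (posSqrt Q)
  rw [hcov] at hmap
  have e := hmap.unique hV.isGaussianMeasure_inf
  refine le_antisymm prob_le_one ?_
  calc (1 : ℝ≥0∞) = ν (posSqrt Q ⁻¹' range (posSqrt Q)) := by
        rw [preimage_range, measure_univ]
    _ ≤ _ := by
        rw [← e]
        exact Measure.le_map_apply (by fun_prop) _

end IsSymmetrization

/-- If `N(0, C)` is concentrated on the range of an injective operator `A`, then it is the image
under `A` of a measure with finite second moment. -/
theorem IsGaussianMeasure.exists_map_eq {C A : H →L[ℝ] H} (hC : C.IsPositive) {μ : Measure H}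
    (hμ : IsGaussianMeasure 0 C μ) (hA : Function.Injective A) (h : μ (range A) = 1) :
    ∃ ν : Measure H, IsProbabilityMeasure ν ∧ ν.map A = μ ∧ ∫⁻ x, ‖x‖ₑ ^ 2 ∂ν < ∞ := by
  have := hμ.1
  obtain ⟨hg, h0, -⟩ := hμ.isGaussian_and_covarianceBilin hC
  have hAe : MeasurableEmbedding A := A.continuous.measurableEmbedding hA
  set ν := μ.comap A with hν
  have hmap : ν.map A = μ := by
    rw [hν, hAe.map_comap]
    refine Measure.restrict_eq_self_of_ae_mem ?_
    rw [ae_iff_prob_eq_one]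
    · exact h
    · exact hAe.measurableSet_range.mem
  have hprob : IsProbabilityMeasure ν := by
    have : IsProbabilityMeasure (ν.map A) := by rw [hmap]; infer_instance
    exact (Measure.isProbabilityMeasure_map_iff (by fun_prop)).1 this
  refine ⟨ν, hprob, hmap, ?_⟩
  have hAA : MeasurableEmbedding (Prod.map A A) :=
    (A.continuous.prodMap A.continuous).measurableEmbedding (hA.prodMap hA)
  have hmap2 : (ν.prod ν).map (Prod.map A A) = μ.prod μ := by
    rw [← Measure.map_prod_map _ _ (by fun_prop) (by fun_prop), hmap]
  -- Rotations mix the two copies linearly, so they commute with `Prod.map A A`. The invariance of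
  -- `μ.prod μ` is pulled back through this embedding, and Fernique's theorem needs only this
  -- invariance of `ν.prod ν`.
  have hrot : (ν.prod ν).map (ContinuousLinearMap.rotation (-(Real.pi / 4))) = ν.prod ν := by
    have e : ((ν.prod ν).map (ContinuousLinearMap.rotation (-(Real.pi / 4)))).map (Prod.map A A) =
        (ν.prod ν).map (Prod.map A A) := by
      rw [Measure.map_map hAA.measurable (by fun_prop)]
      have hcomm : Prod.map A A ∘ (ContinuousLinearMap.rotation (-(Real.pi / 4)) : H × H →L[ℝ] H × H)
          = (ContinuousLinearMap.rotation (-(Real.pi / 4)) : H × H →L[ℝ] H × H) ∘ Prod.map A A := by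
        funext p
        simp [ContinuousLinearMap.rotation_apply]
      rw [hcomm, ← Measure.map_map (by fun_prop) hAA.measurable, hmap2]
      exact IsGaussian.map_rotation_eq_self (by simpa using h0) _
    rw [← hAA.comap_map ((ν.prod ν).map _), e, hAA.comap_map]
  obtain ⟨c, hc, hint⟩ := exists_integrable_exp_sq_of_map_rotation_eq_self hrot
  have hle : ∀ x : H, ‖x‖ₑ ^ 2 ≤ ENNReal.ofReal c⁻¹ * ‖Real.exp (c * ‖x‖ ^ 2)‖ₑ := fun x => by
    rw [enorm_sq_eq_ofReal_norm_sq, ← ofReal_norm, Real.norm_of_nonneg (Real.exp_pos _).le,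
      ← ENNReal.ofReal_mul (inv_nonneg.2 hc.le)]
    refine ENNReal.ofReal_le_ofReal ?_
    rw [le_inv_mul_iff₀ hc]
    linarith [Real.add_one_le_exp (c * ‖x‖ ^ 2)]
  refine (lintegral_mono hle).trans_lt ?_
  rw [lintegral_const_mul' _ _ ENNReal.ofReal_ne_top]
  exact ENNReal.mul_lt_top ENNReal.ofReal_lt_top hint.2

namespace IsSymmetrization

/-- For `y` in the range of Q^{1/2} both sides equal `⟪V z, z⟫`, where `y = posSqrt Q z`. Density
gives the rest: Fatou on the left, dominated convergence by the second moment of `ν` on the right.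
-/
theorem lintegral_enorm_apply_sq_le (hT : IsSymmetrization S Q T₁) (hV : IsCovariance S Q V Vt)
    (hS : IsC0Semigroup S) (hQ : Q.IsPositive)
    (htr : ∫⁻ s in Ioi (0 : ℝ), trace (covKernel S Q s) < ∞) (hinj : Function.Injective Q)
    {ν : Measure H} (hν : ν.map (posSqrt Q) = invMeasure S Q) (h2 : ∫⁻ x, ‖x‖ₑ ^ 2 ∂ν < ∞) (y : H) :
    ∫⁻ s in Ioi (0 : ℝ), ‖T₁ s y‖ₑ ^ 2 ≤ ∫⁻ x, ‖⟪y, x⟫‖ₑ ^ 2 ∂ν := by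
  have hμ := hV.isGaussianMeasure_inf
  have heq : ∀ z, ∫⁻ s in Ioi (0 : ℝ), ‖T₁ s (posSqrt Q z)‖ₑ ^ 2 =
      ∫⁻ x, ‖⟪posSqrt Q z, x⟫‖ₑ ^ 2 ∂ν := fun z => by
    have e1 : ∀ x, ⟪posSqrt Q z, x⟫ = ⟪z, posSqrt Q x⟫ := fun x => inner_posSqrt_left hQ z x
    have e2 := lintegral_map (μ := ν) (g := posSqrt Q) (f := fun x => ‖⟪z, x⟫‖ₑ ^ 2)
      (by fun_prop) (by fun_prop)
    have i1 := IsCovariance.memLp_inner hV.isPositive hμ z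
    have e3 : ∀ r : ℝ, ‖r‖ₑ ^ 2 = ENNReal.ofReal (r * r) := fun r => by
      rw [enorm_sq_eq_ofReal_norm_sq, Real.norm_eq_abs, sq_abs, pow_two]
    simp only [e1]
    rw [← e2, hν]
    simp only [e3]
    have i2 : Integrable (fun x => ⟪z, x⟫ * ⟪z, x⟫) (invMeasure S Q) := i1.integrable_mul i1
    rw [← ofReal_integral_eq_lintegral_ofReal i2
      (Eventually.of_forall fun x => mul_self_nonneg _), hμ.integral_inner_mul_inner hV.isPositive,
      hV.inner_eq, ofReal_integral_eq_lintegral_ofReal (IsCovariance.inner_covKernel_integrableOn hS hQ htr z z)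
      (Eventually.of_forall fun s => (isPositive_covKernel S hQ s).inner_nonneg_left z)]
    refine setLIntegral_congr_fun measurableSet_Ioi fun s hs => ?_
    rw [enorm_sq_eq_ofReal_norm_sq, hT.norm_apply_sqrt_sq hQ (le_of_lt hs)]
  obtain ⟨w, hw, hlim⟩ := mem_closure_iff_seq_limit.1 (denseRange_posSqrt hQ hinj y)
  have hr : Tendsto (fun n => ∫⁻ x, ‖⟪w n, x⟫‖ₑ ^ 2 ∂ν) atTop (𝓝 (∫⁻ x, ‖⟪y, x⟫‖ₑ ^ 2 ∂ν)) := by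
    obtain ⟨K, hK⟩ := hlim.norm.bddAbove_range
    refine tendsto_lintegral_of_dominated_convergence (fun x => ENNReal.ofReal (K ^ 2) * ‖x‖ₑ ^ 2)
      (fun n => by fun_prop) (fun n => Eventually.of_forall fun x => ?_) ?_
      (Eventually.of_forall fun x => ?_)
    · simp only [enorm_sq_eq_ofReal_norm_sq]
      rw [← ENNReal.ofReal_mul (sq_nonneg K), ← mul_pow]
      refine ENNReal.ofReal_le_ofReal (pow_le_pow_left₀ (norm_nonneg _) ?_ 2)
      exact (norm_inner_le_norm _ _).trans (by gcongr; exact hK ⟨n, rfl⟩)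
    · rw [lintegral_const_mul' _ _ ENNReal.ofReal_ne_top]
      exact (ENNReal.mul_lt_top ENNReal.ofReal_lt_top h2).ne
    · have hx : Tendsto (fun n => ⟪w n, x⟫) atTop (𝓝 ⟪y, x⟫) := hlim.inner tendsto_const_nhds
      exact (ENNReal.continuous_pow 2).tendsto _ |>.comp ((continuous_enorm.tendsto _).comp hx)
  have hl : ∀ n, ∫⁻ s in Ioi (0 : ℝ), ‖T₁ s (w n)‖ₑ ^ 2 = ∫⁻ x, ‖⟪w n, x⟫‖ₑ ^ 2 ∂ν := fun n => by
    obtain ⟨z, hz⟩ := hw n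
    rw [← hz, heq]
  have hpt : ∀ s, Tendsto (fun n => ‖T₁ s (w n)‖ₑ ^ 2) atTop (𝓝 (‖T₁ s y‖ₑ ^ 2)) := fun s =>
    (ENNReal.continuous_pow 2).tendsto _ |>.comp ((continuous_enorm.tendsto _).comp
      (((T₁ s).continuous.tendsto y).comp hlim))
  calc ∫⁻ s in Ioi (0 : ℝ), ‖T₁ s y‖ₑ ^ 2
      = ∫⁻ s in Ioi (0 : ℝ), liminf (fun n => ‖T₁ s (w n)‖ₑ ^ 2) atTop :=
        lintegral_congr fun s => (hpt s).liminf_eq.symm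
    _ ≤ liminf (fun n => ∫⁻ s in Ioi (0 : ℝ), ‖T₁ s (w n)‖ₑ ^ 2) atTop :=
        lintegral_liminf_le' fun n =>
          (((hT.isC0Semigroup.continuousOn (w n)).mono Ioi_subset_Ici_self).aestronglyMeasurable
            measurableSet_Ioi).enorm.pow_const 2
    _ = _ := by
        simp only [hl]
        exact hr.liminf_eq

/-- Summing the previous bound over the basis turns its right side, by Parseval, into the second
moment of `ν`. -/
theorem lintegral_hsNormSq_lt_top (hT : IsSymmetrization S Q T₁) (hV : IsCovariance S Q V Vt)
    (hS : IsC0Semigroup S) (hQ : Q.IsPositive)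
    (htr : ∫⁻ s in Ioi (0 : ℝ), trace (covKernel S Q s) < ∞) (hinj : Function.Injective Q)
    (h : invMeasure S Q (range (posSqrt Q)) = 1) :
    ∫⁻ t in Ioi (0 : ℝ), hsNormSq (T₁ t) < ∞ := by
  obtain ⟨ν, hν1, hν, h2⟩ := hV.isGaussianMeasure_inf.exists_map_eq hV.isPositive
    (injective_posSqrt hQ hinj) h
  simp only [hsNormSq]
  rw [lintegral_tsum fun i => ?_]
  · refine (ENNReal.tsum_le_tsum fun i =>
      hT.lintegral_enorm_apply_sq_le hV hS hQ htr hinj hν h2 _).trans_lt ?_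
    rw [← lintegral_tsum fun i => by fun_prop]
    simpa only [tsum_enorm_inner_sq] using h2
  · have := ((hT.isC0Semigroup.continuousOn (basis H i)).mono Ioi_subset_Ici_self).aestronglyMeasurable
      (μ := volume) measurableSet_Ioi
    exact this.enorm.pow_const 2

end IsSymmetrization

end Support

end OrnsteinUhlenbeck

open OrnsteinUhlenbeck in
/-- Let `S` be a strongly continuous semigroup on a separable real Hilbert space `H` and `Q` a
bounded selfadjoint nonnegative operator with `∫_0^∞ tr(S(s) Q S*(s)) ds < ∞` and `Q_∞` injective.
If `(R_t)` is symmetric, then the operators `R_t` on `L²(H, μ)` and `S_Q(t)` on `H` are well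
defined (first three conjuncts), and (a) and (b) hold. -/
theorem theorem5p1 {H : Type*} [NormedAddCommGroup H] [InnerProductSpace ℝ H] [CompleteSpace H]
    [SecondCountableTopology H] [MeasurableSpace H] [BorelSpace H]
    (S : ℝ → H →L[ℝ] H) (hS : IsC0Semigroup S)
    (Q : H →L[ℝ] H) (hQ : Q.IsPositive)
    (htr : ∫⁻ s in Set.Ioi (0 : ℝ), OrnsteinUhlenbeck.trace (covKernel S Q s) < ∞)
    (hinj : Function.Injective (covOpInf S Q))
    (hsymm : IsSymmetricOU S Q) :
    (∀ t, 0 ≤ t → IsL2Extension S Q t (transitionL2 S Q t)) ∧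
    Function.Injective (posSqrt Q) ∧
    (∀ t, 0 ≤ t → posSqrt Q ∘L SQ S Q t = S t ∘L posSqrt Q) ∧
    (IsHilbertSchmidtSemigroup (transitionL2 S Q) ↔
      IsHilbertSchmidtSemigroup (SQ S Q) ∧ IsExponentiallyStable (SQ S Q)) ∧
    (invMeasure S Q (Set.range (posSqrt Q)) = 1 ↔
      IsHilbertSchmidtSemigroup (SQ S Q) ∧
        ∫⁻ t in Set.Ioi (0 : ℝ), hsNormSq (SQ S Q t) < ∞) := by
  obtain ⟨V, Vt, hV⟩ := exists_isCovariance hS hQ htr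
  have hsV : Symmetrizes S V := fun t ht => hV.comp_eq_comp_adjoint hsymm ht
  have hVi : Function.Injective V := hV.injective_of_injective hinj
  have hsQ : Symmetrizes S Q := hV.symmetrizes_Q hS hsV
  have hQi : Function.Injective Q := hV.injective_Q hS hsQ hVi
  have hT₁ : IsSymmetrization S Q (SQ S Q) := isSymmetrization_SQ hS hQ hQi hsQ
  obtain ⟨T₀, h1, h2, h3, h4⟩ := hS.exists_symmetrization hV.isPositive hVi hsV
  have hT₀ : IsSymmetrization S V T₀ := ⟨h1, h2, h3, h4⟩
  obtain ⟨U, hU⟩ := hT₁.exists_unitary hV hS hQ htr hsV hVi hT₀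
  have hHS : ∀ t, 0 ≤ t → hsNormSq (SQ S Q t) = hsNormSq (T₀ t) := fun t ht =>
    hsNormSq_eq_of_intertwine U _ _ (hU t ht)
  refine ⟨fun t ht => hV.isL2Extension_transitionL2 hsymm ht, injective_posSqrt hQ hQi,
    hT₁.sqrt_comp, ⟨fun h => ?_, fun ⟨h, hstab⟩ t ht => ?_⟩, ⟨fun h => ?_, fun h => ?_⟩⟩
  · have h0 : IsHilbertSchmidtSemigroup T₀ := fun t ht =>
      (hV.hsNormSq_le_hsNormSq_transitionL2 hsymm hVi hT₀ hsV ht.le).trans_lt (h t ht)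
    refine ⟨fun t ht => (hHS t ht.le).trans_lt (h0 t ht), IsExponentiallyStable.of_intertwine ?_ U hU⟩
    exact h1.isExponentiallyStable_of_hsNormSq_lt_top (fun t ht => hT₀.norm_le_one hV hVi ht)
      (hT₀.tendsto_atTop hV hS hQ htr hVi) (h0 1 one_pos)
  · have hstab₀ : IsExponentiallyStable T₀ := hstab.of_intertwine U.symm fun t ht x => by
      rw [← U.symm_apply_apply (T₀ t (U.symm x)), ← hU t ht, U.apply_symm_apply]
    exact (hV.hsNormSq_transitionL2_le hsymm ht.le (hV.sqDominates_jointLaw hVi hT₀ ht.le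
      ((hHS t ht.le).symm.trans_lt (h t ht))
      (h1.norm_lt_one_of_isExponentiallyStable h2 hstab₀ ht))).trans_lt
      (kernelBound_ne_top _).lt_top
  · have hlt := hT₁.lintegral_hsNormSq_lt_top hV hS hQ htr hQi h
    exact ⟨hT₁.isC0Semigroup.isHilbertSchmidtSemigroup hlt, hlt⟩
  · exact hT₁.invMeasure_range_eq_one hV hQ h.2
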